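/- Let $\mathcal G$ be a braided stability groupoid, i.e. a strict braided monoidal skeletal groupoid whose monoid of objects is $(\mathbb N,+)$, with automorphism groups $G_n=\mathrm{Aut}(n)$, such that $\oplus\colon G_m\times G_n\to G_{m+n}$ is injective for all $m,n$, $G_0$ is trivial, and $(G_{l+m}\times 1)\cap(1\times G_{m+n})=1\times G_m\times 1$ in $G_{l+m+n}$ for all $l,m,n$. Let $U\mathcal G$ be the category with objects $\mathbb N$ whose morphisms $m\to n$ are the pairs $(f,c)$ with $f\colon c\oplus m\to n$ in $\mathcal G$, modulo $(f\circ(k\oplus \mathrm{id}_m),c)\sim(f,c)$ for $k\in G_c$, with composition $[f,c]\circ[g,d]=[f\circ(\mathrm{id}_c\oplus g),c\oplus d]$. A $U\mathcal G$-module (resp. $\mathcal G$-module) is a functor from $U\mathcal G$ (resp. $\mathcal G$) to abelian groups. *Standard connectivity assumption.* The $n$th splitting complex is the semi-simplicial set with $p$-simplices $$\bigsqcup_{n_0+\dots+n_{p+1}=n,\ n_j>0} G_n/(G_{n_0}\times\dots\times G_{n_{p+1}}),$$ the $i$th face map being induced by $G_{n_i}\times G_{n_{i+1}}\to G_{n_i+n_{i+1}}$.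 $\mathcal G$ satisfies the standard connectivity assumption if, for every $n$, the reduced homology of the $n$th splitting complex vanishes in all degrees $\le n-3$. *Polynomial degree.* For a $U\mathcal G$-module $A$ let $\Sigma A$ be the $U\mathcal G$-module $(\Sigma A)_n=A_{n\oplus 1}$, with the map $A\to\Sigma A$ induced by $\mathrm{id}_n\oplus\iota_1\colon n\to n\oplus 1$, where $\iota_1\colon 0\to 1$ is the unique morphism; let $\ker A$ and $\operatorname{coker}A$ be the kernel and cokernel of $A\to\Sigma A$. For $d\in\mathbb Z$, $A$ has polynomial degree $-\infty$ in ranks $>d$ if $A_n=0$ for all $n>d$. For $r\ge 0$, $A$ has polynomial degree $\le r$ in ranks $>d$ if $(\ker A)_n=0$ for all $n>d$ and $\operatorname{coker}A$ has polynomial degree $\le r-1$ in ranks $>d-1$, where for $r=0$ the number $r-1$ is read as $-\infty$. *Tor.* The category of $\mathcal G$-modules is monoidal under the induction product $(A\circledast B)_n=\bigoplus_{a+b=n}\mathrm{Ind}_{G_a\times G_b}^{G_n}A_a\boxtimes B_b$. Let $\underline{\mathbb Z}$ be the constant module $\mathbb Z$, a monoid for $\circledast$; its left modules are the $U\mathcal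 G$-modules, and by the braiding each of them is also a right $\underline{\mathbb Z}$-module. Let $\mathbb Z=\underline{\mathbb Z}/\underline{\mathbb Z}_+$ be the module that is $\mathbb Z$ in degree $0$ and $0$ in positive degrees, and let $\mathrm{Tor}_i^{\underline{\mathbb Z}}(-,\mathbb Z)$ be the $i$th left derived functor of $-\circledast_{\underline{\mathbb Z}}\mathbb Z$ from $U\mathcal G$-modules to $\mathcal G$-modules. **Theorem.** Let $\mathcal G$ be a braided stability groupoid that satisfies the standard connectivity assumption, let $d\in\mathbb Z$ and $r\in\{-\infty\}\cup\mathbb N$, and let $A$ be a $U\mathcal G$-module of polynomial degree $\le r$ in ranks $>d$. Then for all $i\ge 0$ and all $n\ge 0$ with $n>i+\max(d,r)$, $$\mathrm{Tor}_i^{\underline{\mathbb Z}}(A,\mathbb Z)_n=0 .$$ -/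

import Mathlib

open CategoryTheory CategoryTheory.Limits

universe u

/-! ## Braided stability groupoids -/

/-- A stability groupoid: a strict monoidal skeletal groupoid whose monoid of objects is `(ℕ, +)`,
given by its automorphism groups `G n = Aut(n)` and the maps `G a × G b → G (a + b)` induced by the
monoidal product, subject to the three axioms of a stability groupoid.

The monoidal product `blk` takes a proof `h : a + b = n`, so that no transport between
`G ((a + b) + c)` and `G (a + (b + c))` is ever needed. Composition in the groupoid is
multiplication, `f ∘ g = f * g`. -/
structure StabilityGroupoid where
  G : ℕ → Type u
  [group : ∀ n, Group (G n)]
  /-- the monoidal product of automorphisms `(x, y) ↦ x ⊕ y` -/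
  blk : ∀ {a b n : ℕ}, a + b = n → G a × G b →* G n
  blk_assoc : ∀ {a b c ab bc n : ℕ} (h₁ : a + b = ab) (h₂ : ab + c = n) (h₃ : b + c = bc)
    (h₄ : a + bc = n) (x : G a) (y : G b) (z : G c),
    blk h₂ (blk h₁ (x, y), z) = blk h₄ (x, blk h₃ (y, z))
  one_blk : ∀ {n : ℕ} (h : 0 + n = n) (y : G n), blk h (1, y) = y
  blk_one : ∀ {n : ℕ} (h : n + 0 = n) (x : G n), blk h (x, 1) = x
  /-- `G m × G n → G (m + n)` is injective -/
  blk_injective : ∀ {a b n : ℕ} (h : a + b = n), Function.Injective (blk h)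
  /-- `G 0` is trivial -/
  subsingleton_zero : Subsingleton (G 0)
  /-- `(G (l + m) × 1) ∩ (1 × G (m + n)) = 1 × G m × 1` inside `G (l + m + n)`
  (only the inclusion that is not automatic) -/
  inter : ∀ {l m n lm mn k : ℕ} (h₁ : l + m = lm) (h₂ : lm + n = k) (_ : m + n = mn)
    (h₄ : l + mn = k) (x : G lm) (y : G mn), blk h₂ (x, 1) = blk h₄ (1, y) →
    ∃ z : G m, blk h₂ (x, 1) = blk h₂ (blk h₁ (1, z), 1)

attribute [instance] StabilityGroupoid.group

/-- A stability groupoid with a braiding `b_{m,n} : m ⊕ n → n ⊕ m`, an element of `G (m + n)`,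
which is natural and satisfies both hexagon identities. -/
structure BraidedStabilityGroupoid extends StabilityGroupoid.{u} where
  braid : ∀ {m n k : ℕ}, m + n = k → G k
  braid_natural : ∀ {m n k : ℕ} (h : m + n = k) (h' : n + m = k) (x : G m) (y : G n),
    braid h * blk h (x, y) = blk h' (y, x) * braid h
  /-- `b_{l, m ⊕ n} = (id_m ⊕ b_{l,n}) ∘ (b_{l,m} ⊕ id_n)` -/
  hexagon_left : ∀ {l m n lm mn ln k : ℕ} (_ : m + n = mn) (hlm : l + m = lm) (hln : l + n = ln)
    (h : l + mn = k) (h₁ : m + ln = k) (h₂ : lm + n = k),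
    braid h = blk h₁ (1, braid hln) * blk h₂ (braid hlm, 1)
  /-- `b_{l ⊕ m, n} = (b_{l,n} ⊕ id_m) ∘ (id_l ⊕ b_{m,n})` -/
  hexagon_right : ∀ {l m n lm mn ln k : ℕ} (_ : l + m = lm) (hmn : m + n = mn) (hln : l + n = ln)
    (h : lm + n = k) (h₁ : ln + m = k) (h₂ : l + mn = k),
    braid h = blk h₁ (braid hln, 1) * blk h₂ (1, braid hmn)

namespace StabilityGroupoid

variable (S : StabilityGroupoid.{u})

lemma blk_mul {a b n : ℕ} (h : a + b = n) (x x' : S.G a) (y y' : S.G b) :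
    S.blk h (x, y) * S.blk h (x', y') = S.blk h (x * x', y * y') := by
  rw [← map_mul, Prod.mk_mul_mk]

lemma blk_one_one {a b n : ℕ} (h : a + b = n) : S.blk h (1, 1) = 1 := map_one (S.blk h)

/-! ### The category `U𝒢` -/

/-- Objects of `U𝒢`: the natural numbers. -/
structure UCat (S : StabilityGroupoid.{u}) : Type where
  rank : ℕ

/-- A representative `(f, c)` of a morphism `m → n` of `U𝒢`: an (iso)morphism `f : c ⊕ m → n`. -/
structure PreHom (m n : ℕ) : Type u where
  c : ℕ
  h : c + m = n
  f : S.G n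

/-- `(f, c) ∼ (f', c')` if `f = f' ∘ (k ⊕ id_m)` for an isomorphism `k : c → c'`; by skeletality
`c = c'` (which here follows from `c + m = n = c' + m`) and `k ∈ G c'`. -/
def homSetoid (m n : ℕ) : Setoid (S.PreHom m n) where
  r x y := ∃ k : S.G y.c, x.f = y.f * S.blk y.h (k, 1)
  iseqv := by
    refine ⟨fun x => ⟨1, by rw [blk_one_one, mul_one]⟩, ?_, ?_⟩
    · rintro ⟨c, h, f⟩ ⟨c', h', f'⟩ ⟨k, hk⟩
      obtain rfl : c = c' := by omega
      refine ⟨k⁻¹, ?_⟩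
      dsimp only at hk ⊢
      rw [hk, mul_assoc, blk_mul, mul_inv_cancel, one_mul, blk_one_one, mul_one]
    · rintro ⟨c, h, f⟩ ⟨c', h', f'⟩ ⟨c'', h'', f''⟩ ⟨k, hk⟩ ⟨k', hk'⟩
      obtain rfl : c = c' := by omega
      obtain rfl : c = c'' := by omega
      refine ⟨k' * k, ?_⟩
      dsimp only at hk hk' ⊢
      rw [hk, hk', mul_assoc, blk_mul, one_mul]

/-- Morphisms `m → n` of `U𝒢`. -/
def UHom (m n : ℕ) : Type u := Quotient (S.homSetoid m n)

variable {S}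

/-- The class `[f, c]`. -/
def UHom.mk {m n : ℕ} (c : ℕ) (h : c + m = n) (f : S.G n) : S.UHom m n :=
  Quotient.mk (S.homSetoid m n) ⟨c, h, f⟩

lemma UHom.ind {m n : ℕ} {P : S.UHom m n → Prop} (H : ∀ c h f, P (UHom.mk c h f)) (x) : P x :=
  Quotient.ind (fun ⟨c, h, f⟩ => H c h f) x

lemma UHom.mk_eq {m n c c' : ℕ} (h : c + m = n) (h' : c' + m = n) (f f' : S.G n) (k : S.G c')
    (e : f = f' * S.blk h' (k, 1)) : UHom.mk c h f = (UHom.mk c' h' f' : S.UHom m n) :=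
  Quotient.sound ⟨k, e⟩

/-- `[f, c] ∘ [g, d] = [f ∘ (id_c ⊕ g), c ⊕ d]` -/
def UHom.comp {l m n : ℕ} (x : S.UHom m n) (y : S.UHom l m) : S.UHom l n :=
  Quotient.map₂ (sa := S.homSetoid m n) (sb := S.homSetoid l m) (sc := S.homSetoid l n)
    (fun x y => ⟨x.c + y.c, by have := x.h; have := y.h; omega, x.f * S.blk x.h (1, y.f)⟩)
    (by
      rintro ⟨c, h, f⟩ ⟨c', h', f'⟩ ⟨k, hk⟩ ⟨d, e, g⟩ ⟨d', e', g'⟩ ⟨q, hq⟩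
      obtain rfl : c = c' := by omega
      obtain rfl : d = d' := by omega
      refine ⟨S.blk rfl (k, q), ?_⟩
      dsimp only at hk hq ⊢
      rw [hk, hq, S.blk_assoc rfl _ e h, mul_assoc, mul_assoc, blk_mul, blk_mul]
      simp) x y

lemma UHom.comp_mk {l m n c d : ℕ} (h : c + m = n) (e : d + l = m) (f : S.G n) (g : S.G m) :
    UHom.comp (UHom.mk c h f) (UHom.mk d e g) =
      UHom.mk (c + d) (by omega) (f * S.blk h (1, g)) := rfl

instance : Category.{u} (UCat S) where
  Hom X Y := S.UHom X.rank Y.rank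
  id X := UHom.mk 0 (Nat.zero_add _) 1
  comp f g := UHom.comp g f
  id_comp := by
    rintro ⟨m⟩ ⟨n⟩ f
    induction f using UHom.ind with
    | H c h f =>
      refine UHom.mk_eq _ _ _ _ 1 ?_
      simp only [blk_one_one]
  comp_id := by
    rintro ⟨m⟩ ⟨n⟩ f
    induction f using UHom.ind with
    | H c h f =>
      refine UHom.mk_eq _ _ _ _ 1 ?_
      simp only [blk_one_one, one_blk, one_mul, mul_one]
  assoc := by
    rintro ⟨k⟩ ⟨l⟩ ⟨m⟩ ⟨n⟩ x y z
    induction x using UHom.ind with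
    | H c h f =>
    induction y using UHom.ind with
    | H c' h' f' =>
    induction z using UHom.ind with
    | H c'' h'' f'' =>
      refine UHom.mk_eq _ _ _ _ 1 ?_
      dsimp only at h h' h'' f f' f''
      rw [blk_one_one, mul_one, mul_assoc, ← S.blk_one_one (a := c'') (b := c') rfl,
        S.blk_assoc rfl _ h' h'', blk_mul, one_mul]

variable (S)

/-- The morphism `m → n` of `U𝒢` with representative `(f, c)`. -/
abbrev homMk {m n : ℕ} (c : ℕ) (h : c + m = n) (f : S.G n) : (⟨m⟩ : UCat S) ⟶ ⟨n⟩ :=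
  UHom.mk c h f

/-- An element of `G n` as an automorphism in `U𝒢`. -/
abbrev ofAut {n : ℕ} (g : S.G n) : (⟨n⟩ : UCat S) ⟶ ⟨n⟩ := S.homMk 0 (Nat.zero_add n) g

/-- `ι_c ⊕ id_m : m → c ⊕ m` -/
abbrev insLeft {c m n : ℕ} (h : c + m = n) : (⟨m⟩ : UCat S) ⟶ ⟨n⟩ := S.homMk c h 1

/-- `U𝒢`-modules. -/
abbrev UMod := UCat S ⥤ ModuleCat.{u} ℤ

/-- The groupoid `𝒢` itself, as the disjoint union of its automorphism groups. -/
abbrev Grpd := Σ n : ℕ, SingleObj (S.G n)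

/-- `𝒢`-modules. -/
abbrev GMod := S.Grpd ⥤ ModuleCat.{u} ℤ

/-- The value in degree `n` of a `𝒢`-module. -/
abbrev deg (M : S.GMod) (n : ℕ) : ModuleCat.{u} ℤ := M.obj ⟨n, SingleObj.star _⟩

end StabilityGroupoid

/-! ## Semi-simplicial sets and their reduced homology -/

/-- A semi-simplicial set, with face maps `d_i : X_{p+1} → X_p`, `0 ≤ i ≤ p + 1`. -/
structure SemiSimplicialSet where
  obj : ℕ → Type u
  face : ∀ p : ℕ, Fin (p + 2) → obj (p + 1) → obj p
  /-- `d_i d_{j+1} = d_j d_i` for `i ≤ j` -/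
  face_face : ∀ (p : ℕ) (i j : Fin (p + 2)), i ≤ j → ∀ x : obj (p + 2),
    face p i (face (p + 1) j.succ x) = face p j (face (p + 1) i.castSucc x)

namespace SemiSimplicialSet

variable (X : SemiSimplicialSet.{u})

/-- The boundary map `∑ (-1)^i d_i : ℤ[X_{p+1}] → ℤ[X_p]`. -/
noncomputable def boundary (p : ℕ) : (X.obj (p + 1) →₀ ℤ) →ₗ[ℤ] (X.obj p →₀ ℤ) :=
  ∑ i : Fin (p + 2), (-1 : ℤ) ^ (i : ℕ) • Finsupp.lmapDomain ℤ ℤ (X.face p i)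

lemma boundary_single (p : ℕ) (x : X.obj (p + 1)) : X.boundary p (Finsupp.single x 1) =
    ∑ i : Fin (p + 2), (-1 : ℤ) ^ (i : ℕ) • Finsupp.single (X.face p i x) 1 := by
  simp [boundary, LinearMap.sum_apply, Finsupp.mapDomain_single]

lemma boundary_boundary (p : ℕ) : X.boundary p ∘ₗ X.boundary (p + 1) = 0 := by
  refine Finsupp.lhom_ext' fun x => LinearMap.ext_ring ?_
  simp only [LinearMap.comp_apply, Finsupp.lsingle_apply, LinearMap.zero_apply, boundary_single,
    map_sum, map_zsmul, Finset.smul_sum]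
  rw [← Finset.sum_product', Finset.univ_product_univ]
  let T : Finset (Fin (p + 3) × Fin (p + 2)) := {ij | (ij.1 : ℕ) ≤ (ij.2 : ℕ)}
  rw [← Finset.sum_add_sum_compl T, ← eq_neg_iff_add_eq_zero, ← Finset.sum_neg_distrib]
  refine Finset.sum_bij
    (fun ij hij => (ij.2.succ, Fin.castLT ij.1 (lt_of_le_of_lt (Finset.mem_filter.mp hij).2 ij.2.2)))
    ?_ ?_ ?_ ?_
  · rintro ⟨i, j⟩ hij
    simp only [T, Finset.mem_filter_univ, Finset.compl_filter, Fin.val_succ, Fin.val_castLT]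
      at hij ⊢
    omega
  · rintro ⟨i, j⟩ hij ⟨i', j'⟩ hij' e
    simp only [Prod.mk.injEq, Fin.succ_inj] at e
    obtain ⟨rfl, e⟩ := e
    have := congrArg Fin.val e
    simp only [Fin.val_castLT] at this
    rw [Fin.ext this]
  · rintro ⟨i, j⟩ hij
    simp only [T, Finset.mem_filter_univ, Finset.compl_filter, not_le] at hij
    refine ⟨(j.castSucc, i.pred (by rintro rfl; simp at hij)), ?_, ?_⟩
    · simp only [T, Finset.mem_filter_univ, Fin.val_castSucc, Fin.val_pred]
      omega
    · simp
  · rintro ⟨i, j⟩ hij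
    simp only [T, Finset.mem_filter_univ] at hij
    have := X.face_face p (Fin.castLT i (lt_of_le_of_lt hij j.2)) j hij x
    rw [Fin.castSucc_castLT] at this
    simp only [smul_smul, Fin.val_succ, Fin.val_castLT, this, pow_succ, ← neg_smul]
    congr 1
    ring

/-- The Moore complex `ℤ[X_*]`. -/
noncomputable def mooreComplex : ChainComplex (ModuleCat.{u} ℤ) ℕ :=
  ChainComplex.of (fun p => ModuleCat.of ℤ (X.obj p →₀ ℤ)) (fun p => ModuleCat.ofHom (X.boundary p))
    (fun p => by rw [← ModuleCat.ofHom_comp, boundary_boundary]; rfl)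

/-- The augmentation `ℤ[X_0] → ℤ[pt]`. -/
noncomputable def augmentation : (X.obj 0 →₀ ℤ) →ₗ[ℤ] (PUnit.{u + 1} →₀ ℤ) :=
  Finsupp.lmapDomain ℤ ℤ (fun _ => PUnit.unit)

lemma augmentation_boundary : X.augmentation ∘ₗ X.boundary 0 = 0 := by
  refine Finsupp.lhom_ext' fun x => LinearMap.ext_ring ?_
  have h (y : X.obj 0) : X.augmentation (Finsupp.single y 1) = Finsupp.single PUnit.unit 1 := by
    simp [augmentation, Finsupp.mapDomain_single]
  simp only [LinearMap.comp_apply, Finsupp.lsingle_apply, LinearMap.zero_apply, boundary_single,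
    map_sum, map_zsmul, h]
  simp [Fin.sum_univ_two]

/-- The augmented Moore complex `ℤ[X_*] → ℤ`, with `ℤ` in degree `0` and `ℤ[X_p]` in degree
`p + 1`. -/
noncomputable def augmentedComplex : ChainComplex (ModuleCat.{u} ℤ) ℕ :=
  X.mooreComplex.augment (X := ModuleCat.of ℤ (PUnit.{u + 1} →₀ ℤ))
    (ModuleCat.ofHom X.augmentation) (by
      have : X.mooreComplex.d 1 0 = ModuleCat.ofHom (X.boundary 0) := 
        ChainComplex.of_d (fun p => ModuleCat.of ℤ (X.obj p →₀ ℤ))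
          (fun p => ModuleCat.ofHom (X.boundary p)) 0
      rw [this]
      exact (ModuleCat.ofHom_comp _ _).symm.trans (congrArg _ X.augmentation_boundary))

/-- `X.reducedHomology j` is the reduced homology of `X` in degree `j - 1`. -/
noncomputable def reducedHomology (j : ℕ) : ModuleCat.{u} ℤ := X.augmentedComplex.homology j

end SemiSimplicialSet

/-! ## The `E₁`-splitting complex -/

/-- Add the entries number `i` and `i + 1` of a list. -/
def mergeAt : ℕ → List ℕ → List ℕ
  | 0, a :: b :: t => (a + b) :: t
  | i + 1, a :: t => a :: mergeAt i t
  | _, l => l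

lemma sum_mergeAt : ∀ (i : ℕ) (l : List ℕ), (mergeAt i l).sum = l.sum
  | 0, [] => rfl
  | 0, [_] => rfl
  | 0, a :: b :: t => by simp [mergeAt, add_assoc]
  | _ + 1, [] => rfl
  | i + 1, a :: t => by simp [mergeAt, sum_mergeAt i t]

lemma length_mergeAt : ∀ (i : ℕ) (l : List ℕ), i + 1 < l.length →
    (mergeAt i l).length + 1 = l.length
  | 0, [], h => by simp at h
  | 0, [_], h => by simp at h
  | 0, a :: b :: t, _ => by simp [mergeAt]
  | _ + 1, [], h => by simp at h
  | i + 1, a :: t, h => by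
    have := length_mergeAt i t (by simpa using h)
    simp [mergeAt, this]

lemma pos_mergeAt : ∀ (i : ℕ) (l : List ℕ), (∀ a ∈ l, 0 < a) → ∀ a ∈ mergeAt i l, 0 < a
  | 0, [], h => h
  | 0, [_], h => h
  | 0, a :: b :: t, h => by
    simp only [mergeAt, List.mem_cons, forall_eq_or_imp] at h ⊢
    exact ⟨by omega, h.2.2⟩
  | _ + 1, [], h => h
  | i + 1, a :: t, h => by
    simp only [mergeAt, List.mem_cons, forall_eq_or_imp] at h ⊢
    exact ⟨h.1, pos_mergeAt i t h.2⟩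

lemma mergeAt_mergeAt : ∀ (i j : ℕ) (l : List ℕ), i ≤ j →
    mergeAt i (mergeAt (j + 1) l) = mergeAt j (mergeAt i l)
  | 0, 0, [], _ => rfl
  | 0, 0, [_], _ => rfl
  | 0, 0, [_, _], _ => rfl
  | 0, 0, a :: b :: c :: t, _ => by simp [mergeAt, add_assoc]
  | 0, _ + 1, [], _ => rfl
  | 0, _ + 1, [_], _ => by simp [mergeAt]
  | 0, _ + 1, _ :: _ :: _, _ => by simp [mergeAt]
  | _ + 1, 0, _, h => by omega
  | _ + 1, _ + 1, [], _ => rfl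
  | i + 1, j + 1, a :: t, h => by
    simp only [mergeAt]
    rw [mergeAt_mergeAt i j t (by omega)]

namespace StabilityGroupoid

variable (S : StabilityGroupoid.{u})

/-- The subgroup `G_{n_0} × ⋯ × G_{n_k}` of `G_n`, where `n = n_0 + ⋯ + n_k`. -/
def young : (l : List ℕ) → {n : ℕ} → l.sum = n → Subgroup (S.G n)
  | [], _, _ => ⊥
  | a :: t, _, h =>
    ((⊤ : Subgroup (S.G a)).prod (young t rfl)).map (S.blk (List.sum_cons.symm.trans h))

lemma young_le_mergeAt : ∀ (i : ℕ) (l : List ℕ) {n : ℕ} (h : l.sum = n)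
    (h' : (mergeAt i l).sum = n), S.young l h ≤ S.young (mergeAt i l) h'
  | 0, [], _, _, _ => le_rfl
  | 0, [_], _, _, _ => le_rfl
  | 0, a :: b :: t, n, h, h' => by
    rintro _ ⟨⟨x, w⟩, ⟨-, ⟨⟨y, z⟩, ⟨-, hz⟩, rfl⟩⟩, rfl⟩
    refine ⟨⟨S.blk rfl (x, y), z⟩, ⟨trivial, hz⟩, ?_⟩
    exact S.blk_assoc rfl _ _ _ x y z
  | _ + 1, [], _, _, _ => le_rfl
  | i + 1, a :: t, n, h, h' => by
    rintro _ ⟨⟨x, w⟩, ⟨-, hw⟩, rfl⟩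
    have e : (mergeAt i t).sum = t.sum := sum_mergeAt i t
    have key : ∀ (k : ℕ) (hk : (mergeAt i t).sum = k) (hn : a + k = n) (w : S.G k),
        w ∈ S.young (mergeAt i t) hk →
        S.blk hn (x, w) ∈ S.young (mergeAt (i + 1) (a :: t)) h' := by
      rintro k rfl hn w hw
      exact ⟨⟨x, w⟩, ⟨trivial, hw⟩, rfl⟩
    exact key _ e _ w (young_le_mergeAt i t rfl e hw)

/-- Tuples `(n_0, …, n_{p+1})` of positive integers with sum `n`. -/
abbrev Parts (n p : ℕ) : Type :=
  {l : List ℕ // l.length = p + 2 ∧ (∀ a ∈ l, 0 < a) ∧ l.sum = n}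

/-- The `p`-simplices of the splitting complex:
the disjoint union of the `G_n / (G_{n_0} × ⋯ × G_{n_{p+1}})`. -/
abbrev SplitSimplex (n p : ℕ) : Type u := Σ l : Parts n p, S.G n ⧸ S.young l.1 l.2.2.2

/-- `(…, n_i, n_{i+1}, …) ↦ (…, n_i + n_{i+1}, …)` -/
def mergeParts {n p : ℕ} (i : Fin (p + 2)) (l : Parts n (p + 1)) : Parts n p :=
  ⟨mergeAt i l.1, by
      have := length_mergeAt i l.1 (by have := l.2.1; have := i.2; omega)
      have := l.2.1
      omega,
    pos_mergeAt i l.1 l.2.2.1, (sum_mergeAt i l.1).trans l.2.2.2⟩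

lemma splitSimplex_ext {n p : ℕ} {l l' : Parts n p} (e : l = l') (g : S.G n) :
    (⟨l, (g : S.G n ⧸ S.young l.1 l.2.2.2)⟩ : S.SplitSimplex n p) = ⟨l', (g : S.G n ⧸ _)⟩ := by
  subst e
  rfl

/-- The `n`th `E₁`-splitting complex of `𝒢`. -/
def splittingComplex (n : ℕ) : SemiSimplicialSet.{u} where
  obj p := S.SplitSimplex n p
  face p i x := ⟨mergeParts i x.1,
    Subgroup.quotientMapOfLE (S.young_le_mergeAt i x.1.1 x.1.2.2.2 (mergeParts i x.1).2.2.2) x.2⟩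
  face_face p i j hij x := by
    obtain ⟨l, g⟩ := x
    induction g using QuotientGroup.induction_on with
    | H g =>
      exact S.splitSimplex_ext (Subtype.ext (mergeAt_mergeAt i j l.1 hij)) g

/-- The standard connectivity assumption: for all `n`, the reduced homology of the `n`th splitting
complex vanishes in all degrees `≤ n - 3` (with `j - 1` for the degree). -/
def StandardConnectivity : Prop :=
  ∀ n j : ℕ, (j : ℤ) - 1 ≤ (n : ℤ) - 3 → IsZero ((S.splittingComplex n).reducedHomology j)

end StabilityGroupoid

/-! ## Shifts and polynomial modules -/

namespace BraidedStabilityGroupoid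

open StabilityGroupoid

variable (S : BraidedStabilityGroupoid.{u})

/-- `id_m ⊕ ι_c : m → m ⊕ c`, which is `b_{m,c}⁻¹ ∘ (ι_c ⊕ id_m)`. -/
abbrev insRight {m c n : ℕ} (h : m + c = n) : (⟨m⟩ : UCat S.toStabilityGroupoid) ⟶ ⟨n⟩ :=
  S.homMk c ((Nat.add_comm c m).trans h) (S.braid h)⁻¹

/-- `[f, c] ⊕ id_1 = [f ⊕ id_1, c]` -/
def shiftHom {m n : ℕ} (x : S.UHom m n) : S.UHom (m + 1) (n + 1) :=
  Quotient.map (sa := S.homSetoid m n) (sb := S.homSetoid (m + 1) (n + 1))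
    (fun x => ⟨x.c, by have := x.h; omega, S.blk rfl (x.f, 1)⟩)
    (by
      rintro ⟨c, h, f⟩ ⟨c', h', f'⟩ ⟨k, hk⟩
      refine ⟨k, ?_⟩
      dsimp only at hk ⊢
      rw [← S.blk_one_one (a := m) (b := 1) rfl, ← S.blk_assoc h' rfl rfl, blk_mul, one_mul, hk]) x

/-- The endofunctor `- ⊕ 1` of `U𝒢`. -/
def shift : UCat S.toStabilityGroupoid ⥤ UCat S.toStabilityGroupoid where
  obj X := ⟨X.rank + 1⟩
  map f := S.shiftHom f
  map_id := by
    rintro ⟨n⟩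
    refine UHom.mk_eq _ _ _ _ 1 ?_
    simp only [blk_one_one, mul_one]
  map_comp := by
    rintro ⟨l⟩ ⟨m⟩ ⟨n⟩ x y
    induction x using UHom.ind with
    | H c h f =>
    induction y using UHom.ind with
    | H d e g =>
      refine UHom.mk_eq _ _ _ _ 1 ?_
      dsimp only at h e f g ⊢
      rw [blk_one_one, mul_one, ← S.blk_assoc e rfl rfl, blk_mul, one_mul]

lemma toShift_aux {c m n : ℕ} (h : c + m = n) (h₁ : c + (m + 1) = n + 1) (h₂ : c + 1 + m = n + 1)
    (f : S.G n) :
    (S.braid (m := n) (n := 1) rfl)⁻¹ * S.blk (Nat.add_comm 1 n) (1, f) =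
      S.blk rfl (f, 1) * S.blk h₁ (1, (S.braid (m := m) (n := 1) rfl)⁻¹) *
        S.blk h₂ ((S.braid (m := c) (n := 1) rfl)⁻¹, 1) := by
  have e₁ : (S.braid (m := n) (n := 1) rfl)⁻¹ * S.blk (Nat.add_comm 1 n) (1, f) =
      S.blk rfl (f, 1) * (S.braid (m := n) (n := 1) rfl)⁻¹ := by
    rw [inv_mul_eq_iff_eq_mul, ← mul_assoc, S.braid_natural rfl (Nat.add_comm 1 n),
      mul_inv_cancel_right]
  have e₂ := S.hexagon_right (l := c) (m := m) (n := 1) h rfl rfl rfl h₂ h₁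
  rw [e₁, mul_assoc, e₂, mul_inv_rev, ← map_inv, ← map_inv]
  simp only [Prod.inv_mk, inv_one]

/-- The natural transformation with components `id_n ⊕ ι_1 : n → n ⊕ 1`. -/
def toShift : 𝟭 (UCat S.toStabilityGroupoid) ⟶ S.shift where
  app X := S.insRight (m := X.rank) (c := 1) rfl
  naturality := by
    rintro ⟨m⟩ ⟨n⟩ x
    induction x using UHom.ind with
    | H c h f =>
      dsimp only at h f
      refine UHom.mk_eq (c' := c + 1) _ (by change c + 1 + m = n + 1; omega) _ _
        (S.braid (m := c) (n := 1) rfl)⁻¹ ?_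
      exact S.toShift_aux h (by omega) (by omega) f

/-- The shift `ΣA` of a `U𝒢`-module, `(ΣA)_n = A_{n+1}`. -/
abbrev shiftMod (A : S.UMod) : S.UMod := S.shift ⋙ A

/-- The canonical map `A → ΣA`. -/
def toShiftMod (A : S.UMod) : A ⟶ S.shiftMod A := Functor.whiskerRight S.toShift A

/-- `A` has polynomial degree `≤ r` in ranks `> d`, where `r = ⊥` stands for `-∞` and
`0 - 1 = -∞`. -/
inductive IsPolynomial : WithBot ℕ → ℤ → S.UMod → Prop
  | bot (d : ℤ) (A : S.UMod) (h : ∀ n : ℕ, d < n → IsZero (A.obj ⟨n⟩)) : IsPolynomial ⊥ d A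
  | zero (d : ℤ) (A : S.UMod)
      (hker : ∀ n : ℕ, d < n → IsZero ((kernel (S.toShiftMod A)).obj ⟨n⟩))
      (hcoker : IsPolynomial ⊥ (d - 1) (cokernel (S.toShiftMod A))) : IsPolynomial (0 : ℕ) d A
  | succ (r : ℕ) (d : ℤ) (A : S.UMod)
      (hker : ∀ n : ℕ, d < n → IsZero ((kernel (S.toShiftMod A)).obj ⟨n⟩))
      (hcoker : IsPolynomial (r : ℕ) (d - 1) (cokernel (S.toShiftMod A))) :
      IsPolynomial ((r + 1 : ℕ) : WithBot ℕ) d A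

/-! ## The product `A ⊛_{ℤ̲} B` and its derived functors -/

/-- Symbols `a ⊗ b ⊗ g` with `a ∈ A_p`, `b ∈ B_q`, `g ∈ G_n`, `p + q = n`. -/
structure Symb (A B : S.UMod) (n : ℕ) : Type u where
  p : ℕ
  q : ℕ
  h : p + q = n
  a : A.obj ⟨p⟩
  b : B.obj ⟨q⟩
  g : S.G n

variable {S} in
/-- The element `a ⊗ b ⊗ g` of the free abelian group on the symbols. -/
noncomputable def symb {A B : S.UMod} {n p q : ℕ} (h : p + q = n) (a : A.obj ⟨p⟩) (b : B.obj ⟨q⟩)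
    (g : S.G n) : Symb S A B n →₀ ℤ :=
  Finsupp.single ⟨p, q, h, a, b, g⟩ 1

/-- The relations defining `(A ⊛_{ℤ̲} B)_n`. The first three present the induction product
`(A ⊛_𝒢 B)_n = ((A ⊠ B) ⊗_{𝒢 × 𝒢} ℤ𝒢(- ⊕ -, n))`; the last one is the coequalizer of
`A ⊛_𝒢 ℤ̲ ⊛_𝒢 B ⇉ A ⊛_𝒢 B`, where `1_c ∈ ℤ̲_c` acts on `A` from the right by `id_p ⊕ ι_c` and on
`B` from the left by `ι_c ⊕ id_q`. -/
inductive Rel (A B : S.UMod) (n : ℕ) : (Symb S A B n →₀ ℤ) → Prop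
  | add_left {p q : ℕ} (h : p + q = n) (a a' : A.obj ⟨p⟩) (b : B.obj ⟨q⟩) (g : S.G n) :
      Rel A B n (symb h (a + a') b g - (symb h a b g + symb h a' b g))
  | add_right {p q : ℕ} (h : p + q = n) (a : A.obj ⟨p⟩) (b b' : B.obj ⟨q⟩) (g : S.G n) :
      Rel A B n (symb h a (b + b') g - (symb h a b g + symb h a b' g))
  | equivariant {p q : ℕ} (h : p + q = n) (x : S.G p) (y : S.G q) (a : A.obj ⟨p⟩) (b : B.obj ⟨q⟩)
      (g : S.G n) :
      Rel A B n (symb h (A.map (S.ofAut x) a) (B.map (S.ofAut y) b) g -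
        symb h a b (g * S.blk h (x, y)))
  | balanced {p c q pc cq : ℕ} (hpc : p + c = pc) (h : pc + q = n) (hcq : c + q = cq)
      (h' : p + cq = n) (a : A.obj ⟨p⟩) (b : B.obj ⟨q⟩) (g : S.G n) :
      Rel A B n (symb h (A.map (S.insRight hpc) a) b g - symb h' a (B.map (S.insLeft hcq) b) g)

/-- The subgroup generated by the relations. -/
noncomputable def relations (A B : S.UMod) (n : ℕ) : Submodule ℤ (Symb S A B n →₀ ℤ) :=
  Submodule.span ℤ {x | Rel S A B n x}

/-- The abelian group `(A ⊛_{ℤ̲} B)_n`. -/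
abbrev TensorObj (A B : S.UMod) (n : ℕ) : Type u := (Symb S A B n →₀ ℤ) ⧸ S.relations A B n

/-- Left multiplication by `k ∈ G_n` on symbols. -/
def Symb.act {A B : S.UMod} {n : ℕ} (k : S.G n) (s : Symb S A B n) : Symb S A B n :=
  { s with g := k * s.g }

/-- The map of symbols induced by a morphism `A ⟶ A'`. -/
def Symb.map {A A' : S.UMod} (φ : A ⟶ A') {B : S.UMod} {n : ℕ} (s : Symb S A B n) :
    Symb S A' B n :=
  ⟨s.p, s.q, s.h, φ.app ⟨s.p⟩ s.a, s.b, s.g⟩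

variable {S}

lemma mapDomain_act_symb {A B : S.UMod} {n p q : ℕ} (k : S.G n) (h : p + q = n) (a : A.obj ⟨p⟩)
    (b : B.obj ⟨q⟩) (g : S.G n) :
    Finsupp.lmapDomain ℤ ℤ (Symb.act S k) (symb h a b g) = symb (B := B) h a b (k * g) := by
  simp [symb, Symb.act, Finsupp.mapDomain_single]

lemma mapDomain_map_symb {A A' B : S.UMod} (φ : A ⟶ A') {n p q : ℕ} (h : p + q = n)
    (a : A.obj ⟨p⟩) (b : B.obj ⟨q⟩) (g : S.G n) :
    Finsupp.lmapDomain ℤ ℤ (Symb.map S φ) (symb h a b g) =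
      symb (B := B) h (φ.app ⟨p⟩ a) b g := by
  simp [symb, Symb.map, Finsupp.mapDomain_single]

lemma relations_le_act (A B : S.UMod) {n : ℕ} (k : S.G n) : S.relations A B n ≤
    (S.relations A B n).comap (Finsupp.lmapDomain ℤ ℤ (Symb.act S k)) := by
  refine Submodule.span_le.2 ?_
  intro x hx
  refine Submodule.subset_span (?_ : Rel S A B n _)
  cases hx <;> simp only [map_sub, map_add, mapDomain_act_symb, ← mul_assoc]
  · exact .add_left ..
  · exact .add_right ..
  · exact .equivariant ..
  · exact .balanced ..

lemma relations_le_map {A A' : S.UMod} (φ : A ⟶ A') (B : S.UMod) (n : ℕ) : S.relations A B n ≤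
    (S.relations A' B n).comap (Finsupp.lmapDomain ℤ ℤ (Symb.map S φ)) := by
  refine Submodule.span_le.2 ?_
  intro x hx
  refine Submodule.subset_span (?_ : Rel S A' B n _)
  cases hx <;>
    simp only [map_sub, map_add, mapDomain_map_symb, NatTrans.naturality_apply]
  · exact .add_left ..
  · exact .add_right ..
  · exact .equivariant ..
  · exact .balanced ..

lemma tensorObj_hom_ext {A B : S.UMod} {n : ℕ} {M : Type*} [AddCommGroup M] [Module ℤ M]
    {f f' : TensorObj S A B n →ₗ[ℤ] M}
    (h : ∀ {p q : ℕ} (h : p + q = n) (a : A.obj ⟨p⟩) (b : B.obj ⟨q⟩) (g : S.G n),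
      f (Submodule.mkQ _ (symb h a b g)) = f' (Submodule.mkQ _ (symb h a b g))) : f = f' := by
  refine Submodule.linearMap_qext _ (Finsupp.lhom_ext' fun s => LinearMap.ext_ring ?_)
  exact h s.h s.a s.b s.g

variable (S)

/-- The action of `k ∈ G_n` on `(A ⊛_{ℤ̲} B)_n`. -/
noncomputable def tensorAct (A B : S.UMod) {n : ℕ} (k : S.G n) :
    TensorObj S A B n →ₗ[ℤ] TensorObj S A B n :=
  Submodule.mapQ _ _ (Finsupp.lmapDomain ℤ ℤ (Symb.act S k)) (relations_le_act A B k)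

/-- The map `(A ⊛_{ℤ̲} B)_n → (A' ⊛_{ℤ̲} B)_n` induced by `A ⟶ A'`. -/
noncomputable def tensorMap {A A' : S.UMod} (φ : A ⟶ A') (B : S.UMod) (n : ℕ) :
    TensorObj S A B n →ₗ[ℤ] TensorObj S A' B n :=
  Submodule.mapQ _ _ (Finsupp.lmapDomain ℤ ℤ (Symb.map S φ)) (relations_le_map φ B n)

variable {S}

lemma tensorAct_symb (A B : S.UMod) {n p q : ℕ} (k : S.G n) (h : p + q = n) (a : A.obj ⟨p⟩)
    (b : B.obj ⟨q⟩) (g : S.G n) :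
    S.tensorAct A B k (Submodule.mkQ _ (symb h a b g)) = Submodule.mkQ _ (symb h a b (k * g)) := by
  rw [← mapDomain_act_symb]
  rfl

lemma tensorMap_symb {A A' : S.UMod} (φ : A ⟶ A') (B : S.UMod) {n p q : ℕ} (h : p + q = n)
    (a : A.obj ⟨p⟩) (b : B.obj ⟨q⟩) (g : S.G n) :
    S.tensorMap φ B n (Submodule.mkQ _ (symb h a b g)) =
      Submodule.mkQ _ (symb h (φ.app ⟨p⟩ a) b g) := by
  rw [← mapDomain_map_symb]
  rfl

lemma tensorMap_comp_tensorAct {A A' : S.UMod} (φ : A ⟶ A') (B : S.UMod) {n : ℕ} (k : S.G n) :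
    S.tensorMap φ B n ∘ₗ S.tensorAct A B k = S.tensorAct A' B k ∘ₗ S.tensorMap φ B n := by
  refine tensorObj_hom_ext fun h a b g => ?_
  rw [LinearMap.comp_apply, LinearMap.comp_apply, tensorAct_symb, tensorMap_symb, tensorMap_symb,
    tensorAct_symb]

lemma tensorMap_id (A B : S.UMod) (n : ℕ) : S.tensorMap (𝟙 A) B n = LinearMap.id :=
  tensorObj_hom_ext fun h a b g => tensorMap_symb (𝟙 A) B h a b g

lemma tensorMap_comp {A A' A'' : S.UMod} (φ : A ⟶ A') (ψ : A' ⟶ A'') (B : S.UMod) (n : ℕ) :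
    S.tensorMap (φ ≫ ψ) B n = S.tensorMap ψ B n ∘ₗ S.tensorMap φ B n := by
  refine tensorObj_hom_ext fun h a b g => ?_
  rw [LinearMap.comp_apply, tensorMap_symb, tensorMap_symb, tensorMap_symb]
  rfl

lemma tensorMap_add {A A' : S.UMod} (φ ψ : A ⟶ A') (B : S.UMod) (n : ℕ) :
    S.tensorMap (φ + ψ) B n = S.tensorMap φ B n + S.tensorMap ψ B n := by
  refine tensorObj_hom_ext fun h a b g => ?_
  rw [LinearMap.add_apply, tensorMap_symb, tensorMap_symb, tensorMap_symb, ← map_add]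
  exact (Submodule.Quotient.eq _).2 (Submodule.subset_span (.add_left ..))

variable (S)

/-- The `𝒢`-module `A ⊛_{ℤ̲} B`. -/
noncomputable def tensor (A B : S.UMod) : S.GMod :=
  CategoryTheory.Sigma.desc fun n =>
    { obj := fun _ => ModuleCat.of ℤ (TensorObj S A B n)
      map := fun k => ModuleCat.ofHom (S.tensorAct A B (n := n) k)
      map_id := fun _ => by
        refine ModuleCat.hom_ext (tensorObj_hom_ext fun h a b g => ?_)
        refine (tensorAct_symb A B (1 : S.G n) h a b g).trans ?_
        rw [one_mul]
        rfl
      map_comp := fun {X Y Z} (k k' : S.G n) => by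
        refine ModuleCat.hom_ext (tensorObj_hom_ext fun h a b g => ?_)
        refine (tensorAct_symb A B (k' * k) h a b g).trans ?_
        rw [mul_assoc, ← tensorAct_symb, ← tensorAct_symb]
        rfl }

/-- The functor `- ⊛_{ℤ̲} B`. -/
noncomputable def tensorRight (B : S.UMod) : S.UMod ⥤ S.GMod where
  obj A := S.tensor A B
  map {A A'} φ := CategoryTheory.Sigma.natTrans fun n =>
    { app := fun _ => ModuleCat.ofHom (S.tensorMap φ B n)
      naturality := fun X Y (k : S.G n) => by
        exact ModuleCat.hom_ext (tensorMap_comp_tensorAct φ B k) }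
  map_id A := by
    ext ⟨n, x⟩ : 2
    exact ModuleCat.hom_ext (tensorMap_id A B n)
  map_comp φ ψ := by
    ext ⟨n, x⟩ : 2
    exact ModuleCat.hom_ext (tensorMap_comp φ ψ B n)

instance (B : S.UMod) : (S.tensorRight B).Additive where
  map_add {A A' φ ψ} := by
    ext ⟨n, x⟩ : 2
    exact ModuleCat.hom_ext (tensorMap_add φ ψ B n)

end BraidedStabilityGroupoid

lemma projective_sigma {D : Type*} [Category* D] {β : Type*} (g : β → D) [HasCoproduct g]
    (h : ∀ b, Projective (g b)) : Projective (∐ g) where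
  factors f e _ :=
    ⟨Limits.Sigma.desc fun b => Projective.factorThru (Limits.Sigma.ι g b ≫ f) e,
      Limits.Sigma.hom_ext _ _ fun b => by
        rw [← Category.assoc, colimit.ι_desc]
        exact Projective.factorThru_comp _ _⟩

/-- Functors from a small category to modules have enough projectives: the left adjoints of the
evaluation functors send projectives to projectives. -/
instance enoughProjectives_functor {C : Type} [Category.{u} C] :
    EnoughProjectives (C ⥤ ModuleCat.{u} ℤ) where
  presentation A := by
    let P : C → (C ⥤ ModuleCat.{u} ℤ) := fun c =>
      (evaluationLeftAdjoint (ModuleCat.{u} ℤ) c).obj (Projective.over (A.obj c))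
    have hP : ∀ c, Projective (P c) := fun c =>
      (evaluationAdjunctionRight (ModuleCat.{u} ℤ) c).map_projective _ inferInstance
    have hcop : HasCoproduct P := inferInstance
    have hproj : Projective (∐ P) := projective_sigma P hP
    let π : ∀ c, P c ⟶ A := fun c =>
      ((evaluationAdjunctionRight (ModuleCat.{u} ℤ) c).homEquiv _ _).symm (Projective.π (A.obj c))
    have hepi : ∀ c, Epi ((Limits.Sigma.desc π).app c) := by
      intro c
      have h₁ : Projective.π (A.obj c) =
          (evaluationAdjunctionRight (ModuleCat.{u} ℤ) c).unit.app _ ≫ (π c).app c := by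
        have := ((evaluationAdjunctionRight (ModuleCat.{u} ℤ) c).homEquiv _ _).apply_symm_apply
          (Projective.π (A.obj c))
        rw [Adjunction.homEquiv_unit] at this
        exact this.symm
      have h₂ : π c = Limits.Sigma.ι P c ≫ Limits.Sigma.desc π := by simp
      have h₃ : ((evaluationAdjunctionRight (ModuleCat.{u} ℤ) c).unit.app _ ≫
          (Limits.Sigma.ι P c).app c) ≫ (Limits.Sigma.desc π).app c = Projective.π (A.obj c) := by
        rw [h₁, Category.assoc, ← NatTrans.comp_app, ← h₂]
      exact epi_of_epi_fac h₃
    have := CategoryTheory.NatTrans.epi_of_epi_app (Limits.Sigma.desc π)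
    exact ⟨{ p := ∐ P, f := Limits.Sigma.desc π }⟩

namespace BraidedStabilityGroupoid

open StabilityGroupoid

variable (S : BraidedStabilityGroupoid.{u})

/-- The degree `n` part of the ideal `ℤ̲_+` of `ℤ̲`: zero if `n = 0` and everything if `n > 0`. -/
def augIdeal (n : ℕ) : Submodule ℤ (ULift.{u} ℤ) := if n = 0 then ⊥ else ⊤

lemma augIdeal_le {m n : ℕ} (h : m ≤ n) : augIdeal.{u} m ≤ augIdeal.{u} n := by
  unfold augIdeal
  by_cases hn : n = 0
  · rw [if_pos hn, if_pos (by omega)]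
  · rw [if_neg hn]
    exact le_top

variable {S} in
lemma rank_le {X Y : UCat S.toStabilityGroupoid} (f : X ⟶ Y) : X.rank ≤ Y.rank := by
  induction f using UHom.ind with
  | H c h f => omega

/-- The module `ℤ = ℤ̲ / ℤ̲_+`, where `ℤ̲` is the constant module. -/
noncomputable def unitMod : S.UMod where
  obj X := ModuleCat.of ℤ (ULift.{u} ℤ ⧸ augIdeal.{u} X.rank)
  map f := ModuleCat.ofHom (Submodule.mapQ _ _ LinearMap.id (augIdeal_le (rank_le f)))
  map_id X := by
    refine ModuleCat.hom_ext (Submodule.linearMap_qext _ ?_)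
    rfl
  map_comp f g := by
    refine ModuleCat.hom_ext (Submodule.linearMap_qext _ ?_)
    rfl

/-- The `𝒢`-module `Tor_i^{ℤ̲}(A, ℤ)`: the `i`th left derived functor of `- ⊛_{ℤ̲} ℤ` at `A`. -/
noncomputable def tor (i : ℕ) (A : S.UMod) : S.GMod :=
  ((S.tensorRight S.unitMod).leftDerived i).obj A

end BraidedStabilityGroupoid

/-! Tor is detected by Ext. The group (A ⊛ ℤ)_n is the quotient of A_n by the decomposable elements,
those generated by images from lower ranks, and a morphism from A to a module N supported in rank n
factors through this quotient. By this, Tor_i(A, ℤ)_n vanishes as soon as Ext^i(A, N) = 0 for all N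
supported in rank n (`isZero_tor`). Call A c-regular (`Reg`) if Ext^j(A, N) = 0 whenever N is
supported in a rank n > j + c. The goal is then max(d, r)-regularity of A.

The unit ℤ is 0-regular (`ExtVan.unit`). For fixed n, take the cosets of Young subgroups for tuples
(n_0, …, n_{p+1}) with n_0 ≥ 0, all other entries positive and n_1 + ⋯ + n_{p+1} < n. They span a
complex of `U𝒢`-modules, augmented to the constant module and then to the unit. Its terms are sums
of modules induced from ranks < n, so they have no Ext into modules supported in rank n. In ranks 0
< m < n prepending a zero contracts the complex. In rank n it is the splitting complex, where the
connectivity assumption applies.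

Let F_s be free on one generator of rank s. The functor - ⊛ F_s is exact and left adjoint to Σ^s, so
vanishing of Ext^i(B, Σ^s N) gives vanishing of Ext^i(B ⊛ F_s, N). Peeling off the top rank, it
follows that a module vanishing in ranks > d is d-regular (`Reg.of_bounded`). Regularity of the unit
also gives a free resolution K of the unit whose qth term is generated in ranks ≤ q (`reg_syz`).

The main step (`Reg.of_toSig`) compares two tensor products with K. The functor A ↦ A ⊛ K is exact
and receives a natural map from A. For N supported in a single rank, N → N ⊛ K has a retraction. By
dimension shifting every class in Ext^j(A, N) then factors through A → A ⊛ K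
(`exists_factorization`), so it suffices that A ⊛ K has no morphism to N[j] in the derived category.
The pointwise product A ⊗ K is a resolution of A ⊗ ℤ, which lives in rank 0. By the projection
formula A ⊗ F_s ≅ Σ^s A ⊛ F_s, the comparison A ⊛ K → A ⊗ K is in each degree a sum of maps (A → Σ^s
A) ⊛ F_s. Its kernel and cokernel are therefore governed by those of A → Σ^s A: if all these kernels
are c-regular and all cokernels (c - 1)-regular, with c ≥ 0, then A is c-regular.

The theorem follows by induction on r (`Poly.reg`). The map A → Σ^{s+1} A is the composite A → Σ^s A
→ Σ^{s+1} A, so its kernel vanishes in ranks > d, and its cokernel is controlled by that of A → Σ^s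
A and by Σ^s coker A. The braiding on ΣΣA shows that shifts of polynomial modules are polynomial. -/

namespace StabilityGroupoid

variable {S : StabilityGroupoid.{u}}

/-! ### Block sums of automorphisms and representatives of morphisms -/

lemma one_blk_one_blk {a b ab m bm n : ℕ} (h₁ : a + b = ab) (h₂ : ab + m = n) (h₃ : b + m = bm)
    (h₄ : a + bm = n) (x : S.G m) :
    S.blk h₄ (1, S.blk h₃ (1, x)) = S.blk h₂ (1, x) := by
  rw [← S.blk_assoc h₁ h₂ h₃ h₄, S.blk_one_one]

lemma blk_blk_one {a b ab m bm n : ℕ} (h₁ : a + b = ab) (h₂ : ab + m = n) (h₃ : b + m = bm)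
    (h₄ : a + bm = n) (x : S.G a) :
    S.blk h₂ (S.blk h₁ (x, 1), 1) = S.blk h₄ (x, 1) := by
  rw [S.blk_assoc h₁ h₂ h₃ h₄, S.blk_one_one]

lemma blk_comm_one {a b n : ℕ} (h : a + b = n) (x : S.G a) (y : S.G b) :
    S.blk h (1, y) * S.blk h (x, 1) = S.blk h (x, 1) * S.blk h (1, y) := by
  rw [blk_mul, blk_mul, one_mul, mul_one, one_mul, mul_one]

lemma blk_inv_left {a b n : ℕ} (h : a + b = n) (x : S.G a) :
    S.blk h (x⁻¹, 1) = (S.blk h (x, 1))⁻¹ := by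
  rw [← map_inv, Prod.inv_mk, inv_one]

lemma blk_inv_right {a b n : ℕ} (h : a + b = n) (x : S.G b) :
    S.blk h (1, x⁻¹) = (S.blk h (1, x))⁻¹ := by
  rw [← map_inv, Prod.inv_mk, inv_one]

lemma blk_mul_left {a b n : ℕ} (h : a + b = n) (x y : S.G a) :
    S.blk h (x * y, 1) = S.blk h (x, 1) * S.blk h (y, 1) := by
  rw [blk_mul, one_mul]

lemma blk_mul_right {a b n : ℕ} (h : a + b = n) (x y : S.G b) :
    S.blk h (1, x * y) = S.blk h (1, x) * S.blk h (1, y) := by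
  rw [blk_mul, one_mul]

lemma UHom.mk_eq_iff {m n c : ℕ} (h : c + m = n) (f f' : S.G n) :
    (UHom.mk c h f : S.UHom m n) = UHom.mk c h f' ↔ ∃ k : S.G c, f = f' * S.blk h (k, 1) :=
  ⟨fun e => Quotient.exact e, fun ⟨k, e⟩ => UHom.mk_eq _ _ _ _ k e⟩

lemma UHom.aut_comp_mk {l n d : ℕ} (h : 0 + n = n) (e : d + l = n) (f g : S.G n) :
    UHom.comp (UHom.mk 0 h f) (UHom.mk d e g) = UHom.mk d e (f * g) := by
  rw [UHom.comp_mk]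
  refine UHom.mk_eq _ _ _ _ 1 ?_
  rw [blk_one_one, mul_one, S.one_blk]

lemma UHom.le {m n : ℕ} (x : S.UHom m n) : m ≤ n := by
  induction x using UHom.ind with
  | H c h f => omega

/-- Every morphism `s → n` has a representative in `G n`. -/
lemma UHom.exists_rep {s n : ℕ} (f : S.UHom s n) :
    ∃ (c : ℕ) (h : c + s = n) (g : S.G n), f = UHom.mk c h g := by
  induction f using UHom.ind with
  | H c h f => exact ⟨c, h, f, rfl⟩

variable (S)

/-- The map `x ↦ x ⊕ id_s` on morphisms. -/
def rshMap (s : ℕ) {m n : ℕ} (x : S.UHom m n) : S.UHom (m + s) (n + s) :=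
  Quotient.map (sa := S.homSetoid m n) (sb := S.homSetoid (m + s) (n + s))
    (fun x => ⟨x.c, by have := x.h; omega, S.blk rfl (x.f, 1)⟩)
    (by
      rintro ⟨c, h, f⟩ ⟨c', h', f'⟩ ⟨k, hk⟩
      refine ⟨k, ?_⟩
      dsimp only at hk ⊢
      rw [hk, blk_mul_left, blk_blk_one h' _ rfl]) x

variable {S}

lemma rshMap_mk (s : ℕ) {m n c : ℕ} (h : c + m = n) (f : S.G n) :
    S.rshMap s (UHom.mk c h f) = UHom.mk c (by omega) (S.blk rfl (f, 1)) := rfl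

variable (S)

/-- The endofunctor `- ⊕ id_s` of `U𝒢`. -/
def rsh (s : ℕ) : UCat S ⥤ UCat S where
  obj X := ⟨X.rank + s⟩
  map f := S.rshMap s f
  map_id := by
    rintro ⟨n⟩
    refine UHom.mk_eq _ _ _ _ 1 ?_
    simp only [blk_one_one, mul_one]
  map_comp := by
    rintro ⟨l⟩ ⟨m⟩ ⟨n⟩ x y
    induction x using UHom.ind with
    | H c h f =>
    induction y using UHom.ind with
    | H d e g =>
      refine UHom.mk_eq _ _ _ _ 1 ?_
      dsimp only at h e f g ⊢
      rw [blk_one_one, mul_one, ← S.blk_assoc e rfl rfl, blk_mul, one_mul]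

end StabilityGroupoid

/-! ### Sums of morphisms with identities on either side -/

namespace BraidedStabilityGroupoid

open StabilityGroupoid

variable {S : BraidedStabilityGroupoid.{u}}

/-- The hexagon identity with two trivial factors makes b_{n,0} an idempotent of a group. -/
lemma braid_zero {n k : ℕ} (h : n + 0 = k) : S.braid h = 1 := by
  obtain rfl : n = k := h
  have e := S.hexagon_left (l := n) (m := 0) (n := 0) (k := n) rfl rfl rfl rfl (by omega) rfl
  rw [S.one_blk, S.blk_one] at e
  exact mul_eq_left.1 e.symm

variable (S)

/-- In id_p ⊕ [f, c] the complement c sits behind p and has to be moved to the front by the inverse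
of b_{p,c}. Naturality of the braiding carries the ambiguity k ∈ G_c along. -/
lemma lsh_aux (p : ℕ) {m n c : ℕ} (h : c + m = n) (f f' : S.G n) (k : S.G c)
    (hk : f = f' * S.blk h (k, 1)) :
    (S.blk rfl (1, f) * S.blk (by omega) ((S.braid (m := p) (n := c) rfl)⁻¹, (1 : S.G m)) :
      S.G (p + n)) =
    S.blk rfl (1, f') * S.blk (by omega) ((S.braid (m := p) (n := c) rfl)⁻¹, (1 : S.G m)) *
      S.blk (by omega : c + (p + m) = p + n) (k, 1) := by
  have e : S.blk rfl ((1 : S.G p), S.blk h (k, (1 : S.G m))) =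
      S.blk (by omega : p + c + m = p + n) (S.blk rfl ((1 : S.G p), k), 1) :=
    (S.blk_assoc _ _ _ _ _ _ _).symm
  have e' : S.blk rfl ((1 : S.G p), k) * (S.braid (m := p) (n := c) rfl)⁻¹ =
      (S.braid (m := p) (n := c) rfl)⁻¹ * S.blk (Nat.add_comm c p) (k, 1) := by
    rw [eq_inv_mul_iff_mul_eq, ← mul_assoc, S.braid_natural rfl (Nat.add_comm c p),
      mul_inv_cancel_right]
  rw [hk, blk_mul_right, e, mul_assoc, ← blk_mul_left, e', blk_mul_left, ← mul_assoc,
    blk_blk_one (Nat.add_comm c p) _ rfl]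

/-- The map `x ↦ id_p ⊕ x` on morphisms. -/
def lshMap (p : ℕ) {m n : ℕ} (x : S.UHom m n) : S.UHom (p + m) (p + n) :=
  Quotient.map (sa := S.homSetoid m n) (sb := S.homSetoid (p + m) (p + n))
    (fun x => ⟨x.c, by have := x.h; omega, S.blk rfl (1, x.f) *
      S.blk (by have := x.h; omega) ((S.braid (m := p) (n := x.c) rfl)⁻¹, (1 : S.G m))⟩)
    (by
      rintro ⟨c, h, f⟩ ⟨c', h', f'⟩ ⟨k, hk⟩
      obtain rfl : c = c' := by omega
      exact ⟨k, S.lsh_aux p h f f' k hk⟩) x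

lemma lshMap_mk (p : ℕ) {m n c : ℕ} (h : c + m = n) (f : S.G n) :
    S.lshMap p (UHom.mk c h f) = UHom.mk c (by omega) (S.blk rfl (1, f) *
      S.blk (by omega) ((S.braid (m := p) (n := c) rfl)⁻¹, (1 : S.G m))) := rfl

/-- The endofunctor `id_p ⊕ -` of `U𝒢`. -/
def lsh (p : ℕ) : UCat S.toStabilityGroupoid ⥤ UCat S.toStabilityGroupoid where
  obj X := ⟨p + X.rank⟩
  map f := S.lshMap p f
  map_id := by
    rintro ⟨n⟩
    refine UHom.mk_eq _ _ _ _ 1 ?_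
    simp only [blk_one_one, mul_one, braid_zero, inv_one]
  map_comp := by
    rintro ⟨l⟩ ⟨m⟩ ⟨n⟩ x y
    induction x using UHom.ind with
    | H d e g =>
    induction y using UHom.ind with
    | H c h f =>
      refine UHom.mk_eq _ _ _ _ 1 ?_
      dsimp only at h e f g ⊢
      -- Functoriality of id_p ⊕ - reduces to moving c ⊕ d past p in two stages.
      have hex := S.hexagon_left (l := p) (m := c) (n := d) (k := p + (c + d)) rfl rfl rfl rfl
        (by omega) (by omega)
      rw [hex, mul_inv_rev, ← blk_inv_left, ← blk_inv_right, blk_mul_left, blk_mul_right,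
        blk_one_one, mul_one, blk_mul_right]
      have e₁ : S.blk rfl ((1 : S.G p), S.blk h ((1 : S.G c), g)) =
          S.blk (by omega : p + c + m = p + n) (1, g) := one_blk_one_blk rfl _ _ _ _
      have e₂ : S.blk (by omega : c + (p + m) = p + n) ((1 : S.G c), S.blk rfl ((1 : S.G p), g)) =
          S.blk (by omega : p + c + m = p + n) (1, g) := one_blk_one_blk (by omega) _ _ _ _
      have e₃ : S.blk (by omega : p + (c + d) + l = p + n)
          (S.blk (by omega : p + c + d = p + (c + d)) ((S.braid (m := p) (n := c) rfl)⁻¹, 1), 1) =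
          S.blk (by omega : p + c + m = p + n) ((S.braid (m := p) (n := c) rfl)⁻¹, 1) :=
        blk_blk_one _ _ e _ _
      have e₄ : S.blk (by omega : p + (c + d) + l = p + n)
          (S.blk (by omega : c + (p + d) = p + (c + d)) (1, (S.braid (m := p) (n := d) rfl)⁻¹), 1) =
          S.blk (by omega : c + (p + m) = p + n)
            ((1 : S.G c), S.blk (by omega : p + d + l = p + m)
              ((S.braid (m := p) (n := d) rfl)⁻¹, 1)) := S.blk_assoc _ _ _ _ _ _ _
      rw [e₁, e₂, e₃, e₄]
      rw [mul_assoc, mul_assoc, ← mul_assoc (S.blk _ (1, g)), blk_comm_one]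
      simp only [mul_assoc]

/-- `(x ⊕ id) ∘ (id ⊕ y) = (id ⊕ y) ∘ (x ⊕ id)` -/
lemma interchange {p p' q q' : ℕ} (x : S.UHom p p') (y : S.UHom q q') :
    UHom.comp (S.rshMap q' x) (S.lshMap p y) = UHom.comp (S.lshMap p' y) (S.rshMap q x) := by
  induction x using UHom.ind with
  | H c h f =>
  induction y using UHom.ind with
  | H d e g =>
    rw [rshMap_mk, lshMap_mk, lshMap_mk, rshMap_mk, UHom.comp_mk, UHom.comp_mk]
    -- The two composites list their complements in opposite orders, so their representatives differ
    -- by the braiding of c and d.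
    refine (UHom.mk_eq (c' := c + d) (by omega) (by omega) _ _
      (S.braid (m := c) (n := d) rfl)⁻¹ ?_).symm
    have hex := S.hexagon_right (l := c) (m := p) (n := d) (k := p' + d) h rfl rfl rfl
      (by omega) (by omega)
    have nat : (S.braid (m := p') (n := d) rfl)⁻¹ * S.blk (Nat.add_comm d p') (1, f) =
        S.blk rfl (f, 1) * (S.braid (m := p') (n := d) rfl)⁻¹ := by
      rw [inv_mul_eq_iff_eq_mul, ← mul_assoc, S.braid_natural rfl (Nat.add_comm d p'),
        mul_inv_cancel_right]
    have e₁ : S.blk (by omega : d + (p' + q) = p' + q') ((1 : S.G d), S.blk rfl (f, (1 : S.G q))) =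
        S.blk (by omega : p' + d + q = p' + q') (S.blk (Nat.add_comm d p') (1, f), 1) :=
      (S.blk_assoc _ _ _ _ _ _ _).symm
    have e₂ : S.blk (by omega : p' + d + q = p' + q') (S.blk rfl (f, (1 : S.G d)), 1) =
        S.blk rfl (f, 1) := blk_blk_one _ _ e _ _
    have e₃ : S.blk (by omega : c + (p + q') = p' + q') ((1 : S.G c), S.blk rfl ((1 : S.G p), g)) =
        S.blk rfl (1, g) := one_blk_one_blk h _ _ _ _
    have e₄ : S.blk (by omega : c + (p + q') = p' + q') ((1 : S.G c),
        S.blk (by omega : p + d + q = p + q') ((S.braid (m := p) (n := d) rfl)⁻¹, 1)) =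
        S.blk (by omega : p' + d + q = p' + q')
          (S.blk (by omega : c + (p + d) = p' + d) (1, (S.braid (m := p) (n := d) rfl)⁻¹), 1) :=
      (S.blk_assoc _ _ _ _ _ _ _).symm
    have e₅ : S.blk (by omega : p' + d + q = p' + q')
        (S.blk (by omega : c + d + p = p' + d) ((S.braid (m := c) (n := d) rfl)⁻¹, 1), 1) =
        S.blk (by omega : c + d + (p + q) = p' + q') ((S.braid (m := c) (n := d) rfl)⁻¹, 1) :=
      blk_blk_one _ _ rfl _ _
    rw [e₁, mul_assoc, ← blk_mul_left, nat, blk_mul_left, e₂, blk_mul_right, e₃, e₄, ← mul_assoc,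
      ← mul_assoc, blk_comm_one, hex, mul_inv_rev, ← blk_inv_left, ← blk_inv_right, blk_mul_left,
      e₅, ← mul_assoc]

/-- `(id_p ⊕ y) ∘ (ι_p ⊕ id) = (ι_p ⊕ id) ∘ y` -/
lemma lshMap_comp_insLeft (p : ℕ) {q q' : ℕ} (y : S.UHom q q') :
    UHom.comp (S.lshMap p y) (UHom.mk p rfl 1) = UHom.comp (UHom.mk p rfl 1) y := by
  induction y using UHom.ind with
  | H d e g =>
    rw [lshMap_mk, UHom.comp_mk, UHom.comp_mk]
    refine UHom.mk_eq (c' := p + d) _ (by omega) _ _ (S.braid (m := p) (n := d) rfl)⁻¹ ?_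
    rw [blk_one_one, mul_one, one_mul]

/-- `(x ⊕ id) ∘ (ι ⊕ id) = ι ⊕ id` -/
lemma rshMap_comp_insLeft {p p' : ℕ} (q : ℕ) (x : S.UHom p p') :
    UHom.comp (S.rshMap q x) (UHom.mk p rfl 1) = UHom.mk p' rfl 1 := by
  induction x using UHom.ind with
  | H c h f =>
    rw [rshMap_mk, UHom.comp_mk]
    refine UHom.mk_eq (c' := p') _ _ _ _ f ?_
    rw [blk_one_one, mul_one, one_mul]

lemma rshMap_zero {p p' : ℕ} (x : S.UHom p p') : S.rshMap 0 x = x := by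
  induction x using UHom.ind with
  | H c h f =>
    rw [rshMap_mk, S.blk_one]

/-- `id_p ⊕ ι_q : p → p ⊕ q` -/
def insR (p q : ℕ) : S.UHom p (p + q) := S.lshMap p (UHom.mk q (Nat.add_zero q) 1 : S.UHom 0 q)

lemma insR_eq (p q : ℕ) :
    S.insR p q = UHom.mk q (Nat.add_comm q p) (S.braid (m := p) (n := q) rfl)⁻¹ := by
  rw [insR, lshMap_mk, blk_one_one, one_mul, S.blk_one]

lemma rshMap_comp_insR {p p' : ℕ} (q : ℕ) (x : S.UHom p p') :
    UHom.comp (S.rshMap q x) (S.insR p q) = UHom.comp (S.insR p' q) x := by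
  rw [insR, insR, S.interchange, S.rshMap_zero]

/-- The object 0 is initial: the complement of 0 in q' is all of q', so every element of G_{q'} is
divided out. -/
lemma comp_ini {q q' : ℕ} (y : S.UHom q q') :
    UHom.comp y (UHom.mk q (Nat.add_zero q) 1 : S.UHom 0 q) = UHom.mk q' (Nat.add_zero q') 1 := by
  induction y using UHom.ind with
  | H d e g =>
    rw [UHom.comp_mk]
    refine UHom.mk_eq (c' := q') _ _ _ _ g ?_
    rw [blk_one_one, mul_one, one_mul, S.blk_one]

lemma lshMap_comp (p : ℕ) {l m n : ℕ} (y : S.UHom m n) (x : S.UHom l m) :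
    S.lshMap p (UHom.comp y x) = UHom.comp (S.lshMap p y) (S.lshMap p x) :=
  (S.lsh p).map_comp (X := ⟨l⟩) (Y := ⟨m⟩) (Z := ⟨n⟩) x y

lemma lshMap_comp_insR (p : ℕ) {q q' : ℕ} (y : S.UHom q q') :
    UHom.comp (S.lshMap p y) (S.insR p q) = S.insR p q' := by
  rw [insR, ← S.lshMap_comp, S.comp_ini, insR]

/-- A morphism out of `m ⊕ s` is determined by its restriction to `s` and a unique morphism
from `m` to the complement. -/
lemma existsUnique_factor {m s n c : ℕ} (h : c + s = n) (g : S.G n) (w : S.UHom (m + s) n)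
    (hw : UHom.comp w (UHom.mk m rfl 1) = (UHom.mk c h g : S.UHom s n)) :
    ∃! γ : S.UHom m c, w = UHom.comp (UHom.mk 0 (by omega) g : S.UHom (c + s) n) (S.rshMap s γ) := by
  induction w using UHom.ind with
  | H d e f =>
    rw [UHom.comp_mk, blk_one_one, mul_one] at hw
    obtain rfl : c = d + m := by omega
    obtain rfl := h
    obtain ⟨x, rfl⟩ := (UHom.mk_eq_iff _ _ _).1 hw
    refine ⟨UHom.mk d rfl x, ?_, fun γ hγ => ?_⟩
    · dsimp only
      exact (UHom.aut_comp_mk _ _ _ _).symm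
    · induction γ using UHom.ind with
      | H d' e' x' =>
        obtain rfl : d = d' := by omega
        obtain ⟨k, hk⟩ := (UHom.mk_eq_iff _ _ _).1 (hγ.trans (UHom.aut_comp_mk _ _ _ _))
        -- Writing k ⊕ id_{m+s} as (k ⊕ id_m) ⊕ id_s lets injectivity of ⊕ cancel the summand s. The
        -- remaining k ∈ G_d is exactly what is divided out in a morphism m → d ⊕ m.
        rw [mul_assoc, mul_right_inj, ← S.blk_blk_one (ab := d + m) (b := m) rfl rfl rfl,
          ← blk_mul_left] at hk
        obtain rfl := congrArg Prod.fst (S.blk_injective rfl hk)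
        exact (UHom.mk_eq _ _ _ _ k rfl).symm

end BraidedStabilityGroupoid

/-! ### Modules over `U𝒢` in terms of elements -/

namespace BraidedStabilityGroupoid

open StabilityGroupoid

variable {S : BraidedStabilityGroupoid.{u}}

/-- The action of a morphism of `U𝒢` on a `U𝒢`-module. -/
def act (A : S.UMod) {m n : ℕ} (x : S.UHom m n) : A.obj ⟨m⟩ →ₗ[ℤ] A.obj ⟨n⟩ :=
  (A.map (X := ⟨m⟩) (Y := ⟨n⟩) x).hom

lemma act_comp (A : S.UMod) {l m n : ℕ} (x : S.UHom m n) (y : S.UHom l m) (a : A.obj ⟨l⟩) :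
    act A (UHom.comp x y) a = act A x (act A y a) :=
  congrArg (fun f => f.hom a) (A.map_comp (X := ⟨l⟩) (Y := ⟨m⟩) (Z := ⟨n⟩) y x)

/-- The identity morphism. -/
abbrev idHom (S : BraidedStabilityGroupoid.{u}) (n : ℕ) : S.UHom n n := UHom.mk 0 (Nat.zero_add n) 1

lemma comp_idHom {m n : ℕ} (x : S.UHom m n) : UHom.comp x (S.idHom m) = x :=
  Category.id_comp (X := (⟨m⟩ : UCat S.toStabilityGroupoid)) (Y := ⟨n⟩) x

lemma idHom_comp {m n : ℕ} (x : S.UHom m n) : UHom.comp (S.idHom n) x = x :=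
  Category.comp_id (X := (⟨m⟩ : UCat S.toStabilityGroupoid)) (Y := ⟨n⟩) x

lemma comp_assoc {k l m n : ℕ} (x : S.UHom m n) (y : S.UHom l m) (z : S.UHom k l) :
    UHom.comp (UHom.comp x y) z = UHom.comp x (UHom.comp y z) :=
  (Category.assoc (W := (⟨k⟩ : UCat S.toStabilityGroupoid)) (X := ⟨l⟩) (Y := ⟨m⟩) (Z := ⟨n⟩)
    z y x).symm

lemma rshMap_comp (s : ℕ) {l m n : ℕ} (y : S.UHom m n) (x : S.UHom l m) :
    S.rshMap s (UHom.comp y x) = UHom.comp (S.rshMap s y) (S.rshMap s x) :=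
  (S.rsh s).map_comp (X := ⟨l⟩) (Y := ⟨m⟩) (Z := ⟨n⟩) x y

lemma lshMap_idHom (p n : ℕ) : S.lshMap p (S.idHom n) = S.idHom (p + n) :=
  (S.lsh p).map_id ⟨n⟩

lemma act_idHom (A : S.UMod) {n : ℕ} (a : A.obj ⟨n⟩) : act A (S.idHom n) a = a :=
  congrArg (fun f => f.hom a) (A.map_id ⟨n⟩)

lemma app_act {A B : S.UMod} (φ : A ⟶ B) {m n : ℕ} (x : S.UHom m n) (a : A.obj ⟨m⟩) :
    (φ.app ⟨n⟩).hom (act A x a) = act B x ((φ.app ⟨m⟩).hom a) :=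
  congrArg (fun f => f.hom a) (φ.naturality (X := ⟨m⟩) (Y := ⟨n⟩) x)

lemma umod_hom_ext {A B : S.UMod} {φ ψ : A ⟶ B}
    (h : ∀ n (a : A.obj ⟨n⟩), (φ.app ⟨n⟩).hom a = (ψ.app ⟨n⟩).hom a) : φ = ψ := by
  ext ⟨n⟩ : 2
  exact ModuleCat.hom_ext (LinearMap.ext (h n))

/-- A morphism of `U𝒢`-modules from its components. -/
def umodHom {A B : S.UMod} (f : ∀ n, A.obj ⟨n⟩ →ₗ[ℤ] B.obj ⟨n⟩)
    (h : ∀ {m n} (x : S.UHom m n) a, f n (act A x a) = act B x (f m a)) : A ⟶ B where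
  app X := ModuleCat.ofHom (f X.rank)
  naturality _ _ x := ModuleCat.hom_ext (LinearMap.ext fun a => h x a)

/-! ### The tensor product over the constant module -/

/-- Symbols `a ⊗ b ⊗ w` with `w : p ⊕ q → n`. -/
structure DaySymb (A M : S.UMod) (n : ℕ) : Type u where
  p : ℕ
  q : ℕ
  a : A.obj ⟨p⟩
  b : M.obj ⟨q⟩
  w : S.UHom (p + q) n

/-- The generator `a ⊗ b ⊗ w` of the free abelian group on the symbols. -/
noncomputable def daySymb {A M : S.UMod} {n p q : ℕ} (a : A.obj ⟨p⟩) (b : M.obj ⟨q⟩)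
    (w : S.UHom (p + q) n) : DaySymb A M n →₀ ℤ :=
  Finsupp.single ⟨p, q, a, b, w⟩ 1

/-- The relations of the coend `∫ A_p ⊗ M_q ⊗ ℤ[Hom(p ⊕ q, n)]`. -/
inductive DayRel (A M : S.UMod) (n : ℕ) : (DaySymb A M n →₀ ℤ) → Prop
  | add_left {p q : ℕ} (a a' : A.obj ⟨p⟩) (b : M.obj ⟨q⟩) (w : S.UHom (p + q) n) :
      DayRel A M n (daySymb (a + a') b w - (daySymb a b w + daySymb a' b w))
  | add_right {p q : ℕ} (a : A.obj ⟨p⟩) (b b' : M.obj ⟨q⟩) (w : S.UHom (p + q) n) :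
      DayRel A M n (daySymb a (b + b') w - (daySymb a b w + daySymb a b' w))
  | nat_left {p p' q : ℕ} (x : S.UHom p' p) (a : A.obj ⟨p'⟩) (b : M.obj ⟨q⟩)
      (w : S.UHom (p + q) n) :
      DayRel A M n (daySymb (act A x a) b w - daySymb a b (UHom.comp w (S.rshMap q x)))
  | nat_right {p q q' : ℕ} (y : S.UHom q' q) (a : A.obj ⟨p⟩) (b : M.obj ⟨q'⟩)
      (w : S.UHom (p + q) n) :
      DayRel A M n (daySymb a (act M y b) w - daySymb a b (UHom.comp w (S.lshMap p y)))

/-- The coend `∫ A_p ⊗ M_q ⊗ ℤ[Hom(p ⊕ q, n)]`. -/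
abbrev DayObj (A M : S.UMod) (n : ℕ) : Type u :=
  (DaySymb A M n →₀ ℤ) ⧸ Submodule.span ℤ {x | DayRel A M n x}

/-- The class of `a ⊗ b ⊗ w`. -/
noncomputable def dayMk {A M : S.UMod} {n p q : ℕ} (a : A.obj ⟨p⟩) (b : M.obj ⟨q⟩)
    (w : S.UHom (p + q) n) : DayObj A M n :=
  Submodule.Quotient.mk (daySymb a b w)

lemma linearCombination_single_one {R W ι : Type*} [Ring R] [AddCommGroup W] [Module R W]
    (f : ι → W) (i : ι) : Finsupp.linearCombination R f (Finsupp.single i 1) = f i := by simp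

section

variable {A M : S.UMod} {n : ℕ}

lemma dayMk_add_left {p q : ℕ} (a a' : A.obj ⟨p⟩) (b : M.obj ⟨q⟩) (w : S.UHom (p + q) n) :
    dayMk (a + a') b w = dayMk a b w + dayMk a' b w :=
  (Submodule.Quotient.eq _).2 (Submodule.subset_span (.add_left ..))

lemma dayMk_add_right {p q : ℕ} (a : A.obj ⟨p⟩) (b b' : M.obj ⟨q⟩) (w : S.UHom (p + q) n) :
    dayMk a (b + b') w = dayMk a b w + dayMk a b' w :=
  (Submodule.Quotient.eq _).2 (Submodule.subset_span (.add_right ..))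

lemma dayMk_act_left {p p' q : ℕ} (x : S.UHom p' p) (a : A.obj ⟨p'⟩) (b : M.obj ⟨q⟩)
    (w : S.UHom (p + q) n) :
    dayMk (act A x a) b w = dayMk a b (UHom.comp w (S.rshMap q x)) :=
  (Submodule.Quotient.eq _).2 (Submodule.subset_span (.nat_left ..))

lemma dayMk_act_right {p q q' : ℕ} (y : S.UHom q' q) (a : A.obj ⟨p⟩) (b : M.obj ⟨q'⟩)
    (w : S.UHom (p + q) n) :
    dayMk a (act M y b) w = dayMk a b (UHom.comp w (S.lshMap p y)) :=
  (Submodule.Quotient.eq _).2 (Submodule.subset_span (.nat_right ..))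

lemma dayHom_ext {W : Type*} [AddCommGroup W] [Module ℤ W] {f f' : DayObj A M n →ₗ[ℤ] W}
    (h : ∀ {p q : ℕ} (a : A.obj ⟨p⟩) (b : M.obj ⟨q⟩) (w : S.UHom (p + q) n),
      f (dayMk a b w) = f' (dayMk a b w)) : f = f' :=
  Submodule.linearMap_qext _ (Finsupp.lhom_ext' fun s => LinearMap.ext_ring (h s.a s.b s.w))

/-- The universal property of the coend. -/
noncomputable def dayLift {W : Type*} [AddCommGroup W] [Module ℤ W]
    (φ : ∀ p q, S.UHom (p + q) n → A.obj ⟨p⟩ → M.obj ⟨q⟩ → W)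
    (hal : ∀ {p q} w a a' b, φ p q w (a + a') b = φ p q w a b + φ p q w a' b)
    (har : ∀ {p q} w a b b', φ p q w a (b + b') = φ p q w a b + φ p q w a b')
    (hl : ∀ {p p' q} (x : S.UHom p' p) a (b : M.obj ⟨q⟩) (w : S.UHom (p + q) n),
      φ p q w (act A x a) b = φ p' q (UHom.comp w (S.rshMap q x)) a b)
    (hr : ∀ {p q q'} (y : S.UHom q' q) a b (w : S.UHom (p + q) n),
      φ p q w a (act M y b) = φ p q' (UHom.comp w (S.lshMap p y)) a b) :
    DayObj A M n →ₗ[ℤ] W :=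
  Submodule.liftQ _ (Finsupp.linearCombination ℤ fun s : DaySymb A M n => φ s.p s.q s.w s.a s.b)
    (by
      refine Submodule.span_le.2 ?_
      intro x hx
      change _ = (0 : W)
      have h1 {p q : ℕ} (a : A.obj ⟨p⟩) (b : M.obj ⟨q⟩) (w : S.UHom (p + q) n) :
          Finsupp.linearCombination ℤ (fun s : DaySymb A M n => φ s.p s.q s.w s.a s.b)
            (daySymb a b w) = φ p q w a b := linearCombination_single_one _ _
      cases hx with
      | add_left a a' b w => rw [map_sub, map_add, h1, h1, h1, hal, sub_self]
      | add_right a b b' w => rw [map_sub, map_add, h1, h1, h1, har, sub_self]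
      | nat_left x a b w => rw [map_sub, h1, h1, hl, sub_self]
      | nat_right y a b w => rw [map_sub, h1, h1, hr, sub_self])

lemma dayLift_mk {W : Type*} [AddCommGroup W] [Module ℤ W]
    (φ : ∀ p q, S.UHom (p + q) n → A.obj ⟨p⟩ → M.obj ⟨q⟩ → W) (hal) (har) (hl) (hr)
    {p q : ℕ} (a : A.obj ⟨p⟩) (b : M.obj ⟨q⟩) (w : S.UHom (p + q) n) :
    dayLift φ hal har hl hr (dayMk a b w) = φ p q w a b :=
  linearCombination_single_one (R := ℤ)
    (fun s : DaySymb A M n => φ s.p s.q s.w s.a s.b) ⟨p, q, a, b, w⟩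

variable (A M) in
/-- The action of a morphism of `U𝒢` on the coend. -/
noncomputable def dayAct {m : ℕ} (x : S.UHom m n) : DayObj A M m →ₗ[ℤ] DayObj A M n :=
  dayLift (fun _ _ w a b => dayMk a b (UHom.comp x w))
    (fun _ _ _ _ => dayMk_add_left ..) (fun _ _ _ _ => dayMk_add_right ..)
    (fun x a b w => by rw [dayMk_act_left, comp_assoc])
    (fun x a b w => by rw [dayMk_act_right, comp_assoc])

lemma dayAct_mk {m p q : ℕ} (x : S.UHom m n) (a : A.obj ⟨p⟩) (b : M.obj ⟨q⟩)
    (w : S.UHom (p + q) m) : dayAct A M x (dayMk a b w) = dayMk a b (UHom.comp x w) :=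
  dayLift_mk (fun _ _ w a b => dayMk a b (UHom.comp x w)) _ _ _ _ a b w

end

/-- The `U𝒢`-module `A ⊛ M`, the tensor product over the constant module. -/
noncomputable def day (A M : S.UMod) : S.UMod where
  obj X := ModuleCat.of ℤ (DayObj A M X.rank)
  map f := ModuleCat.ofHom (dayAct A M f)
  map_id X := ModuleCat.hom_ext (dayHom_ext fun a b w =>
    (dayAct_mk ..).trans (congrArg (dayMk a b) (idHom_comp w)))
  map_comp f g := ModuleCat.hom_ext (dayHom_ext fun a b w =>
    (dayAct_mk ..).trans ((congrArg (dayMk a b) (comp_assoc _ _ _)).trans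
      ((congrArg _ (dayAct_mk f a b w)).trans (dayAct_mk ..)).symm))

lemma act_dayMk (A M : S.UMod) {m n p q : ℕ} (x : S.UHom m n) (a : A.obj ⟨p⟩) (b : M.obj ⟨q⟩)
    (w : S.UHom (p + q) m) :
    act (day A M) x (dayMk a b w : DayObj A M m) = (dayMk a b (UHom.comp x w) : DayObj A M n) :=
  dayAct_mk x a b w

/-- A natural pairing `A_p × M_q → B_{p+q}`. -/
structure DayPairing (A M B : S.UMod) where
  φ : ∀ p q, A.obj ⟨p⟩ → M.obj ⟨q⟩ → B.obj ⟨p + q⟩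
  add_left : ∀ {p q} a a' b, φ p q (a + a') b = φ p q a b + φ p q a' b
  add_right : ∀ {p q} a b b', φ p q a (b + b') = φ p q a b + φ p q a b'
  act_left : ∀ {p p' q} (x : S.UHom p' p) a (b : M.obj ⟨q⟩),
    φ p q (act A x a) b = act B (S.rshMap q x) (φ p' q a b)
  act_right : ∀ {p q q'} (y : S.UHom q' q) (a : A.obj ⟨p⟩) b,
    φ p q a (act M y b) = act B (S.lshMap p y) (φ p q' a b)

/-- The components of `dayDesc`. -/
noncomputable def dayDescApp {A M B : S.UMod} (P : DayPairing A M B) (n : ℕ) :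
    DayObj A M n →ₗ[ℤ] B.obj ⟨n⟩ :=
  dayLift (fun p q w a b => act B w (P.φ p q a b))
    (fun w a a' b => by rw [P.add_left, map_add])
    (fun w a b b' => by rw [P.add_right, map_add])
    (fun x a b w => by rw [P.act_left, act_comp])
    (fun x a b w => by rw [P.act_right, act_comp])

lemma dayDescApp_mk {A M B : S.UMod} (P : DayPairing A M B) {n p q : ℕ} (a : A.obj ⟨p⟩)
    (b : M.obj ⟨q⟩) (w : S.UHom (p + q) n) :
    dayDescApp P n (dayMk a b w) = act B w (P.φ p q a b) :=
  dayLift_mk (fun p q w a b => act B w (P.φ p q a b)) _ _ _ _ a b w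

/-- The morphism `A ⊛ M ⟶ B` given by a natural pairing. -/
noncomputable def dayDesc {A M B : S.UMod} (P : DayPairing A M B) : day A M ⟶ B :=
  umodHom (A := day A M) (dayDescApp P) (by
    intro m n x a
    have : dayDescApp P n ∘ₗ dayAct A M x = act B x ∘ₗ dayDescApp P m :=
      dayHom_ext fun a b w => by
        rw [LinearMap.comp_apply, LinearMap.comp_apply, dayAct_mk, dayDescApp_mk, dayDescApp_mk,
          act_comp]
    exact LinearMap.congr_fun this a)

lemma dayDesc_mk {A M B : S.UMod} (P : DayPairing A M B) {n p q : ℕ} (a : A.obj ⟨p⟩)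
    (b : M.obj ⟨q⟩) (w : S.UHom (p + q) n) :
    ((dayDesc P).app ⟨n⟩).hom (dayMk a b w : DayObj A M n) = act B w (P.φ p q a b) :=
  dayDescApp_mk P a b w

lemma day_hom_ext {A M B : S.UMod} {φ ψ : day A M ⟶ B}
    (h : ∀ {p q : ℕ} (a : A.obj ⟨p⟩) (b : M.obj ⟨q⟩),
      (φ.app ⟨p + q⟩).hom (dayMk a b (S.idHom (p + q)) : DayObj A M (p + q)) =
        (ψ.app ⟨p + q⟩).hom (dayMk a b (S.idHom (p + q)) : DayObj A M (p + q))) : φ = ψ := by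
  ext ⟨n⟩ : 2
  refine ModuleCat.hom_ext (dayHom_ext fun a b w => ?_)
  rw [← comp_idHom w, ← act_dayMk]
  exact (app_act φ w _).trans ((congrArg _ (h a b)).trans (app_act ψ w _).symm)

/-- Functoriality of `A ⊛ M` in both variables. -/
noncomputable def dayMap {A A' M M' : S.UMod} (α : A ⟶ A') (β : M ⟶ M') : day A M ⟶ day A' M' :=
  dayDesc (B := day A' M')
    { φ := fun p q a b => dayMk ((α.app ⟨p⟩).hom a) ((β.app ⟨q⟩).hom b) (S.idHom (p + q))
      add_left := fun a a' b => by rw [map_add, dayMk_add_left]; rfl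
      add_right := fun a b b' => by rw [map_add, dayMk_add_right]; rfl
      act_left := fun {p p' q} x a b => by
        rw [app_act, act_dayMk, dayMk_act_left, comp_idHom, idHom_comp]
      act_right := fun {p q q'} y a b => by
        rw [app_act, act_dayMk, dayMk_act_right, comp_idHom, idHom_comp] }

lemma dayMap_mk {A A' M M' : S.UMod} (α : A ⟶ A') (β : M ⟶ M') {n p q : ℕ} (a : A.obj ⟨p⟩)
    (b : M.obj ⟨q⟩) (w : S.UHom (p + q) n) :
    ((dayMap α β).app ⟨n⟩).hom (dayMk a b w : DayObj A M n) =
      (dayMk ((α.app ⟨p⟩).hom a) ((β.app ⟨q⟩).hom b) w : DayObj A' M' n) := by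
  refine (dayDesc_mk _ a b w).trans ?_
  rw [act_dayMk, comp_idHom]

lemma dayMap_comp {A A' A'' M M' M'' : S.UMod} (α : A ⟶ A') (α' : A' ⟶ A'') (β : M ⟶ M')
    (β' : M' ⟶ M'') : dayMap (α ≫ α') (β ≫ β') = dayMap α β ≫ dayMap α' β' :=
  day_hom_ext fun {p q} a b => (dayMap_mk ..).trans
    (((congrArg _ (dayMap_mk ..)).trans (dayMap_mk ..)).symm)

lemma dayMap_id (A M : S.UMod) : dayMap (𝟙 A) (𝟙 M) = 𝟙 (day A M) :=
  day_hom_ext fun a b => dayMap_mk ..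

lemma dayMap_add_left {A A' M M' : S.UMod} (α α' : A ⟶ A') (β : M ⟶ M') :
    dayMap (α + α') β = dayMap α β + dayMap α' β :=
  day_hom_ext fun a b => (dayMap_mk ..).trans ((dayMk_add_left ..).trans
    (congrArg₂ (· + ·) (dayMap_mk ..).symm (dayMap_mk ..).symm))

lemma dayMap_add_right {A A' M M' : S.UMod} (α : A ⟶ A') (β β' : M ⟶ M') :
    dayMap α (β + β') = dayMap α β + dayMap α β' :=
  day_hom_ext fun a b => (dayMap_mk ..).trans ((dayMk_add_right ..).trans
    (congrArg₂ (· + ·) (dayMap_mk ..).symm (dayMap_mk ..).symm))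

/-- The functor `A ⊛ -`. -/
@[simps]
noncomputable def dayL (A : S.UMod) : S.UMod ⥤ S.UMod where
  obj M := day A M
  map β := dayMap (𝟙 A) β
  map_id M := dayMap_id A M
  map_comp β β' := by rw [← dayMap_comp, Category.comp_id]

/-- The functor `- ⊛ M`. -/
@[simps]
noncomputable def dayR (M : S.UMod) : S.UMod ⥤ S.UMod where
  obj A := day A M
  map α := dayMap α (𝟙 M)
  map_id A := dayMap_id A M
  map_comp α α' := by rw [← dayMap_comp, Category.comp_id]

instance (A : S.UMod) : (dayL A).Additive where
  map_add := dayMap_add_right ..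

instance (M : S.UMod) : (dayR M).Additive where
  map_add := dayMap_add_left ..

end BraidedStabilityGroupoid

/-! ### Vanishing of Ext: dimension shifting, adjunctions and coproducts -/

section ExtVanishing

universe w w' v₁ u₁

open CategoryTheory.Abelian

variable {C : Type u₁} [Category.{v₁} C] [Abelian C]

/-- The kernel sequence of an epimorphism. -/
@[simps]
noncomputable def kernelSequence {X Y : C} (f : X ⟶ Y) : ShortComplex C :=
  ShortComplex.mk (kernel.ι f) f (kernel.condition f)

lemma kernelSequence_shortExact {X Y : C} (f : X ⟶ Y) [Epi f] : (kernelSequence f).ShortExact where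
  exact := ShortComplex.exact_of_f_is_kernel _ (kernelIsKernel f)
  mono_f := inferInstanceAs (Mono (kernel.ι f))
  epi_g := ‹_›

/-- The cokernel sequence of a monomorphism. -/
@[simps]
noncomputable def cokernelSequence {X Y : C} (f : X ⟶ Y) : ShortComplex C :=
  ShortComplex.mk f (cokernel.π f) (cokernel.condition f)

lemma cokernelSequence_shortExact {X Y : C} (f : X ⟶ Y) [Mono f] :
    (cokernelSequence f).ShortExact where
  exact := ShortComplex.exact_of_g_is_cokernel _ (cokernelIsCokernel f)
  mono_f := ‹_›
  epi_g := inferInstanceAs (Epi (cokernel.π f))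

variable [HasExt.{w} C]

/-- `Ext^i(X, N) = 0` -/
def ExtVan (X N : C) (i : ℕ) : Prop := ∀ e : Ext X N i, e = 0

namespace ExtVan

variable {X Y N : C} {i : ℕ}

lemma of_iso (e : X ≅ Y) (h : ExtVan X N i) : ExtVan Y N i := fun x => by
  rw [← Ext.mk₀_id_comp x, ← e.inv_hom_id, ← Ext.mk₀_comp_mk₀, Ext.comp_assoc_of_second_deg_zero,
    h ((Ext.mk₀ e.hom).comp x (zero_add i)), Ext.comp_zero]

lemma zero_iff : ExtVan X N 0 ↔ ∀ f : X ⟶ N, f = 0 :=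
  ⟨fun h f => (Ext.mk₀_eq_zero_iff f).1 (h _), fun h e => by
    rw [← Ext.mk₀_homEquiv₀_apply e, h (Ext.homEquiv₀ e), Ext.mk₀_zero]⟩

lemma of_isZero (h : IsZero X) : ExtVan X N i := fun x => by
  rw [← Ext.mk₀_id_comp x, h.eq_zero_of_src (𝟙 X), Ext.mk₀_zero, Ext.zero_comp]

lemma projective (P : C) [Projective P] : ExtVan P N (i + 1) := fun e => e.eq_zero_of_projective

lemma of_epi (f : X ⟶ Y) [Epi f] (h : ExtVan X N 0) : ExtVan Y N 0 :=
  zero_iff.2 fun g => by rw [← cancel_epi f, zero_iff.1 h (f ≫ g), comp_zero]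

variable {T : ShortComplex C} (hT : T.ShortExact)

include hT

lemma mid (h₁ : ExtVan T.X₁ N i) (h₃ : ExtVan T.X₃ N i) : ExtVan T.X₂ N i := fun e => by
  obtain ⟨x, rfl⟩ := Ext.contravariant_sequence_exact₂ hT _ e (h₁ _)
  rw [h₃ x, Ext.comp_zero]

lemma right (h₁ : ExtVan T.X₁ N i) (h₂ : ExtVan T.X₂ N (i + 1)) : ExtVan T.X₃ N (i + 1) :=
  fun e => by
    obtain ⟨x, rfl⟩ := Ext.contravariant_sequence_exact₃ hT _ e (h₂ _) (add_comm 1 i)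
    rw [h₁ x, Ext.comp_zero]

lemma left (h₂ : ExtVan T.X₂ N i) (h₃ : ExtVan T.X₃ N (i + 1)) : ExtVan T.X₁ N i := fun e => by
  obtain ⟨x, rfl⟩ := Ext.contravariant_sequence_exact₁ hT _ e (add_comm 1 i) (h₃ _)
  rw [h₂ x, Ext.comp_zero]

lemma right_zero (h₂ : ExtVan T.X₂ N 0) : ExtVan T.X₃ N 0 :=
  have := hT.epi_g
  of_epi T.g h₂

lemma exists_extension (h : ExtVan T.X₃ N 1) (f : T.X₁ ⟶ N) : ∃ g, T.f ≫ g = f := by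
  obtain ⟨x, hx⟩ := Ext.contravariant_sequence_exact₁ hT _ (Ext.mk₀ f) (add_comm 1 0) (h _)
  refine ⟨Ext.homEquiv₀ x, Ext.mk₀_bijective _ _ |>.1 ?_⟩
  rw [← Ext.mk₀_comp_mk₀, Ext.mk₀_homEquiv₀_apply, hx]

/-- As the middle term is projective, every class in Ext^1(X₃, N) comes from a map X₁ ⟶ N. Such a
class dies when the map extends to X₂. -/
lemma one_of_extension [Projective T.X₂] (h : ∀ f : T.X₁ ⟶ N, ∃ g, T.f ≫ g = f) :
    ExtVan T.X₃ N 1 := fun e => by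
  obtain ⟨x, rfl⟩ := Ext.contravariant_sequence_exact₃ hT _ e (projective _ _) (add_comm 1 0)
  obtain ⟨g, hg⟩ := h (Ext.homEquiv₀ x)
  rw [← Ext.mk₀_homEquiv₀_apply x, ← hg, ← Ext.mk₀_comp_mk₀, hT.extClass_comp_assoc]

end ExtVan

/-- An exact left adjoint `L ⊣ R` with `R` exact: `Ext^i(X, RN) = 0` implies `Ext^i(LX, N) = 0`. -/
lemma ExtVan.adjunction [EnoughProjectives C] {L R : C ⥤ C} (adj : L ⊣ R)
    [PreservesFiniteLimits L] [R.PreservesEpimorphisms] {X N : C} {i : ℕ}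
    (h : ExtVan X (R.obj N) i) : ExtVan (L.obj X) N i := by
  have : PreservesFiniteColimits L :=
    ⟨fun J _ _ => have := adj.leftAdjoint_preservesColimits; inferInstance⟩
  have : L.PreservesZeroMorphisms := by
    have := adj.isLeftAdjoint
    infer_instance
  induction i generalizing X with
  | zero =>
    rw [zero_iff] at h ⊢
    exact fun f => (adj.homEquiv _ _).injective ((h _).trans (h _).symm)
  | succ i ih =>
    have hT := kernelSequence_shortExact (Projective.π X)
    have hLT := hT.map_of_exact L
    have hP : Projective (L.obj (Projective.over X)) := adj.map_projective _ inferInstance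
    -- Degree one is separate: vanishing of Ext^1 only says that maps from the syzygy extend, not
    -- that they are zero. From degree two on, the syzygy inherits the hypothesis one degree lower.
    rcases i with - | i
    · have : Projective ((kernelSequence (Projective.π X)).map L).X₂ := hP
      refine one_of_extension hLT fun f => ?_
      obtain ⟨g, hg⟩ := exists_extension hT h (adj.homEquiv _ _ f)
      refine ⟨(adj.homEquiv _ _).symm g, (adj.homEquiv _ _).injective ?_⟩
      erw [adj.homEquiv_naturality_left]
      simpa using hg
    · have : Projective (kernelSequence (Projective.π X)).X₂ := Projective.projective_over X
      exact right hLT (ih (left hT (projective _) h))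
        (projective (i := i + 1) (L.obj (Projective.over X)))

omit [Abelian C] [HasExt.{w} C] in
lemma sigma_ι_map_comp {J : Type*} {f g : J → C} [HasCoproduct f] [HasCoproduct g]
    (p : ∀ j, f j ⟶ g j) {Z : C} (k : ∐ g ⟶ Z) (j : J) :
    Limits.Sigma.ι f j ≫ Limits.Sigma.map p ≫ k = p j ≫ Limits.Sigma.ι g j ≫ k := by
  rw [← Category.assoc, Limits.Sigma.ι_map, Category.assoc]

omit [Abelian C] [HasExt.{w} C] in
lemma sigma_ι_map_desc {J : Type*} {f g : J → C} [HasCoproduct f] [HasCoproduct g]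
    (p : ∀ j, f j ⟶ g j) {Z : C} (k : ∀ j, g j ⟶ Z) (j : J) :
    Limits.Sigma.ι f j ≫ Limits.Sigma.map p ≫ Limits.Sigma.desc k = p j ≫ k j := by
  rw [sigma_ι_map_comp, Limits.Sigma.ι_desc]

omit [HasExt.{w} C] in
/-- Coproducts of short exact sequences. -/
@[simps]
noncomputable def sigmaSequence {J : Type*} [HasCoproductsOfShape J C] (T : J → ShortComplex C) :
    ShortComplex C :=
  ShortComplex.mk (Limits.Sigma.map fun j => (T j).f) (Limits.Sigma.map fun j => (T j).g)
    (Limits.Sigma.hom_ext _ _ fun j => by simp)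

omit [HasExt.{w} C] in
-- Exactness of coproducts is needed only for the monomorphism. The rest is the universal property
-- of cokernels, summand by summand.
lemma sigmaSequence_shortExact {J : Type*} [HasCoproductsOfShape J C]
    [HasExactColimitsOfShape (Discrete J) C] {T : J → ShortComplex C}
    (hT : ∀ j, (T j).ShortExact) : (sigmaSequence T).ShortExact := by
  have h₁ (j : J) : Mono (T j).f := (hT j).mono_f
  have h₂ (j : J) : Epi (T j).g := (hT j).epi_g
  have hm : Mono (sigmaSequence T).f := by
    have h (j : Discrete J) : Mono ((Discrete.natTrans (F := Discrete.functor fun j => (T j).X₁)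
        (G := Discrete.functor fun j => (T j).X₂) fun j => (T j.as).f).app j) := h₁ j.as
    have := NatTrans.mono_of_mono_app (Discrete.natTrans
        (F := Discrete.functor fun j => (T j).X₁)
        (G := Discrete.functor fun j => (T j).X₂) fun j => (T j.as).f)
    exact inferInstanceAs (Mono (colim.map (Discrete.natTrans
        (F := Discrete.functor fun j => (T j).X₁)
        (G := Discrete.functor fun j => (T j).X₂) fun j => (T j.as).f)))
  have he : Epi (sigmaSequence T).g := inferInstanceAs (Epi (Limits.Sigma.map fun j => (T j).g))
  refine { exact := ShortComplex.exact_of_g_is_cokernel _ ?_ }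
  refine CokernelCofork.IsColimit.ofπ' _ _ fun k hk => ?_
  have hk' (j : J) : (T j).f ≫ Limits.Sigma.ι (fun j => (T j).X₂) j ≫ k = 0 := by
    refine (sigma_ι_map_comp (fun j => (T j).f) k j).symm.trans ?_
    exact (congrArg (Limits.Sigma.ι (fun j => (T j).X₁) j ≫ ·) hk).trans comp_zero
  refine ⟨Limits.Sigma.desc fun j => (hT j).gIsCokernel.desc (CokernelCofork.ofπ _ (hk' j)), ?_⟩
  refine Limits.Sigma.hom_ext _ _ fun j => ?_
  refine (sigma_ι_map_desc (fun j => (T j).g) _ j).trans ?_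
  exact (hT j).gIsCokernel.fac (CokernelCofork.ofπ _ (hk' j)) WalkingParallelPair.one

/-- The coproduct of projective presentations of the summands is a projective presentation of the
coproduct, so dimension shifting works for all summands at once. -/
lemma ExtVan.sigma [EnoughProjectives C] {J : Type*} [HasCoproductsOfShape J C]
    [HasExactColimitsOfShape (Discrete J) C] {X : J → C} {N : C} {i : ℕ}
    (h : ∀ j, ExtVan (X j) N i) : ExtVan (∐ X) N i := by
  induction i generalizing X with
  | zero =>
    refine zero_iff.2 fun f => Limits.Sigma.hom_ext _ _ fun j => ?_
    rw [zero_iff.1 (h j) (_ ≫ f), comp_zero]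
  | succ i ih =>
    have hT (j : J) := kernelSequence_shortExact (Projective.π (X j))
    have hS := sigmaSequence_shortExact hT
    have (j : J) : Projective (kernelSequence (Projective.π (X j))).X₂ :=
      Projective.projective_over (X j)
    have : Projective (sigmaSequence fun j => kernelSequence (Projective.π (X j))).X₂ :=
      projective_sigma _ fun j => Projective.projective_over (X j)
    rcases i with - | i
    · refine one_of_extension hS fun f => ?_
      choose g hg using fun j => exists_extension (hT j) (h j)
        (Limits.Sigma.ι (fun j => (kernelSequence (Projective.π (X j))).X₁) j ≫ f)
      refine ⟨Limits.Sigma.desc g, Limits.Sigma.hom_ext _ _ fun j => ?_⟩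
      exact (sigma_ι_map_desc (fun j => kernel.ι (Projective.π (X j))) g j).trans (hg j)
    · exact right hS (ih fun j => left (hT j) (projective _) (h j)) (projective _)

end ExtVanishing

/-! ### Vanishing of morphisms N[j] receives in the derived category -/

section DerivedVanishing

universe w w' v₁ u₁

open CategoryTheory.Abelian DerivedCategory Pretriangulated

variable {C : Type u₁} [Category.{v₁} C] [Abelian C] [HasDerivedCategory.{w'} C]

/-- The vanishing of `Hom(Y, N[j])` in the derived category. -/
def HomVan (Y : CochainComplex C ℤ) (N : C) (j : ℤ) : Prop :=
  ∀ f : Q.obj Y ⟶ ((singleFunctor C 0).obj N)⟦j⟧, f = 0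

namespace HomVan

variable {Y Y' : CochainComplex C ℤ} {N : C} {j : ℤ}

lemma of_quasiIso (φ : Y ⟶ Y') [QuasiIso φ] (h : HomVan Y' N j) : HomVan Y N j := fun f => by
  have : IsIso (Q.map φ) := (isIso_Q_map_iff_quasiIso C φ).2 ‹_›
  rw [← cancel_epi (inv (Q.map φ)), h (inv (Q.map φ) ≫ f), comp_zero]

/-- For the canonical t-structure, Y lies in degrees ≤ n and N[j] in degree -j > n. -/
lemma of_isLE (n : ℤ) [Y.IsLE n] (h : n + j < 0) : HomVan Y N j := fun f => by
  have : (((singleFunctor C 0).obj N)⟦j⟧).IsGE (-j) := TStructure.t.isGE_shift _ 0 j (-j)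
  exact TStructure.t.zero f n (-j) (by omega)

section

variable {T : ShortComplex (CochainComplex C ℤ)} (hT : T.ShortExact)

include hT

lemma mid (h₁ : HomVan T.X₁ N j) (h₃ : HomVan T.X₃ N j) : HomVan T.X₂ N j := fun f => by
  obtain ⟨g, rfl⟩ := Triangle.yoneda_exact₂ _ (triangleOfSES_distinguished hT) f (h₁ _)
  exact (congrArg ((triangleOfSES hT).mor₂ ≫ ·) (h₃ g)).trans comp_zero

/-- The composite with the connecting map X₃ ⟶ X₁[1] vanishes by the second hypothesis, so f[1]
factors through X₂[1] on the rotated triangle. -/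
lemma left (h₂ : HomVan T.X₂ N j) (h₃ : HomVan T.X₃ N (j + 1)) : HomVan T.X₁ N j := fun f => by
  have h : triangleOfSESδ hT ≫ f⟦(1 : ℤ)⟧' = 0 := by
    rw [← cancel_mono ((shiftFunctorAdd (DerivedCategory C) j 1).inv.app _), zero_comp]
    exact h₃ _
  obtain ⟨g, hg⟩ := Triangle.yoneda_exact₂ _ (rot_of_distTriang _ (rot_of_distTriang _
    (triangleOfSES_distinguished hT))) (f⟦(1 : ℤ)⟧') h
  obtain ⟨g, rfl⟩ := (shiftFunctor (DerivedCategory C) (1 : ℤ)).map_surjective g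
  apply (shiftFunctor (DerivedCategory C) (1 : ℤ)).map_injective
  refine hg.trans (.trans ?_ (Functor.map_zero _ _ _).symm)
  refine (congrArg (_ ≫ ·) ?_).trans comp_zero
  exact (congrArg _ (h₂ g)).trans (Functor.map_zero _ _ _)

end

section

variable [HasExt.{w} C]

lemma single_zero {X : C} {i : ℕ} (h : ExtVan X N i) :
    HomVan ((HomologicalComplex.single C (.up ℤ) 0).obj X) N i := fun f => by
  have := h (Ext.homEquiv.symm (f : ShiftedHom ((singleFunctor C 0).obj X) _ (i : ℤ)))
  have e := Ext.homEquiv.apply_symm_apply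
    (f : ShiftedHom ((singleFunctor C 0).obj X) ((singleFunctor C 0).obj N) (i : ℤ))
  rw [this] at e
  exact e.symm.trans (Ext.zero_hom _ _ _)

/-- Shifting by b turns morphisms from X in degree b to N[j] into Ext^{b+j}(X, N). -/
lemma single {X : C} (b : ℤ) {i : ℕ} (hb : b + j = i) (h : ExtVan X N i) :
    HomVan ((HomologicalComplex.single C (.up ℤ) b).obj X) N j := fun f => by
  apply (shiftFunctor (DerivedCategory C) b).map_injective
  rw [Functor.map_zero]
  let e := ((singleFunctors C).shiftIso b 0 b (add_zero b)).app X
  have := single_zero h (e.inv ≫ f⟦b⟧' ≫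
    (shiftFunctorAdd' (DerivedCategory C) j b i (by omega)).inv.app _)
  refine (cancel_mono ((shiftFunctorAdd' (DerivedCategory C) j b i (by omega)).inv.app _)).1 ?_
  exact (Iso.hom_inv_id_assoc e _).symm.trans (((congrArg (e.hom ≫ ·) this).trans comp_zero).trans
    zero_comp.symm)

/-- `Hom(Y, N[j]) = 0` for a bounded above complex `Y` if `Ext^{j+q}(Y^q, N) = 0` for all `q`. -/
lemma of_terms (b : ℤ) [Y.IsStrictlyLE b]
    (h : ∀ (q : ℤ) (i : ℕ), q + j = i → ExtVan (Y.X q) N i) : HomVan Y N j := by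
  -- The induction is on a bound for the number of degrees q ≤ b with q + j ≥ 0, the only ones that
  -- can contribute.
  obtain ⟨k, hk⟩ : ∃ k : ℕ, b + j < k := ⟨(b + j).toNat + 1, by omega⟩
  induction k generalizing b Y with
  | zero => exact of_isLE b (by omega)
  | succ k ih =>
    by_cases hbj : b + j < 0
    · exact of_isLE b hbj
    obtain ⟨i, hi⟩ : ∃ i : ℕ, b + j = i := ⟨(b + j).toNat, by omega⟩
    -- The differential out of the top degree is zero, so the top term is a subcomplex. The quotient
    -- has the same terms in lower degrees and vanishes from degree b on.
    let φ : (HomologicalComplex.single C (.up ℤ) b).obj (Y.X b) ⟶ Y :=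
      HomologicalComplex.mkHomFromSingle (𝟙 _) fun q hq =>
        (Y.isZero_of_isStrictlyLE b q (by simp at hq; omega)).eq_of_tgt _ _
    have hφb : IsIso (φ.f b) := by
      simp only [φ, HomologicalComplex.mkHomFromSingle_f]
      infer_instance
    have hφ : Mono φ := HomologicalComplex.mono_of_mono_f _ fun q => by
      by_cases hq : q = b
      · subst hq
        infer_instance
      · exact ⟨fun _ _ _ => (HomologicalComplex.isZero_single_obj_X _ _ _ _ hq).eq_of_tgt _ _⟩
    have hT := cokernelSequence_shortExact φ
    have hTq (q : ℤ) := hT.map_of_exact (HomologicalComplex.eval C (.up ℤ) q)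
    have hzero (q : ℤ) (hq : b - 1 < q) : IsZero ((cokernel φ).X q) := by
      have : Epi ((cokernel.π φ).f q) := (hTq q).epi_g
      by_cases hqb : q = b
      · subst hqb
        have := (hTq q).exact.epi_f_iff.1 (inferInstanceAs (Epi (φ.f q)))
        exact IsZero.of_epi_eq_zero ((cokernel.π φ).f q) this
      · exact IsZero.of_epi ((cokernel.π φ).f q) (Y.isZero_of_isStrictlyLE b q (by omega))
    have : CochainComplex.IsStrictlyLE (cokernelSequence φ).X₃ (b - 1) :=
      (CochainComplex.isStrictlyLE_iff _ _).2 hzero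
    refine mid hT (single b hi (h b i hi)) (ih (b - 1) (fun q i hq => ?_) (by push_cast at hk; omega))
    by_cases hqb : q = b
    · exact .of_isZero (hzero q (by omega))
    · have hz : IsZero (((HomologicalComplex.single C (.up ℤ) b).obj (Y.X b)).X q) :=
        HomologicalComplex.isZero_single_obj_X _ _ _ _ hqb
      have h₁ : Epi ((cokernel.π φ).f q) := (hTq q).epi_g
      have h₂ : Mono ((cokernel.π φ).f q) := (hTq q).exact.mono_g (hz.eq_of_src _ _)
      have h₃ : IsIso ((cokernel.π φ).f q) := @isIso_of_mono_of_epi _ _ _ _ _ _ h₂ h₁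
      exact .of_iso (@asIso _ _ _ _ ((cokernel.π φ).f q) h₃) (h q i hq)

end

end HomVan

/-- This identifies the connecting map that defines the class of an extension with the one of the
short exact sequence of complexes in degree 0, to which naturality in short exact sequences of
complexes applies. -/
lemma singleδ_eq {T : ShortComplex C} (hT : T.ShortExact) : hT.singleδ =
    triangleOfSESδ (hT.map_of_exact (HomologicalComplex.single C (.up ℤ) 0)) := by
  have h₁ : ((SingleFunctors.evaluation _ _ 0).mapIso
      (singleFunctorsPostcompQIso C)).hom = 𝟙 (singleFunctor C 0) :=
    singleFunctorsPostcompQIso_hom_hom C 0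
  have h₂ : ((SingleFunctors.evaluation _ _ 0).mapIso
      (singleFunctorsPostcompQIso C)).inv = 𝟙 (singleFunctor C 0) :=
    singleFunctorsPostcompQIso_inv_hom C 0
  unfold ShortComplex.ShortExact.singleδ
  rw [h₁, h₂]
  refine (Category.id_comp _).trans ?_
  exact (congrArg (_ ≫ ·) ((shiftFunctor _ (1 : ℤ)).map_id _)).trans (Category.comp_id _)

/-- The connecting maps of T and of R(T) are compatible with ι, so a factorization of α over X₁
becomes one of its image under the connecting map over X₃. -/
lemma exists_factorization_succ [HasExt.{w} C] {R : C ⥤ CochainComplex C ℤ}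
    [R.PreservesZeroMorphisms] (ι : HomologicalComplex.single C (.up ℤ) 0 ⟶ R) {N : C}
    {T : ShortComplex C} (hT : T.ShortExact) (hR : (T.map R).ShortExact) {j j' : ℕ}
    (h : 1 + j = j') (α : Ext T.X₁ N j)
    (β : Q.obj (R.obj T.X₁) ⟶ ((singleFunctor C 0).obj N)⟦(j : ℤ)⟧)
    (hβ : Q.map (ι.app T.X₁) ≫ β = α.hom) :
    ∃ β' : Q.obj (R.obj T.X₃) ⟶ ((singleFunctor C 0).obj N)⟦(j' : ℤ)⟧,
      Q.map (ι.app T.X₃) ≫ β' = (hT.extClass.comp α h).hom := by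
  let δ : Q.obj (R.obj T.X₃) ⟶ (Q.obj (R.obj T.X₁))⟦(1 : ℤ)⟧ := triangleOfSESδ hR
  let δ₀ : Q.obj ((HomologicalComplex.single C (.up ℤ) 0).obj T.X₃) ⟶
    (Q.obj ((HomologicalComplex.single C (.up ℤ) 0).obj T.X₁))⟦(1 : ℤ)⟧ :=
    triangleOfSESδ (hT.map_of_exact (HomologicalComplex.single C (.up ℤ) 0))
  have nat : δ₀ ≫ (Q.map (ι.app T.X₁))⟦(1 : ℤ)⟧' = Q.map (ι.app T.X₃) ≫ δ :=
    triangleOfSESδ_naturality (hT.map_of_exact (HomologicalComplex.single C (.up ℤ) 0)) hR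
      (T.mapNatTrans ι)
  refine ⟨δ ≫ β⟦(1 : ℤ)⟧' ≫
    (shiftFunctorAdd' (DerivedCategory C) (j : ℤ) 1 (j' : ℤ) (by omega)).inv.app _, ?_⟩
  refine (Category.assoc _ _ _).symm.trans ((congrArg (· ≫ _) nat.symm).trans ?_)
  refine (Category.assoc _ _ _).trans ?_
  refine .trans ?_ (Ext.comp_hom _ _ _).symm
  rw [hT.extClass_hom, singleδ_eq, ← hβ]
  refine congrArg (δ₀ ≫ ·) ?_
  exact (Category.assoc _ _ _).symm.trans (congrArg (· ≫ _) (Functor.map_comp _ _ _).symm)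

/-- Let `R` be an exact functor from `C` to complexes and `i_A : A ⟶ R(A)` a natural morphism.
If `i_N` is a split monomorphism, then every class in `Ext^j(A, N)` factors through `i_A`. -/
lemma exists_factorization [EnoughProjectives C] [HasExt.{w} C] (R : C ⥤ CochainComplex C ℤ)
    [R.PreservesZeroMorphisms] (hR : ∀ T : ShortComplex C, T.ShortExact → (T.map R).ShortExact)
    (ι : HomologicalComplex.single C (.up ℤ) 0 ⟶ R) (N : C)
    (ρ : R.obj N ⟶ (HomologicalComplex.single C (.up ℤ) 0).obj N) (hρ : ι.app N ≫ ρ = 𝟙 _)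
    {A : C} {j : ℕ} (α : Ext A N j) :
    ∃ β : Q.obj (R.obj A) ⟶ ((singleFunctor C 0).obj N)⟦(j : ℤ)⟧,
      Q.map (ι.app A) ≫ β = α.hom := by
  induction j generalizing A with
  | zero =>
    obtain ⟨f, rfl⟩ := Ext.mk₀_bijective A N |>.2 α
    -- In degree 0 the factorization is A ⟶ R(A) ⟶ R(N) ⟶ N, by naturality of ι and the retraction
    -- ρ.
    refine ⟨Q.map (R.map f ≫ ρ) ≫ (shiftFunctorZero' (DerivedCategory C)
      (((0 : ℕ) : ℤ)) Nat.cast_zero).inv.app ((singleFunctor C 0).obj N), ?_⟩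
    refine .trans ?_ (Ext.mk₀_hom f).symm
    refine (Category.assoc _ _ _).symm.trans (congrArg (· ≫ (shiftFunctorZero' (DerivedCategory C)
      (((0 : ℕ) : ℤ)) Nat.cast_zero).inv.app ((singleFunctor C 0).obj N)) ?_)
    refine (Q.map_comp _ _).symm.trans (congrArg Q.map ?_)
    rw [← Category.assoc, ← ι.naturality f, Category.assoc, hρ, Category.comp_id]
    rfl
  | succ j ih =>
    have hT := kernelSequence_shortExact (Projective.π A)
    have : Projective (kernelSequence (Projective.π A)).X₂ := Projective.projective_over A
    -- A class of positive degree vanishes on the projective cover, hence comes from the syzygy one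
    -- degree lower.
    obtain ⟨α, rfl⟩ := Ext.contravariant_sequence_exact₃ hT N α
      (ExtVan.projective (kernelSequence (Projective.π A)).X₂ _) (add_comm 1 j)
    obtain ⟨β, hβ⟩ := ih α
    exact exists_factorization_succ ι hT (hR _ hT) _ α β hβ

/-- With `R` as in `exists_factorization`, `Ext^j(A, N) = 0` if `Hom(R(A), N[j]) = 0`. -/
lemma ExtVan.of_homVan [EnoughProjectives C] [HasExt.{w} C] (R : C ⥤ CochainComplex C ℤ)
    [R.PreservesZeroMorphisms] (hR : ∀ T : ShortComplex C, T.ShortExact → (T.map R).ShortExact)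
    (ι : HomologicalComplex.single C (.up ℤ) 0 ⟶ R) (N : C)
    (ρ : R.obj N ⟶ (HomologicalComplex.single C (.up ℤ) 0).obj N) (hρ : ι.app N ≫ ρ = 𝟙 _)
    {A : C} {j : ℕ} (h : HomVan (R.obj A) N j) : ExtVan A N j := fun α => by
  obtain ⟨β, hβ⟩ := exists_factorization R hR ι N ρ hρ α
  apply Ext.ext
  exact hβ.symm.trans (((congrArg (_ ≫ ·) (h β)).trans comp_zero).trans (Ext.zero_hom _ _ _).symm)

end DerivedVanishing

namespace BraidedStabilityGroupoid

open StabilityGroupoid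

variable {S : BraidedStabilityGroupoid.{u}}

/-- An additive map as a linear map over `ℤ`. -/
def intLinear {V W : Type*} [AddCommGroup V] [AddCommGroup W] [Module ℤ V] [Module ℤ W]
    (f : V → W) (h : ∀ a b, f (a + b) = f a + f b) : V →ₗ[ℤ] W where
  toFun := f
  map_add' := h
  map_smul' c x := by
    simpa using map_intCast_smul (AddMonoidHom.mk' f h) ℤ ℤ c x

/-! ### Pointwise criteria -/

lemma umod_mono_iff {A B : S.UMod} (φ : A ⟶ B) :
    Mono φ ↔ ∀ n, Function.Injective (φ.app ⟨n⟩).hom := by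
  rw [NatTrans.mono_iff_mono_app]
  exact ⟨fun h n => (ModuleCat.mono_iff_injective _).1 (h ⟨n⟩),
    fun h n => (ModuleCat.mono_iff_injective _).2 (h n.rank)⟩

lemma umod_epi_iff {A B : S.UMod} (φ : A ⟶ B) :
    Epi φ ↔ ∀ n, Function.Surjective (φ.app ⟨n⟩).hom := by
  rw [NatTrans.epi_iff_epi_app]
  exact ⟨fun h n => (ModuleCat.epi_iff_surjective _).1 (h ⟨n⟩),
    fun h n => (ModuleCat.epi_iff_surjective _).2 (h n.rank)⟩

/-- Evaluation at a rank is exact, so it commutes with homology, and a module is zero if and only if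
all its values are. -/
lemma umod_exact_iff (T : ShortComplex S.UMod) :
    T.Exact ↔ ∀ n, Function.Exact (T.f.app ⟨n⟩).hom (T.g.app ⟨n⟩).hom := by
  have h (X : UCat S.toStabilityGroupoid) :
      (T.map ((evaluation _ _).obj X)).Exact ↔ IsZero (T.homology.obj X) := by
    rw [ShortComplex.exact_iff_isZero_homology]
    exact (T.mapHomologyIso ((evaluation _ (ModuleCat.{u} ℤ)).obj X)).isZero_iff
  rw [ShortComplex.exact_iff_isZero_homology]
  refine ⟨fun hT n => (ShortComplex.ShortExact.moduleCat_exact_iff_function_exact _).1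
    ((h ⟨n⟩).2 (hT.obj _)), fun hT => Functor.isZero _ fun X => (h X).1 ?_⟩
  exact (ShortComplex.ShortExact.moduleCat_exact_iff_function_exact _).2 (hT X.rank)

lemma umod_shortExact_iff (T : ShortComplex S.UMod) :
    T.ShortExact ↔ ∀ n, Function.Injective (T.f.app ⟨n⟩).hom ∧
      Function.Exact (T.f.app ⟨n⟩).hom (T.g.app ⟨n⟩).hom ∧
      Function.Surjective (T.g.app ⟨n⟩).hom := by
  constructor
  · intro h n
    exact ⟨(umod_mono_iff _).1 h.mono_f n, (umod_exact_iff T).1 h.exact n,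
      (umod_epi_iff _).1 h.epi_g n⟩
  · intro h
    have h₁ := (umod_mono_iff T.f).2 fun n => (h n).1
    have h₂ := (umod_epi_iff T.g).2 fun n => (h n).2.2
    exact { exact := (umod_exact_iff T).2 fun n => (h n).2.1 }

lemma isZero_obj_iff {A : S.UMod} {n : ℕ} : IsZero (A.obj ⟨n⟩) ↔ ∀ a : A.obj ⟨n⟩, a = 0 := by
  rw [ModuleCat.isZero_iff_subsingleton]
  exact ⟨fun h a => Subsingleton.elim _ _, fun h => ⟨fun a b => (h a).trans (h b).symm⟩⟩

/-! ### Free modules -/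

/-- The free module on generators `j ∈ J` in ranks `s j`. -/
noncomputable def free {J : Type u} (s : J → ℕ) : S.UMod where
  obj X := ModuleCat.of ℤ ((Σ j, S.UHom (s j) X.rank) →₀ ℤ)
  map f := ModuleCat.ofHom (Finsupp.lmapDomain ℤ ℤ fun x => ⟨x.1, UHom.comp f x.2⟩)
  map_id X := ModuleCat.hom_ext (Finsupp.lhom_ext' fun x => LinearMap.ext_ring (by
    refine Finsupp.mapDomain_single.trans ?_
    exact congrArg (fun y => Finsupp.single (⟨x.1, y⟩ : Σ j, S.UHom (s j) X.rank) (1 : ℤ))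
      (idHom_comp x.2)))
  map_comp f g := ModuleCat.hom_ext (Finsupp.lhom_ext' fun x => LinearMap.ext_ring (by
    refine Finsupp.mapDomain_single.trans ?_
    refine .trans ?_ (congrArg (Finsupp.mapDomain _) Finsupp.mapDomain_single).symm
    refine .trans ?_ Finsupp.mapDomain_single.symm
    exact congrArg (fun y => Finsupp.single (⟨x.1, y⟩ : Σ j, S.UHom (s j) _) (1 : ℤ))
      (comp_assoc g f x.2)))

section

variable {J : Type u} {s : J → ℕ}

/-- The basis element `u` of `free s`. -/
noncomputable def freeMk (s : J → ℕ) (j : J) {n : ℕ} (x : S.UHom (s j) n) :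
    (free (S := S) s).obj ⟨n⟩ :=
  Finsupp.single (⟨j, x⟩ : Σ j, S.UHom (s j) n) (1 : ℤ)

lemma act_freeMk {m n : ℕ} (y : S.UHom m n) (j : J) (x : S.UHom (s j) m) :
    act (free s) y (freeMk s j x) = freeMk s j (UHom.comp y x) :=
  Finsupp.mapDomain_single

lemma free_linear_ext {W : Type*} [AddCommGroup W] [Module ℤ W] {n : ℕ}
    {f g : (free (S := S) s).obj ⟨n⟩ →ₗ[ℤ] W}
    (h : ∀ j (x : S.UHom (s j) n), f (freeMk s j x) = g (freeMk s j x)) : f = g :=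
  Finsupp.lhom_ext' fun x => LinearMap.ext_ring (h x.1 x.2)

/-- Linear extension of a function on the basis. -/
noncomputable def freeLift {W : Type*} [AddCommGroup W] [Module ℤ W] {n : ℕ}
    (φ : ∀ j, S.UHom (s j) n → W) : (free (S := S) s).obj ⟨n⟩ →ₗ[ℤ] W :=
  Finsupp.linearCombination ℤ fun x : Σ j, S.UHom (s j) n => φ x.1 x.2

lemma freeLift_mk {W : Type*} [AddCommGroup W] [Module ℤ W] {n : ℕ}
    (φ : ∀ j, S.UHom (s j) n → W) (j : J) (x : S.UHom (s j) n) :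
    freeLift φ (freeMk s j x) = φ j x :=
  linearCombination_single_one (R := ℤ) (fun x : Σ j, S.UHom (s j) n => φ x.1 x.2) ⟨j, x⟩

/-- The morphism from a free module given by the images of the generators. -/
noncomputable def freeDesc {M : S.UMod} (x : ∀ j, M.obj ⟨s j⟩) : free s ⟶ M :=
  umodHom (fun _ => freeLift fun j y => act M y (x j)) (by
    intro m n y a
    have : (freeLift fun j y => act M y (x j)) ∘ₗ act (free s) y =
        act M y ∘ₗ (freeLift fun j y => act M y (x j)) := free_linear_ext fun j z => by
      rw [LinearMap.comp_apply, LinearMap.comp_apply, act_freeMk, freeLift_mk, freeLift_mk,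
        act_comp]
    exact LinearMap.congr_fun this a)

lemma freeDesc_mk {M : S.UMod} (x : ∀ j, M.obj ⟨s j⟩) {n : ℕ} (j : J) (y : S.UHom (s j) n) :
    ((freeDesc x).app ⟨n⟩).hom (freeMk s j y) = act M y (x j) :=
  freeLift_mk (fun j y => act M y (x j)) j y

lemma freeDesc_gen {M : S.UMod} (x : ∀ j, M.obj ⟨s j⟩) (j : J) :
    ((freeDesc x).app ⟨s j⟩).hom (freeMk s j (S.idHom (s j))) = x j := by
  rw [freeDesc_mk, act_idHom]

lemma free_hom_ext {M : S.UMod} {φ ψ : free s ⟶ M}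
    (h : ∀ j, (φ.app ⟨s j⟩).hom (freeMk s j (S.idHom (s j))) =
      (ψ.app ⟨s j⟩).hom (freeMk s j (S.idHom (s j)))) : φ = ψ := by
  ext ⟨n⟩ : 2
  refine ModuleCat.hom_ext (free_linear_ext fun j y => ?_)
  rw [← comp_idHom y, ← act_freeMk]
  exact (app_act φ y _).trans ((congrArg _ (h j)).trans (app_act ψ y _).symm)

instance : Projective (free (S := S) s) where
  factors {A B} f e he := by
    choose x hx using fun j => (umod_epi_iff e).1 he (s j)
      ((f.app ⟨s j⟩).hom (freeMk s j (S.idHom (s j))))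
    refine ⟨freeDesc x, free_hom_ext fun j => ?_⟩
    refine .trans ?_ (hx j)
    exact congrArg (e.app ⟨s j⟩).hom (freeDesc_gen x j)

lemma free_eq_zero {n : ℕ} (h : ∀ j, n < s j) (a : (free (S := S) s).obj ⟨n⟩) : a = 0 := by
  refine LinearMap.congr_fun (f := LinearMap.id) (g := 0) (free_linear_ext fun j x => ?_) a
  exact absurd x.le (h j).not_ge

/-- The free module on one generator of rank `s`. -/
noncomputable abbrev free₁ (S : BraidedStabilityGroupoid.{u}) (s : ℕ) : S.UMod :=
  free fun _ : PUnit.{u + 1} => s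

end

/-! ### Complements -/

lemma exists_rep_sub {s n : ℕ} (f : S.UHom s n) :
    ∃ g : S.G n, f = UHom.mk (n - s) (Nat.sub_add_cancel f.le) g := by
  obtain ⟨c, h, g, rfl⟩ := f.exists_rep
  obtain rfl : c = n - s := by omega
  exact ⟨g, rfl⟩

/-- An isomorphism `(n - s) ⊕ s → n` extending `f : s → n`. -/
noncomputable def hat {s n : ℕ} (f : S.UHom s n) : S.UHom (n - s + s) n :=
  UHom.mk 0 ((Nat.zero_add _).trans (Nat.sub_add_cancel f.le)) (exists_rep_sub f).choose

/-- The inverse of `hat f`. -/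
noncomputable def hatInv {s n : ℕ} (f : S.UHom s n) : S.UHom n (n - s + s) :=
  UHom.mk 0 ((Nat.zero_add _).trans (Nat.sub_add_cancel f.le).symm)
    (cast (congrArg S.G (Nat.sub_add_cancel f.le).symm) (exists_rep_sub f).choose⁻¹)

lemma mk_zero_comp_cast {k n : ℕ} (h : k = n) (g : S.G n) :
    UHom.comp (UHom.mk 0 ((Nat.zero_add _).trans h) g : S.UHom k n)
      (UHom.mk 0 ((Nat.zero_add _).trans h.symm) (cast (congrArg S.G h.symm) g⁻¹)) = S.idHom n ∧
    UHom.comp (UHom.mk 0 ((Nat.zero_add _).trans h.symm) (cast (congrArg S.G h.symm) g⁻¹))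
      (UHom.mk 0 ((Nat.zero_add _).trans h) g : S.UHom k n) = S.idHom k := by
  subst h
  exact ⟨by rw [UHom.aut_comp_mk]; simp, by rw [UHom.aut_comp_mk]; simp⟩

lemma hat_hatInv {s n : ℕ} (f : S.UHom s n) : UHom.comp (hat f) (hatInv f) = S.idHom n :=
  (mk_zero_comp_cast (Nat.sub_add_cancel f.le) _).1

lemma hatInv_hat {s n : ℕ} (f : S.UHom s n) :
    UHom.comp (hatInv f) (hat f) = S.idHom (n - s + s) :=
  (mk_zero_comp_cast (Nat.sub_add_cancel f.le) _).2

lemma hat_comp {s n : ℕ} (f : S.UHom s n) : UHom.comp (hat f) (UHom.mk (n - s) rfl 1) = f := by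
  conv_rhs => rw [(exists_rep_sub f).choose_spec]
  rw [hat, UHom.comp_mk, blk_one_one, mul_one]
  exact UHom.mk_eq (c' := n - s) _ (Nat.sub_add_cancel f.le) _ _ 1 (by rw [blk_one_one, mul_one])

lemma existsUnique_hat {m s n : ℕ} {f : S.UHom s n} {w : S.UHom (m + s) n}
    (hw : UHom.comp w (UHom.mk m rfl 1) = f) :
    ∃! γ : S.UHom m (n - s), w = UHom.comp (hat f) (S.rshMap s γ) :=
  S.existsUnique_factor (Nat.sub_add_cancel f.le) _ w (hw.trans (exists_rep_sub f).choose_spec)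

/-! ### Tensor products with free modules -/

/-- The functor `A ↦ Σ^s A`. -/
@[simps! obj]
noncomputable def shiftF (S : BraidedStabilityGroupoid.{u}) (s : ℕ) : S.UMod ⥤ S.UMod :=
  (Functor.whiskeringLeft _ _ _).obj (S.rsh s)

/-- The components of a morphism `A ⟶ Σ^s B`. -/
noncomputable def shiftApp {A B : S.UMod} {s : ℕ} (θ : A ⟶ (S.shiftF s).obj B) (p : ℕ) :
    A.obj ⟨p⟩ →ₗ[ℤ] B.obj ⟨p + s⟩ := (θ.app ⟨p⟩).hom

lemma shiftApp_act {A B : S.UMod} {s : ℕ} (θ : A ⟶ (S.shiftF s).obj B) {m n : ℕ}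
    (x : S.UHom m n) (a : A.obj ⟨m⟩) :
    shiftApp θ n (act A x a) = act B (S.rshMap s x) (shiftApp θ m a) := app_act θ x a

/-- A morphism `A ⟶ Σ^s B` from its components. -/
noncomputable def shiftHomMk {A B : S.UMod} {s : ℕ} (f : ∀ p, A.obj ⟨p⟩ →ₗ[ℤ] B.obj ⟨p + s⟩)
    (h : ∀ {m n} (x : S.UHom m n) a, f n (act A x a) = act B (S.rshMap s x) (f m a)) :
    A ⟶ (S.shiftF s).obj B :=
  umodHom (B := (S.shiftF s).obj B) f h

lemma shift_hom_ext {A B : S.UMod} {s : ℕ} {θ θ' : A ⟶ (S.shiftF s).obj B}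
    (h : ∀ p a, shiftApp θ p a = shiftApp θ' p a) : θ = θ' := umod_hom_ext h

section

variable {J : Type u} {s : J → ℕ} {A B : S.UMod}

/-- The pairing defining morphisms out of `A ⊛ free s`. -/
noncomputable def dayFreePairing (θ : ∀ j, A ⟶ (S.shiftF (s j)).obj B) :
    DayPairing A (free s) B where
  φ p q a b := freeLift (fun j y => act B (S.lshMap p y) (shiftApp (θ j) p a)) b
  add_left {p q} a a' b := by
    refine LinearMap.congr_fun (f := freeLift _) (g := freeLift
      (fun j y => act B (S.lshMap p y) (shiftApp (θ j) p a)) + freeLift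
      (fun j y => act B (S.lshMap p y) (shiftApp (θ j) p a')))
      (free_linear_ext fun j x => ?_) b
    rw [LinearMap.add_apply, freeLift_mk, freeLift_mk, freeLift_mk, map_add, map_add]
  add_right _ _ _ := map_add _ _ _
  act_left {p p' q} x a b := by
    refine LinearMap.congr_fun (f := freeLift _) (g := act B (S.rshMap q x) ∘ₗ freeLift
      (fun j y => act B (S.lshMap p' y) (shiftApp (θ j) p' a)))
      (free_linear_ext fun j y => ?_) b
    rw [LinearMap.comp_apply, freeLift_mk, freeLift_mk, shiftApp_act, ← act_comp, ← act_comp,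
      S.interchange]
  act_right {p q q'} y a b := by
    refine LinearMap.congr_fun (f := freeLift
      (fun j y => act B (S.lshMap p y) (shiftApp (θ j) p a)) ∘ₗ act _ y)
      (g := act B (S.lshMap p y) ∘ₗ freeLift
      (fun j y => act B (S.lshMap p y) (shiftApp (θ j) p a)))
      (free_linear_ext fun j z => ?_) b
    rw [LinearMap.comp_apply, LinearMap.comp_apply, act_freeMk, freeLift_mk, freeLift_mk,
      ← act_comp, S.lshMap_comp]

/-- The morphism `A ⊛ free s ⟶ B` given by morphisms `A ⟶ Σ^{s_j} B`. -/
noncomputable def dayFreeDesc (θ : ∀ j, A ⟶ (S.shiftF (s j)).obj B) : day A (free s) ⟶ B :=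
  dayDesc (dayFreePairing θ)

lemma dayFreeDesc_mk (θ : ∀ j, A ⟶ (S.shiftF (s j)).obj B) {n p q : ℕ} (a : A.obj ⟨p⟩) (j : J)
    (y : S.UHom (s j) q) (w : S.UHom (p + q) n) :
    ((dayFreeDesc θ).app ⟨n⟩).hom (dayMk a (freeMk s j y) w : DayObj A (free s) n) =
      act B (UHom.comp w (S.lshMap p y)) (shiftApp (θ j) p a) := by
  refine (dayDesc_mk _ _ _ _).trans ?_
  rw [act_comp]
  exact congrArg _ (freeLift_mk _ _ _)

/-- The class of `a ⊗ id_{s_j}` in `(A ⊛ free s)_{p + s_j}`. -/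
noncomputable abbrev dayGen (s : J → ℕ) {p n : ℕ} (a : A.obj ⟨p⟩) (j : J)
    (w : S.UHom (p + s j) n) : DayObj A (free s) n :=
  dayMk a (freeMk s j (S.idHom (s j))) w

lemma dayFreeDesc_gen (θ : ∀ j, A ⟶ (S.shiftF (s j)).obj B) {p n : ℕ} (a : A.obj ⟨p⟩) (j : J)
    (w : S.UHom (p + s j) n) :
    ((dayFreeDesc θ).app ⟨n⟩).hom (dayGen s a j w) = act B w (shiftApp (θ j) p a) := by
  rw [dayFreeDesc_mk, lshMap_idHom, comp_idHom]

lemma dayMk_freeMk {n p q : ℕ} (a : A.obj ⟨p⟩) (j : J) (y : S.UHom (s j) q)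
    (w : S.UHom (p + q) n) : (dayMk a (freeMk s j y) w : DayObj A (free s) n) =
      dayGen s a j (UHom.comp w (S.lshMap p y)) := by
  rw [dayGen, ← dayMk_act_right, act_freeMk, comp_idHom]

lemma day_free_linear_ext {W : Type*} [AddCommGroup W] [Module ℤ W] {n : ℕ}
    {f g : DayObj A (free s) n →ₗ[ℤ] W}
    (h : ∀ {p : ℕ} (a : A.obj ⟨p⟩) (j : J) (w : S.UHom (p + s j) n),
      f (dayGen s a j w) = g (dayGen s a j w)) :
    f = g := by
  refine dayHom_ext fun {p q} a b w => ?_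
  let δ : (free (S := S) s).obj ⟨q⟩ →ₗ[ℤ] DayObj A (free s) n :=
    intLinear (fun b => dayMk a b w) fun b b' => dayMk_add_right a b b' w
  refine LinearMap.congr_fun (f := f ∘ₗ δ) (g := g ∘ₗ δ) (free_linear_ext fun j y => ?_) b
  exact ((congrArg f (dayMk_freeMk a j y w)).trans (h a j _)).trans
    (congrArg g (dayMk_freeMk a j y w)).symm

lemma dayFree_hom_ext {φ ψ : day A (free s) ⟶ B}
    (h : ∀ {p : ℕ} (a : A.obj ⟨p⟩) (j : J),
      (φ.app ⟨p + s j⟩).hom (dayGen s a j (S.idHom (p + s j))) =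
        (ψ.app ⟨p + s j⟩).hom (dayGen s a j (S.idHom (p + s j)))) : φ = ψ := by
  ext ⟨n⟩ : 2
  refine ModuleCat.hom_ext (day_free_linear_ext fun a j w => ?_)
  rw [← comp_idHom w, dayGen, ← act_dayMk]
  exact (app_act φ w _).trans ((congrArg _ (h a j)).trans (app_act ψ w _).symm)

/-- The universal morphism `A ⟶ Σ^{s_j} (A ⊛ free s)`. -/
noncomputable def dayFreeUnit (A : S.UMod) (s : J → ℕ) (j : J) :
    A ⟶ (S.shiftF (s j)).obj (day A (free s)) :=
  shiftHomMk (B := day A (free s)) (fun p => intLinear (W := DayObj A (free s) (p + s j))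
      (fun a => dayGen s a j (S.idHom (p + s j))) fun a a' => dayMk_add_left ..) (by
    intro m n x a
    refine (dayMk_act_left _ _ _ _).trans ?_
    refine .trans ?_ (act_dayMk ..).symm
    rw [comp_idHom, idHom_comp])

end

/-- The functor `- ⊛ free₁ s` is left adjoint to the shift `Σ^s`. -/
noncomputable def dayAdjunction (S : BraidedStabilityGroupoid.{u}) (s : ℕ) :
    dayR (S.free₁ s) ⊣ S.shiftF s :=
  Adjunction.mkOfHomEquiv
    { homEquiv := fun A B =>
        { toFun := fun φ => dayFreeUnit A _ PUnit.unit ≫ (S.shiftF s).map φ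
          invFun := fun θ => dayFreeDesc fun _ => θ
          left_inv := fun φ => dayFree_hom_ext fun a _ =>
            (dayFreeDesc_gen _ _ _ _).trans (act_idHom _ _)
          right_inv := fun θ => shift_hom_ext fun p a =>
            (dayFreeDesc_gen (fun _ : PUnit => θ) a PUnit.unit (S.idHom (p + s))).trans
              (act_idHom _ _) }
      homEquiv_naturality_left_symm := fun {A' A B} f g => dayFree_hom_ext fun a j =>
        (dayFreeDesc_gen _ _ _ _).trans (.symm ((congrArg _ (dayMap_mk ..)).trans
          (dayFreeDesc_gen (fun _ : PUnit => g) _ PUnit.unit _)))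
      homEquiv_naturality_right := fun _ _ => shift_hom_ext fun _ _ => rfl }

/-! ### Exactness of `- ⊛ free₁ s` -/

/-- The restriction of `w : m ⊕ s → n` to `s`. -/
def sec {m s n : ℕ} (w : S.UHom (m + s) n) : S.UHom s n := UHom.comp w (UHom.mk m rfl 1)

/-- The restriction of `w : m ⊕ s → n` to `m`, as a morphism to the complement of `s`. -/
noncomputable def compl {m s n : ℕ} (w : S.UHom (m + s) n) : S.UHom m (n - s) :=
  (existsUnique_hat (f := sec w) (w := w) rfl).choose

lemma hat_compl {m s n : ℕ} (w : S.UHom (m + s) n) :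
    UHom.comp (hat (sec w)) (S.rshMap s (compl w)) = w :=
  (existsUnique_hat (f := sec w) (w := w) rfl).choose_spec.1.symm

lemma sec_comp_rshMap {m m' s n : ℕ} (w : S.UHom (m + s) n) (x : S.UHom m' m) :
    sec (UHom.comp w (S.rshMap s x)) = sec w := by
  rw [sec, comp_assoc, S.rshMap_comp_insLeft, sec]

lemma sec_hat {s n : ℕ} (f : S.UHom s n) : sec (hat f) = f := hat_comp f

lemma compl_eq {m s n : ℕ} {w : S.UHom (m + s) n} {γ : S.UHom m (n - s)}
    (h : w = UHom.comp (hat (sec w)) (S.rshMap s γ)) : compl w = γ :=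
  (existsUnique_hat (f := sec w) (w := w) rfl).unique (hat_compl w).symm h

lemma compl_comp_rshMap {m m' s n : ℕ} (w : S.UHom (m + s) n) (x : S.UHom m' m) :
    compl (UHom.comp w (S.rshMap s x)) = UHom.comp (compl w) x := by
  apply compl_eq
  rw [sec_comp_rshMap, rshMap_comp, ← comp_assoc, hat_compl]

section

variable {s n : ℕ} {A A' : S.UMod}

/-- The decomposition of `(A ⊛ free₁ s)_n` as a sum of copies of `A_{n - s}`. -/
noncomputable def dayCoord (A : S.UMod) (s n : ℕ) :
    DayObj A (S.free₁ s) n →ₗ[ℤ] (S.UHom s n →₀ A.obj ⟨n - s⟩) :=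
  dayLift (fun p q w a b => freeLift (fun _ y => Finsupp.single (sec (UHom.comp w (S.lshMap p y)))
      (act A (compl (UHom.comp w (S.lshMap p y))) a)) b)
    (fun {p q} w a a' b => by
      refine LinearMap.congr_fun (f := freeLift _) (g := freeLift
        (fun _ y => Finsupp.single (sec (UHom.comp w (S.lshMap p y)))
          (act A (compl (UHom.comp w (S.lshMap p y))) a)) + freeLift
        (fun _ y => Finsupp.single (sec (UHom.comp w (S.lshMap p y)))
          (act A (compl (UHom.comp w (S.lshMap p y))) a')))
        (free_linear_ext fun j x => ?_) b
      rw [LinearMap.add_apply, freeLift_mk, freeLift_mk, freeLift_mk, map_add, Finsupp.single_add])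
    (fun w a b b' => map_add _ _ _)
    (fun {p p' q} x a b w => by
      refine LinearMap.congr_fun (f := freeLift _) (g := freeLift _)
        (free_linear_ext fun j y => ?_) b
      rw [freeLift_mk, freeLift_mk, comp_assoc w, S.interchange, ← comp_assoc, sec_comp_rshMap,
        compl_comp_rshMap, act_comp])
    (fun {p q q'} y a b w => by
      refine LinearMap.congr_fun (f := freeLift (fun _ y => Finsupp.single
          (sec (UHom.comp w (S.lshMap p y))) (act A (compl (UHom.comp w (S.lshMap p y))) a)) ∘ₗ
          act _ y) (g := freeLift _)
        (free_linear_ext fun j z => ?_) b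
      rw [LinearMap.comp_apply, act_freeMk, freeLift_mk, freeLift_mk, S.lshMap_comp, comp_assoc])

lemma dayCoord_gen {p : ℕ} (a : A.obj ⟨p⟩) (j : PUnit) (w : S.UHom (p + s) n) :
    dayCoord A s n (dayGen (fun _ => s) a j w) = Finsupp.single (sec w) (act A (compl w) a) := by
  refine (dayLift_mk _ _ _ _ _ _ _ _).trans ?_
  rw [freeLift_mk, lshMap_idHom, comp_idHom]

/-- In these coordinates α ⊛ id acts on every summand by α in rank n - s, which makes exactness
visible. -/
lemma dayCoord_dayMap (α : A ⟶ A') (x : DayObj A (S.free₁ s) n) :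
    dayCoord A' s n (((dayMap α (𝟙 (S.free₁ s))).app ⟨n⟩).hom x) =
      Finsupp.mapRange (α.app ⟨n - s⟩).hom (map_zero _) (dayCoord A s n x) := by
  refine LinearMap.congr_fun (f := dayCoord A' s n ∘ₗ
    ((dayMap α (𝟙 (S.free₁ s))).app ⟨n⟩).hom)
    (g := intLinear (Finsupp.mapRange (α.app ⟨n - s⟩).hom (map_zero _))
      (Finsupp.mapRange_add (map_add _)) ∘ₗ dayCoord A s n)
    (day_free_linear_ext fun a j w => ?_) x
  refine ((congrArg _ (dayMap_mk ..)).trans (dayCoord_gen _ j w)).trans ?_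
  rw [← app_act]
  refine .trans ?_ (congrArg (Finsupp.mapRange (α.app ⟨n - s⟩).hom (map_zero _))
    (dayCoord_gen a j w)).symm
  exact (Finsupp.mapRange_single (hf := map_zero _)).symm

/-- A left inverse sends a in the summand of f to a ⊗ id_s ⊗ w, where w is the chosen isomorphism (n
- s) ⊕ s → n extending f. -/
lemma dayCoord_injective : Function.Injective (dayCoord A s n) := by
  let Φ : (S.UHom s n →₀ A.obj ⟨n - s⟩) →ₗ[ℤ] DayObj A (S.free₁ s) n :=
    intLinear (Finsupp.liftAddHom fun f => AddMonoidHom.mk'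
      (fun a => dayGen (fun _ => s) a PUnit.unit (hat f)) fun a a' => dayMk_add_left ..)
      (map_add _)
  have h : Φ ∘ₗ dayCoord A s n = LinearMap.id := day_free_linear_ext fun a j w => by
    rw [LinearMap.comp_apply, dayCoord_gen, LinearMap.id_apply]
    refine (Finsupp.liftAddHom_apply_single _ _ _).trans ?_
    refine (dayMk_act_left _ _ _ _).trans ?_
    rw [hat_compl]
  exact Function.LeftInverse.injective (g := Φ) fun x => LinearMap.congr_fun h x

end

instance (s : ℕ) : (dayR (S.free₁ s)).IsLeftAdjoint := (dayAdjunction S s).isLeftAdjoint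

/-- A left adjoint that preserves monomorphisms is exact. Exactness is what lets Ext be transported
along the adjunction with Σ^s. -/
instance (s : ℕ) : (dayR (S.free₁ s)).PreservesMonomorphisms where
  preserves {A A'} α hα := by
    rw [umod_mono_iff] at hα ⊢
    intro n x y h
    apply dayCoord_injective
    apply Finsupp.mapRange_injective _ (map_zero _) (hα (n - s))
    exact (dayCoord_dayMap α x).symm.trans ((congrArg _ h).trans (dayCoord_dayMap α y))

instance (s : ℕ) : PreservesFiniteColimits (dayR (S.free₁ s)) :=
  ⟨fun _ _ _ => (dayAdjunction S s).leftAdjoint_preservesColimits.preservesColimitsOfShape⟩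

instance (s : ℕ) : (dayR (S.free₁ s)).PreservesHomology :=
  Functor.preservesHomology_of_preservesMonos_and_cokernels _

instance (s : ℕ) : PreservesFiniteLimits (dayR (S.free₁ s)) :=
  Functor.preservesFiniteLimits_of_preservesHomology _

instance (s : ℕ) : (S.shiftF s).PreservesEpimorphisms where
  preserves {A B} φ hφ := by
    rw [umod_epi_iff] at hφ ⊢
    exact fun n => hφ (n + s)

noncomputable instance (s : ℕ) : PreservesFiniteColimits (S.shiftF s) := by
  unfold shiftF
  infer_instance

noncomputable instance (s : ℕ) : PreservesFiniteLimits (S.shiftF s) := by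
  unfold shiftF
  infer_instance

/-! ### Pointwise tensor products -/

open scoped TensorProduct

lemma tensor_induction {V W : Type*} [AddCommGroup V] [AddCommGroup W] [Module ℤ V] [Module ℤ W]
    {X : Type*} [AddCommGroup X] {f g : V ⊗[ℤ] W → X} (hf : ∀ x y, f (x + y) = f x + f y)
    (hg : ∀ x y, g (x + y) = g x + g y) (h : ∀ a b, f (a ⊗ₜ b) = g (a ⊗ₜ b)) (x : V ⊗[ℤ] W) :
    f x = g x := by
  induction x using TensorProduct.induction_on with
  | zero =>
    have h₁ := h 0 0
    rwa [TensorProduct.zero_tmul] at h₁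
  | tmul a b => exact h a b
  | add x y hx hy => rw [hf, hg, hx, hy]

/-- The pointwise tensor product of `U𝒢`-modules. -/
noncomputable def tens (A M : S.UMod) : S.UMod where
  obj X := ModuleCat.of ℤ (A.obj X ⊗[ℤ] M.obj X)
  map {X Y} f := ModuleCat.ofHom (X := A.obj X ⊗[ℤ] M.obj X) (Y := A.obj Y ⊗[ℤ] M.obj Y)
    (intLinear (TensorProduct.map (A.map f).hom (M.map f).hom) (map_add _))
  map_id X := ModuleCat.hom_ext (LinearMap.ext fun x => tensor_induction (map_add _) (map_add _)
    (fun a b => congrArg₂ (fun a b => a ⊗ₜ[ℤ] b) (congrArg (fun f => f.hom a) (A.map_id X))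
      (congrArg (fun f => f.hom b) (M.map_id X))) x)
  map_comp f g := ModuleCat.hom_ext (LinearMap.ext fun x => tensor_induction (map_add _)
    (map_add _) (fun a b => congrArg₂ (fun a b => a ⊗ₜ[ℤ] b)
      (congrArg (fun f => f.hom a) (A.map_comp f g))
      (congrArg (fun f => f.hom b) (M.map_comp f g))) x)

/-- The element `a ⊗ b`. -/
noncomputable def tmk {A M : S.UMod} {n : ℕ} (a : A.obj ⟨n⟩) (b : M.obj ⟨n⟩) :
    (tens A M).obj ⟨n⟩ := (a ⊗ₜ[ℤ] b : A.obj ⟨n⟩ ⊗[ℤ] M.obj ⟨n⟩)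

section

variable {A A' M M' B : S.UMod} {n : ℕ}

lemma tmk_add_left (a a' : A.obj ⟨n⟩) (b : M.obj ⟨n⟩) :
    tmk (a + a') b = tmk a b + tmk a' b := TensorProduct.add_tmul _ _ _

lemma tmk_add_right (a : A.obj ⟨n⟩) (b b' : M.obj ⟨n⟩) :
    tmk a (b + b') = tmk a b + tmk a b' := TensorProduct.tmul_add _ _ _

lemma act_tmk {m : ℕ} (x : S.UHom m n) (a : A.obj ⟨m⟩) (b : M.obj ⟨m⟩) :
    act (tens A M) x (tmk a b) = tmk (act A x a) (act M x b) := rfl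

lemma tens_linear_ext {W : Type*} [AddCommGroup W] [Module ℤ W]
    {f g : (tens A M).obj ⟨n⟩ →ₗ[ℤ] W} (h : ∀ a b, f (tmk a b) = g (tmk a b)) : f = g :=
  LinearMap.ext fun x => tensor_induction (V := A.obj ⟨n⟩) (W := M.obj ⟨n⟩) (map_add f)
    (map_add g) h x

/-- Linear maps out of `(A ⊗ M)_n`. -/
noncomputable def tensLift {W : Type*} [AddCommGroup W] [Module ℤ W]
    (φ : A.obj ⟨n⟩ → M.obj ⟨n⟩ → W) (hl : ∀ a a' b, φ (a + a') b = φ a b + φ a' b)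
    (hr : ∀ a b b', φ a (b + b') = φ a b + φ a b') : (tens A M).obj ⟨n⟩ →ₗ[ℤ] W :=
  intLinear (V := (tens A M).obj ⟨n⟩) (TensorProduct.liftAddHom (R := ℤ) (M := A.obj ⟨n⟩)
    (N := M.obj ⟨n⟩) (AddMonoidHom.mk' (fun a => AddMonoidHom.mk' (φ a) (hr a))
      fun a a' => AddMonoidHom.ext (hl a a'))
    fun r a b => ((intLinear (fun a => φ a b) fun a a' => hl a a' b).map_smul r a).trans
      ((intLinear (φ a) (hr a)).map_smul r b).symm) (map_add _)

lemma tensLift_mk {W : Type*} [AddCommGroup W] [Module ℤ W]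
    (φ : A.obj ⟨n⟩ → M.obj ⟨n⟩ → W) (hl) (hr) (a : A.obj ⟨n⟩) (b : M.obj ⟨n⟩) :
    tensLift φ hl hr (tmk a b) = φ a b := rfl

lemma tens_hom_ext {φ ψ : tens A M ⟶ B}
    (h : ∀ n (a : A.obj ⟨n⟩) (b : M.obj ⟨n⟩),
      (φ.app ⟨n⟩).hom (tmk a b) = (ψ.app ⟨n⟩).hom (tmk a b)) : φ = ψ := by
  ext ⟨n⟩ : 2
  exact ModuleCat.hom_ext (tens_linear_ext (h n))

/-- Functoriality of the pointwise tensor product, in one rank. -/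
noncomputable def tensMapApp (α : A ⟶ A') (β : M ⟶ M') (n : ℕ) :
    (tens A M).obj ⟨n⟩ →ₗ[ℤ] (tens A' M').obj ⟨n⟩ :=
  tensLift (fun a b => tmk ((α.app ⟨n⟩).hom a) ((β.app ⟨n⟩).hom b))
    (fun a a' b => by rw [map_add, tmk_add_left]) (fun a b b' => by rw [map_add, tmk_add_right])

lemma tensMapApp_mk (α : A ⟶ A') (β : M ⟶ M') (a : A.obj ⟨n⟩) (b : M.obj ⟨n⟩) :
    tensMapApp α β n (tmk a b) = tmk ((α.app ⟨n⟩).hom a) ((β.app ⟨n⟩).hom b) := rfl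

/-- Functoriality of the pointwise tensor product. -/
noncomputable def tensMap (α : A ⟶ A') (β : M ⟶ M') : tens A M ⟶ tens A' M' :=
  umodHom (tensMapApp α β) (by
    intro m n x a
    refine LinearMap.congr_fun (f := tensMapApp α β n ∘ₗ act (tens A M) x)
      (g := act (tens A' M') x ∘ₗ tensMapApp α β m) (tens_linear_ext fun a b => ?_) a
    rw [LinearMap.comp_apply, LinearMap.comp_apply, act_tmk, tensMapApp_mk, tensMapApp_mk, act_tmk,
      app_act, app_act])

lemma tensMap_mk (α : A ⟶ A') (β : M ⟶ M') (a : A.obj ⟨n⟩) (b : M.obj ⟨n⟩) :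
    ((tensMap α β).app ⟨n⟩).hom (tmk a b) =
      tmk ((α.app ⟨n⟩).hom a) ((β.app ⟨n⟩).hom b) := tensMapApp_mk α β a b

lemma tensMap_comp {A'' M'' : S.UMod} (α : A ⟶ A') (α' : A' ⟶ A'') (β : M ⟶ M') (β' : M' ⟶ M'') :
    tensMap (α ≫ α') (β ≫ β') = tensMap α β ≫ tensMap α' β' :=
  tens_hom_ext fun n a b => (tensMap_mk _ _ a b).trans ((congrArg ((tensMap α' β').app ⟨n⟩).hom
    (tensMap_mk α β a b)).trans (tensMap_mk α' β' _ _)).symm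

lemma tensMap_add_right (α : A ⟶ A') (β β' : M ⟶ M') :
    tensMap α (β + β') = tensMap α β + tensMap α β' :=
  tens_hom_ext fun _ a b => (tensMap_mk _ _ a b).trans ((tmk_add_right _ _ _).trans
    (congrArg₂ (· + ·) (tensMap_mk α β a b).symm (tensMap_mk α β' a b).symm))

end

/-- The functor `A ⊗ -`. -/
@[simps! obj map]
noncomputable def tensL (A : S.UMod) : S.UMod ⥤ S.UMod where
  obj M := tens A M
  map β := tensMap (𝟙 A) β
  map_id M := tens_hom_ext fun n a b => tensMap_mk _ _ a b
  map_comp β β' := by rw [← tensMap_comp, Category.comp_id]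

instance (A : S.UMod) : (tensL A).Additive where
  map_add := tensMap_add_right _ _ _

/-- The comparison `A ⊛ M ⟶ A ⊗ M`. -/
noncomputable def dayToTens (A M : S.UMod) : day A M ⟶ tens A M :=
  dayDesc (B := tens A M)
    { φ := fun p q a b => tmk (act A (S.insR p q) a) (act M (UHom.mk p rfl 1) b)
      add_left := fun a a' b => by rw [map_add, tmk_add_left]
      add_right := fun a b b' => by rw [map_add, tmk_add_right]
      act_left := fun x a b => by
        rw [act_tmk, ← act_comp, ← act_comp, ← act_comp, S.rshMap_comp_insR,
          S.rshMap_comp_insLeft]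
      act_right := fun y a b => by
        rw [act_tmk, ← act_comp, ← act_comp, ← act_comp, S.lshMap_comp_insR,
          S.lshMap_comp_insLeft] }

lemma dayToTens_mk {A M : S.UMod} {n p q : ℕ} (a : A.obj ⟨p⟩) (b : M.obj ⟨q⟩)
    (w : S.UHom (p + q) n) :
    ((dayToTens A M).app ⟨n⟩).hom (dayMk a b w : DayObj A M n) =
      tmk (act A w (act A (S.insR p q) a)) (act M w (act M (UHom.mk p rfl 1) b)) :=
  dayDesc_mk _ a b w

lemma dayToTens_naturality {A A' M M' : S.UMod} (α : A ⟶ A') (β : M ⟶ M') :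
    dayMap α β ≫ dayToTens A' M' = dayToTens A M ≫ tensMap α β :=
  day_hom_ext fun a b => by
    refine ((congrArg _ (dayMap_mk ..)).trans (dayToTens_mk ..)).trans ?_
    refine .trans ?_ (congrArg _ (dayToTens_mk ..)).symm
    refine .trans ?_ (tensMap_mk _ _ _ _).symm
    rw [app_act, app_act, app_act, app_act]

end BraidedStabilityGroupoid

/-! ### Kernels and cokernels of coproducts of maps -/

section

universe w v₁ u₁

variable {C : Type u₁} [Category.{v₁} C] [Abelian C]

/-- The sequence `0 ⟶ ker f ⟶ X ⟶ im f ⟶ 0`. -/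
@[simps]
noncomputable def coimageSequence {X Y : C} (f : X ⟶ Y) : ShortComplex C :=
  ShortComplex.mk (kernel.ι f) (Abelian.factorThruImage f) (by
    rw [← cancel_mono (Abelian.image.ι f), Category.assoc, Abelian.image.fac, kernel.condition,
      zero_comp])

lemma coimageSequence_shortExact {X Y : C} (f : X ⟶ Y) : (coimageSequence f).ShortExact where
  exact := by
    have : Mono (coimageSequence f).f := inferInstanceAs (Mono (kernel.ι f))
    refine ShortComplex.exact_of_f_is_kernel _ (KernelFork.IsLimit.ofι' _ _ fun k hk => ?_)
    refine ⟨kernel.lift f k ?_, kernel.lift_ι _ _ _⟩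
    rw [← Abelian.image.fac f]
    exact (Category.assoc _ _ _).symm.trans ((congrArg (· ≫ _) hk).trans zero_comp)
  mono_f := inferInstanceAs (Mono (kernel.ι f))
  epi_g := inferInstanceAs (Epi (Abelian.factorThruImage f))

/-- The sequence `0 ⟶ im f ⟶ Y ⟶ coker f ⟶ 0`. -/
@[simps]
noncomputable def imageSequence {X Y : C} (f : X ⟶ Y) : ShortComplex C :=
  ShortComplex.mk (Abelian.image.ι f) (cokernel.π f) (kernel.condition _)

lemma imageSequence_shortExact {X Y : C} (f : X ⟶ Y) : (imageSequence f).ShortExact where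
  exact := ShortComplex.exact_of_f_is_kernel _ (kernelIsKernel (cokernel.π f))
  mono_f := inferInstanceAs (Mono (kernel.ι (cokernel.π f)))
  epi_g := inferInstanceAs (Epi (cokernel.π f))

/-- The kernel of a composition of an epimorphism and a monomorphism. -/
lemma nonempty_kernel_iso {T₁ T₂ : ShortComplex C} (h₁ : T₁.ShortExact) (h₂ : T₂.ShortExact)
    (e : T₁.X₃ ≅ T₂.X₁) {X Y : C} (κ : X ⟶ Y) (eX : T₁.X₂ ≅ X) (eY : T₂.X₂ ≅ Y)
    (h : eX.hom ≫ κ = T₁.g ≫ e.hom ≫ T₂.f ≫ eY.hom) :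
    Nonempty (T₁.X₁ ≅ kernel κ) ∧ Nonempty (T₂.X₃ ≅ cokernel κ) := by
  have m₂ := h₂.mono_f
  have e₁ := h₁.epi_g
  have m₁ := h₁.mono_f
  have e₂ := h₂.epi_g
  constructor
  · have hl : IsLimit (KernelFork.ofι (f := T₁.g ≫ e.hom ≫ T₂.f) T₁.f
        (by rw [← Category.assoc, T₁.zero, zero_comp])) :=
      isKernelCompMono h₁.fIsKernel (e.hom ≫ T₂.f) rfl
    exact ⟨hl.conePointUniqueUpToIso (kernelIsKernel _) ≪≫
      kernel.mapIso _ κ eX eY (by rw [h]; simp)⟩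
  · have hl : IsColimit (CokernelCofork.ofπ (f := (T₁.g ≫ e.hom) ≫ T₂.f) T₂.g
        (by rw [Category.assoc, T₂.zero, comp_zero])) :=
      isCokernelEpiComp h₂.gIsCokernel (T₁.g ≫ e.hom) rfl
    exact ⟨hl.coconePointUniqueUpToIso (cokernelIsCokernel _) ≪≫
      cokernel.mapIso _ κ eX eY (by rw [h]; simp)⟩

/-- If `κ` is a coproduct of the `F_j(f_j)` for exact `F_j`, then its kernel and cokernel are
coproducts of the `F_j(ker f_j)` and the `F_j(coker f_j)`. -/
lemma nonempty_sigma_iso_kernel {J : Type w} [HasCoproductsOfShape J C]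
    [HasExactColimitsOfShape (Discrete J) C] (F : J → C ⥤ C)
    [∀ j, (F j).PreservesZeroMorphisms] [∀ j, PreservesFiniteLimits (F j)]
    [∀ j, PreservesFiniteColimits (F j)] {A B : J → C} (f : ∀ j, A j ⟶ B j) {X Y : C} (κ : X ⟶ Y)
    (eX : (∐ fun j => (F j).obj (A j)) ≅ X) (eY : (∐ fun j => (F j).obj (B j)) ≅ Y)
    (h : ∀ j, Limits.Sigma.ι (fun j => (F j).obj (A j)) j ≫ eX.hom ≫ κ =
      (F j).map (f j) ≫ Limits.Sigma.ι (fun j => (F j).obj (B j)) j ≫ eY.hom) :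
    Nonempty ((∐ fun j => (F j).obj (kernel (f j))) ≅ kernel κ) ∧
      Nonempty ((∐ fun j => (F j).obj (cokernel (f j))) ≅ cokernel κ) := by
  refine nonempty_kernel_iso (T₁ := sigmaSequence fun j => (coimageSequence (f j)).map (F j))
    (T₂ := sigmaSequence fun j => (imageSequence (f j)).map (F j))
    (sigmaSequence_shortExact fun j => (coimageSequence_shortExact (f j)).map_of_exact (F j))
    (sigmaSequence_shortExact fun j => (imageSequence_shortExact (f j)).map_of_exact (F j))
    (Iso.refl _) κ eX eY (Limits.Sigma.hom_ext _ _ fun j => (h j).trans ?_)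
  refine .symm ((sigma_ι_map_comp (fun j => (F j).map (Abelian.factorThruImage (f j))) _ j).trans ?_)
  refine (congrArg (_ ≫ ·) ((congrArg (_ ≫ ·) (Category.id_comp _)).trans
    (sigma_ι_map_comp (fun j => (F j).map (Abelian.image.ι (f j))) _ j))).trans ?_
  refine (Category.assoc _ _ _).symm.trans (congrArg (· ≫ _) ?_)
  refine ((F j).map_comp _ _).symm.trans (congrArg _ (Abelian.image.fac _))

end

/-! ### The projection formula A ⊗ F_s ≅ Σ^s A ⊛ F_s -/

namespace BraidedStabilityGroupoid

open StabilityGroupoid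

variable {S : BraidedStabilityGroupoid.{u}}

instance (J : Type u) : HasExactColimitsOfShape (Discrete J) S.UMod :=
  have : HasExactColimitsOfShape (Discrete J) (ModuleCat.{u} ℤ) :=
    HasExactColimitsOfShape.domain_of_functor _ (forget₂ (ModuleCat.{u} ℤ) AddCommGrpCat.{u})
  inferInstance

/-- The morphism `A ⟶ Σ^s A`. -/
noncomputable def toSig (s : ℕ) (A : S.UMod) : A ⟶ (S.shiftF s).obj A :=
  shiftHomMk (fun p => act A (S.insR p s)) fun x a => by
    rw [← act_comp, ← act_comp, S.rshMap_comp_insR]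

section

variable {J : Type u} (s : J → ℕ) (A : S.UMod)

/-- The inclusion of a summand of a free module. -/
noncomputable def freeι (j : J) : S.free₁ (s j) ⟶ free s :=
  freeDesc fun _ => freeMk s j (S.idHom (s j))

lemma freeι_gen (j : J) (i : PUnit) : ((freeι (S := S) s j).app ⟨s j⟩).hom
    (freeMk (fun _ : PUnit.{u + 1} => s j) i (S.idHom (s j))) = freeMk s j (S.idHom (s j)) :=
  freeDesc_gen (s := fun _ : PUnit.{u + 1} => s j) _ i

lemma dayMap_freeι_gen {p n : ℕ} (a : A.obj ⟨p⟩) (j : J) (i : PUnit) (w : S.UHom (p + s j) n) :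
    ((dayMap (𝟙 A) (freeι s j)).app ⟨n⟩).hom (dayGen (fun _ => s j) a i w) = dayGen s a j w :=
  (dayMap_mk ..).trans (congrArg (fun b => dayMk a b w) (freeι_gen s j i))

/-- `A ⊛ free s` as a coproduct. -/
noncomputable def dayFreeCofan : Cofan fun j => (dayR (S.free₁ (s j))).obj A :=
  Cofan.mk (day A (free s)) fun j => dayMap (𝟙 A) (freeι s j)

/-- `dayFreeCofan` is a coproduct. -/
noncomputable def dayFreeCofanIsColimit : IsColimit (dayFreeCofan s A) :=
  Cofan.IsColimit.mk _
    (fun t => dayFreeDesc fun j => dayFreeUnit A _ PUnit.unit ≫ (S.shiftF (s j)).map (t.inj j))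
    (fun t j => dayFree_hom_ext fun a i => by
      refine (congrArg _ (dayMap_freeι_gen s A a j i _)).trans ((dayFreeDesc_gen _ _ _ _).trans ?_)
      exact act_idHom _ _)
    (fun t m hm => dayFree_hom_ext fun {p} a j => by
      refine .trans ?_ (dayFreeDesc_gen _ _ _ _).symm
      refine .trans ?_ (act_idHom _ _).symm
      refine (congrArg _ (dayMap_freeι_gen s A a j PUnit.unit _)).symm.trans ?_
      exact congrArg (fun φ : (dayR (S.free₁ (s j))).obj A ⟶ t.pt => (φ.app ⟨p + s j⟩).hom
        (dayGen (fun _ => s j) a PUnit.unit (S.idHom (p + s j)))) (hm j))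

/-- `A ⊛ free s` as a coproduct. -/
noncomputable def dayFreeIso : (∐ fun j => (dayR (S.free₁ (s j))).obj A) ≅ day A (free s) :=
  (coproductIsCoproduct _).coconePointUniqueUpToIso (dayFreeCofanIsColimit s A)

lemma ι_dayFreeIso (j : J) : Limits.Sigma.ι (fun j => (dayR (S.free₁ (s j))).obj A) j ≫
    (dayFreeIso s A).hom = dayMap (𝟙 A) (freeι s j) :=
  (coproductIsCoproduct _).comp_coconePointUniqueUpToIso_hom (dayFreeCofanIsColimit s A) ⟨j⟩

/-- The projection formula morphism `Σ^s A ⊛ free₁ s ⟶ A ⊗ free s`. -/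
noncomputable def projFormula (j : J) :
    (dayR (S.free₁ (s j))).obj ((S.shiftF (s j)).obj A) ⟶ tens A (free s) :=
  dayFreeDesc fun _ => shiftHomMk (A := (S.shiftF (s j)).obj A) (B := tens A (free s))
    (fun p => intLinear (V := A.obj ⟨p + s j⟩)
      (fun a => tmk a (freeMk s j (UHom.mk p rfl 1))) fun a a' => tmk_add_left _ _ _)
    fun x a => by
      refine .trans ?_ (act_tmk (A := A) (M := free s) _ _ _).symm
      rw [act_freeMk, S.rshMap_comp_insLeft]
      rfl

lemma projFormula_gen {p n : ℕ} (j : J) (i : PUnit) (a : A.obj ⟨p + s j⟩)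
    (w : S.UHom (p + s j) n) : ((projFormula s A j).app ⟨n⟩).hom
      (dayGen (A := (S.shiftF (s j)).obj A) (fun _ => s j) a i w) =
      tmk (act A w a) (freeMk s j (sec w)) := by
  refine (dayFreeDesc_gen _ _ _ _).trans ((act_tmk (A := A) (M := free s) _ _ _).trans ?_)
  rw [act_freeMk, sec]

/-- Under the projection formula the comparison A ⊛ F_s ⟶ A ⊗ F_s becomes A ⟶ Σ^s A tensored with
F_s. -/
lemma dayMap_toSig_projFormula (j : J) :
    dayMap (toSig (s j) A) (𝟙 (S.free₁ (s j))) ≫ projFormula s A j =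
      dayMap (𝟙 A) (freeι s j) ≫ dayToTens A (free s) := dayFree_hom_ext fun {p} a i => by
  refine (congrArg _ (dayMap_mk ..)).trans ((projFormula_gen s A j i _ _).trans ?_)
  refine .symm ((congrArg _ (dayMap_freeι_gen s A a j i _)).trans ((dayToTens_mk ..).trans ?_))
  rw [act_freeMk, act_freeMk, comp_idHom]
  rfl

variable {A} in
/-- The image of `a ⊗ f` under the morphism defined by `t`. -/
noncomputable def tensFreeVal {B : S.UMod}
    (t : ∀ j, (dayR (S.free₁ (s j))).obj ((S.shiftF (s j)).obj A) ⟶ B) {n : ℕ} (a : A.obj ⟨n⟩)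
    (j : J) (f : S.UHom (s j) n) : B.obj ⟨n⟩ :=
  ((t j).app ⟨n⟩).hom (dayGen (A := (S.shiftF (s j)).obj A) (fun _ => s j) (act A (hatInv f) a)
    PUnit.unit (hat f))

variable {A} in
lemma tensFreeVal_add {B : S.UMod}
    (t : ∀ j, (dayR (S.free₁ (s j))).obj ((S.shiftF (s j)).obj A) ⟶ B) {n : ℕ} (a a' : A.obj ⟨n⟩)
    (j : J) (f : S.UHom (s j) n) :
    tensFreeVal s t (a + a') j f = tensFreeVal s t a j f + tensFreeVal s t a' j f := by
  rw [tensFreeVal, map_add]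
  exact (congrArg _ (dayMk_add_left (A := (S.shiftF (s j)).obj A) ..)).trans (map_add _ _ _)

variable {A} in
-- The choice of complement is immaterial: w differs from the chosen extension of its restriction to
-- s by some γ ⊕ id_s, and γ can be moved across ⊛ onto a.
lemma tensFreeVal_gen {B : S.UMod}
    (t : ∀ j, (dayR (S.free₁ (s j))).obj ((S.shiftF (s j)).obj A) ⟶ B) {p n : ℕ} (j : J)
    (a : A.obj ⟨p + s j⟩) (w : S.UHom (p + s j) n) :
    tensFreeVal s t (act A w a) j (sec w) = ((t j).app ⟨n⟩).hom
      (dayGen (A := (S.shiftF (s j)).obj A) (fun _ => s j) a PUnit.unit w) := by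
  refine congrArg ((t j).app ⟨n⟩).hom ?_
  have h : act A (hatInv (sec w)) (act A w a) = act ((S.shiftF (s j)).obj A) (compl w) a := by
    refine .trans ?_ (show act A (S.rshMap (s j) (compl w)) a = _ from rfl)
    conv_lhs => rw [← hat_compl w]
    rw [sec_comp_rshMap, sec_hat, ← act_comp, ← comp_assoc, hatInv_hat, idHom_comp]
  refine (congrArg (fun a => dayGen (A := (S.shiftF (s j)).obj A) (fun _ => s j) a PUnit.unit
    (hat (sec w))) h).trans ?_
  refine (dayMk_act_left (A := (S.shiftF (s j)).obj A) _ _ _ _).trans ?_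
  rw [hat_compl]

variable {A} in
/-- The components of `tensFreeDesc`. -/
noncomputable def tensFreeDescApp {B : S.UMod}
    (t : ∀ j, (dayR (S.free₁ (s j))).obj ((S.shiftF (s j)).obj A) ⟶ B) (n : ℕ) :
    (tens A (free s)).obj ⟨n⟩ →ₗ[ℤ] B.obj ⟨n⟩ :=
  tensLift (W := B.obj ⟨n⟩) (fun a b => freeLift (W := B.obj ⟨n⟩) (tensFreeVal s t a) b)
    (fun a a' b => by
      refine LinearMap.congr_fun (f := freeLift (W := B.obj ⟨n⟩) (tensFreeVal s t (a + a')))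
        (g := freeLift (W := B.obj ⟨n⟩) (tensFreeVal s t a) +
          freeLift (W := B.obj ⟨n⟩) (tensFreeVal s t a'))
        (free_linear_ext fun j x => ?_) b
      rw [LinearMap.add_apply, freeLift_mk, freeLift_mk, freeLift_mk, tensFreeVal_add])
    (fun a b b' => map_add _ _ _)

variable {A} in
lemma tensFreeDescApp_mk {B : S.UMod}
    (t : ∀ j, (dayR (S.free₁ (s j))).obj ((S.shiftF (s j)).obj A) ⟶ B) {n : ℕ} (a : A.obj ⟨n⟩)
    (j : J) (f : S.UHom (s j) n) :
    tensFreeDescApp s t n (tmk a (freeMk s j f)) = tensFreeVal s t a j f :=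
  (tensLift_mk _ _ _ _ _).trans (freeLift_mk _ _ _)

variable {A s} in
lemma tens_free_linear_ext {W : Type*} [AddCommGroup W] [Module ℤ W] {n : ℕ}
    {f g : (tens A (free s)).obj ⟨n⟩ →ₗ[ℤ] W}
    (h : ∀ a j (y : S.UHom (s j) n), f (tmk a (freeMk s j y)) = g (tmk a (freeMk s j y))) :
    f = g :=
  tens_linear_ext fun a b => by
    let δ : (free (S := S) s).obj ⟨n⟩ →ₗ[ℤ] (tens A (free s)).obj ⟨n⟩ :=
      intLinear (fun b => tmk a b) fun b b' => tmk_add_right a b b'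
    exact LinearMap.congr_fun (f := f ∘ₗ δ) (g := g ∘ₗ δ) (free_linear_ext fun j y => h a j y) b

variable {A} in
/-- The morphism out of `A ⊗ free s` defined by morphisms out of the `Σ^{s_j} A ⊛ free₁ s_j`. -/
noncomputable def tensFreeDesc {B : S.UMod}
    (t : ∀ j, (dayR (S.free₁ (s j))).obj ((S.shiftF (s j)).obj A) ⟶ B) : tens A (free s) ⟶ B :=
  umodHom (tensFreeDescApp s t) (by
    intro m n x a
    refine LinearMap.congr_fun (f := tensFreeDescApp s t n ∘ₗ act (tens A (free s)) x)
      (g := act B x ∘ₗ tensFreeDescApp s t m) (tens_free_linear_ext fun a j f => ?_) a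
    rw [LinearMap.comp_apply, LinearMap.comp_apply, act_tmk, act_freeMk, tensFreeDescApp_mk,
      tensFreeDescApp_mk]
    have h := tensFreeVal_gen s t j (act A (hatInv f) a) (UHom.comp x (hat f))
    rw [sec, comp_assoc, hat_comp, act_comp, ← act_comp A (hat f), hat_hatInv, act_idHom] at h
    refine h.trans ((congrArg _ (act_dayMk ((S.shiftF (s j)).obj A) _ _ _ _ _)).symm.trans ?_)
    exact app_act (t j) x _)

variable {A} in
lemma tensFreeDesc_mk {B : S.UMod}
    (t : ∀ j, (dayR (S.free₁ (s j))).obj ((S.shiftF (s j)).obj A) ⟶ B) {n : ℕ} (a : A.obj ⟨n⟩)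
    (j : J) (f : S.UHom (s j) n) :
    ((tensFreeDesc s t).app ⟨n⟩).hom (tmk a (freeMk s j f)) = tensFreeVal s t a j f :=
  tensFreeDescApp_mk s t a j f

/-- `A ⊗ free s` as a coproduct. -/
noncomputable def tensFreeCofan :
    Cofan fun j => (dayR (S.free₁ (s j))).obj ((S.shiftF (s j)).obj A) :=
  Cofan.mk (tens A (free s)) (projFormula s A)

/-- `tensFreeCofan` is a coproduct. -/
noncomputable def tensFreeCofanIsColimit : IsColimit (tensFreeCofan s A) :=
  Cofan.IsColimit.mk _ (fun t => tensFreeDesc s t.inj)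
    (fun t j => dayFree_hom_ext fun {p} a i => by
      refine (congrArg _ (projFormula_gen s A j i a _)).trans ((tensFreeDesc_mk _ _ _ _ _).trans ?_)
      exact tensFreeVal_gen s t.inj j a _)
    (fun t m hm => by
      ext ⟨n⟩ : 2
      refine ModuleCat.hom_ext (tens_free_linear_ext fun a j f => ?_)
      refine .trans ?_ (tensFreeDesc_mk s t.inj a j f).symm
      refine .trans ?_ (congrArg (fun φ : (dayR (S.free₁ (s j))).obj ((S.shiftF (s j)).obj A) ⟶ t.pt
        => (φ.app ⟨n⟩).hom (dayGen (A := (S.shiftF (s j)).obj A) (fun _ => s j) (act A (hatInv f) a)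
          PUnit.unit (hat f))) (hm j))
      refine congrArg (m.app ⟨n⟩).hom (.trans ?_ (projFormula_gen s A j PUnit.unit _ _).symm)
      rw [sec_hat, ← act_comp, hat_hatInv, act_idHom])

/-- `A ⊗ free s` as a coproduct. -/
noncomputable def tensFreeIso :
    (∐ fun j => (dayR (S.free₁ (s j))).obj ((S.shiftF (s j)).obj A)) ≅ tens A (free s) :=
  (coproductIsCoproduct _).coconePointUniqueUpToIso (tensFreeCofanIsColimit s A)

lemma ι_tensFreeIso (j : J) :
    Limits.Sigma.ι (fun j => (dayR (S.free₁ (s j))).obj ((S.shiftF (s j)).obj A)) j ≫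
      (tensFreeIso s A).hom = projFormula s A j :=
  (coproductIsCoproduct _).comp_coconePointUniqueUpToIso_hom (tensFreeCofanIsColimit s A) ⟨j⟩

/-- Both sides of the comparison are coproducts over the generators, and the functors - ⊛ F_s are
exact, so kernel and cokernel can be computed generator by generator. -/
lemma nonempty_sigma_iso_kernel_dayToTens :
    Nonempty ((∐ fun j => (dayR (S.free₁ (s j))).obj (kernel (toSig (s j) A))) ≅
      kernel (dayToTens A (free s))) ∧
    Nonempty ((∐ fun j => (dayR (S.free₁ (s j))).obj (cokernel (toSig (s j) A))) ≅
      cokernel (dayToTens A (free s))) :=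
  nonempty_sigma_iso_kernel (fun j => dayR (S.free₁ (s j))) (fun j => toSig (s j) A) _
    (dayFreeIso s A) (tensFreeIso s A) fun j => by
      rw [← Category.assoc, ι_dayFreeIso, ι_tensFreeIso]
      exact (dayMap_toSig_projFormula s A j).symm

variable {A} in
lemma dayFreeIso_naturality {B : S.UMod} (φ : A ⟶ B) :
    (dayFreeIso s A).hom ≫ dayMap φ (𝟙 (free s)) =
      Limits.Sigma.map (fun j => (dayR (S.free₁ (s j))).map φ) ≫ (dayFreeIso s B).hom := by
  refine Limits.Sigma.hom_ext _ _ fun j => ?_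
  rw [sigma_ι_map_comp, ι_dayFreeIso, ← Category.assoc, ι_dayFreeIso, dayR_map]
  refine (dayMap_comp _ _ _ _).symm.trans (.trans ?_ (dayMap_comp _ _ _ _))
  rw [Category.comp_id, Category.comp_id, Category.id_comp, Category.id_comp]

/-- For a free module the functor is a coproduct of the exact functors - ⊛ F_s. -/
lemma shortExact_map_dayR_free {T : ShortComplex S.UMod} (hT : T.ShortExact) :
    (T.map (dayR (free s))).ShortExact :=
  ShortComplex.shortExact_of_iso (ShortComplex.isoMk (dayFreeIso s T.X₁)
    (dayFreeIso s T.X₂) (dayFreeIso s T.X₃) (dayFreeIso_naturality s T.f)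
    (dayFreeIso_naturality s T.g))
    (sigmaSequence_shortExact fun j => hT.map_of_exact (dayR (S.free₁ (s j))))

end

end BraidedStabilityGroupoid

/-! ### Contractions of semi-simplicial sets and exactness of the augmented complex -/

namespace SemiSimplicialSet

variable (X : SemiSimplicialSet.{u})

lemma linearMap_ext_single {α W : Type*} [AddCommGroup W] {f g : (α →₀ ℤ) →ₗ[ℤ] W}
    (h : ∀ x, f (Finsupp.single x 1) = g (Finsupp.single x 1)) : f = g :=
  Finsupp.lhom_ext' fun x => LinearMap.ext_ring (h x)

lemma augmentation_single (x : X.obj 0) :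
    X.augmentation (Finsupp.single x 1) = Finsupp.single PUnit.unit 1 := by
  simp [augmentation, Finsupp.mapDomain_single]

/-- A partially defined extra degeneracy `h`, defined away from the simplices satisfying `Z`, such
that the simplices satisfying `Z` are in the image of `h`. -/
structure Contraction where
  Z : ∀ p, X.obj p → Prop
  h : ∀ p (x : X.obj p), ¬ Z p x → X.obj (p + 1)
  x₀ : X.obj 0
  face_zero : ∀ p x hx, X.face p 0 (h p x hx) = x
  not_Z_face : ∀ p x i, ¬ Z (p + 1) x → ¬ Z p (X.face p i x)
  face_succ : ∀ p x hx i, X.face (p + 1) i.succ (h (p + 1) x hx) =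
    h p (X.face p i x) (not_Z_face p x i hx)
  face_last : ∀ x hx, X.face 0 1 (h 0 x hx) = x₀
  not_Z_face_zero : ∀ p x, Z (p + 1) x → ¬ Z p (X.face p 0 x)
  h_face_zero : ∀ p x hx, h p (X.face p 0 x) (not_Z_face_zero p x hx) = x
  Z_face_succ : ∀ p x i, Z (p + 1) x → Z p (X.face p (Fin.succ i) x)
  eq_of_Z : ∀ x, Z 0 x → x = x₀

namespace Contraction

variable {X} (c : X.Contraction)

open Classical in
/-- The contracting homotopy. -/
noncomputable def homotopy (p : ℕ) : (X.obj p →₀ ℤ) →ₗ[ℤ] (X.obj (p + 1) →₀ ℤ) :=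
  Finsupp.linearCombination ℤ fun x =>
    if hx : c.Z p x then 0 else Finsupp.single (c.h p x hx) 1

lemma homotopy_of_Z {p : ℕ} {x : X.obj p} (hx : c.Z p x) :
    c.homotopy p (Finsupp.single x 1) = 0 := by
  simp [homotopy, hx]

lemma homotopy_of_not_Z {p : ℕ} {x : X.obj p} (hx : ¬ c.Z p x) :
    c.homotopy p (Finsupp.single x 1) = Finsupp.single (c.h p x hx) 1 := by
  simp [homotopy, hx]

/-- Off Z this is the usual identity for an extra degeneracy. On Z the homotopy vanishes on x and on
all its faces but the zeroth, and it maps the zeroth face back to x. -/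
lemma boundary_homotopy (p : ℕ) (a : X.obj (p + 1) →₀ ℤ) :
    X.boundary (p + 1) (c.homotopy (p + 1) a) + c.homotopy p (X.boundary p a) = a := by
  refine LinearMap.congr_fun (f := X.boundary (p + 1) ∘ₗ c.homotopy (p + 1) +
    c.homotopy p ∘ₗ X.boundary p) (g := LinearMap.id) (linearMap_ext_single fun x => ?_) a
  rw [LinearMap.add_apply, LinearMap.comp_apply, LinearMap.comp_apply, LinearMap.id_apply]
  by_cases hx : c.Z (p + 1) x
  · rw [c.homotopy_of_Z hx, map_zero, zero_add, boundary_single, map_sum, Fin.sum_univ_succ,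
      Finset.sum_eq_zero, add_zero, Fin.val_zero, pow_zero, one_smul,
      c.homotopy_of_not_Z (c.not_Z_face_zero p x hx), c.h_face_zero p x hx]
    intro i _
    rw [map_smul, c.homotopy_of_Z (c.Z_face_succ p x i hx), smul_zero]
  · rw [c.homotopy_of_not_Z hx, boundary_single, Fin.sum_univ_succ, c.face_zero, Fin.val_zero,
      pow_zero, one_smul, boundary_single, map_sum, add_assoc, ← Finset.sum_add_distrib,
      Finset.sum_eq_zero, add_zero]
    intro i _
    rw [map_smul, c.homotopy_of_not_Z (c.not_Z_face p x i hx), c.face_succ, Fin.val_succ, pow_succ,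
      mul_neg_one, neg_smul, neg_add_cancel]

/-- In degree 0 the homotopy satisfies ∂h(x) = x - x₀ for every vertex, both sides being 0 for the
vertex x₀ in Z. The correction is thus a multiple of x₀ given by the augmentation. -/
lemma boundary_homotopy_zero (a : X.obj 0 →₀ ℤ) (ha : X.augmentation a = 0) :
    X.boundary 0 (c.homotopy 0 a) = a := by
  have h : X.boundary 0 (c.homotopy 0 a) +
      Finsupp.lmapDomain ℤ ℤ (fun _ => c.x₀) (X.augmentation a) = a := by
    refine LinearMap.congr_fun (f := X.boundary 0 ∘ₗ c.homotopy 0 +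
      Finsupp.lmapDomain ℤ ℤ (fun _ => c.x₀) ∘ₗ X.augmentation) (g := LinearMap.id)
      (linearMap_ext_single fun x => ?_) a
    rw [LinearMap.add_apply, LinearMap.comp_apply, LinearMap.comp_apply, LinearMap.id_apply,
      augmentation_single, Finsupp.lmapDomain_apply, Finsupp.mapDomain_single]
    by_cases hx : c.Z 0 x
    · rw [c.homotopy_of_Z hx, map_zero, zero_add, c.eq_of_Z x hx]
    · rw [c.homotopy_of_not_Z hx, boundary_single, Fin.sum_univ_two, c.face_zero, c.face_last]
      simp
  rwa [ha, map_zero, add_zero] at h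

include c in
lemma surjective_augmentation : Function.Surjective X.augmentation := fun y => by
  refine ⟨Finsupp.lmapDomain ℤ ℤ (fun _ => c.x₀) y, ?_⟩
  refine LinearMap.congr_fun (f := X.augmentation ∘ₗ Finsupp.lmapDomain ℤ ℤ (fun _ => c.x₀))
    (g := LinearMap.id) (linearMap_ext_single fun x => ?_) y
  rw [LinearMap.comp_apply, Finsupp.lmapDomain_apply, Finsupp.mapDomain_single,
    augmentation_single, LinearMap.id_apply]

include c in
lemma exists_boundary {p : ℕ} (a : X.obj (p + 1) →₀ ℤ) (ha : X.boundary p a = 0) :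
    ∃ b, X.boundary (p + 1) b = a :=
  ⟨c.homotopy (p + 1) a, by simpa [ha] using c.boundary_homotopy p a⟩

end Contraction

lemma augmentedComplex_d_succ (p : ℕ) :
    X.augmentedComplex.d (p + 2) (p + 1) = ModuleCat.ofHom (X.boundary p) :=
  ChainComplex.of_d (fun p => ModuleCat.of ℤ (X.obj p →₀ ℤ))
    (fun p => ModuleCat.ofHom (X.boundary p)) p

lemma surjective_augmentation (h : IsZero (X.reducedHomology 0)) :
    Function.Surjective X.augmentation := by
  have e : X.augmentedComplex.ExactAt 0 := (HomologicalComplex.exactAt_iff_isZero_homology _ _).2 h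
  rw [HomologicalComplex.exactAt_iff' _ 1 0 0 (by simp) (by simp)] at e
  have hz : (X.augmentedComplex.sc' 1 0 0).g = 0 := X.augmentedComplex.shape 0 0 (by simp)
  have := (ShortComplex.exact_iff_epi _ hz).1 e
  exact (ModuleCat.epi_iff_surjective (ModuleCat.ofHom X.augmentation)).1 this

lemma exists_boundary_zero (h : IsZero (X.reducedHomology 1)) (a : X.obj 0 →₀ ℤ)
    (ha : X.augmentation a = 0) : ∃ b, X.boundary 0 b = a := by
  have e : X.augmentedComplex.ExactAt 1 := (HomologicalComplex.exactAt_iff_isZero_homology _ _).2 h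
  rw [HomologicalComplex.exactAt_iff' _ 2 1 0 (by simp) (by simp)] at e
  have e' := (ShortComplex.ShortExact.moduleCat_exact_iff_function_exact _).1 e
  obtain ⟨b, hb⟩ := (e' a).1 ha
  exact ⟨b, (congrArg (fun f => f.hom b) (X.augmentedComplex_d_succ 0)).symm.trans hb⟩

lemma exists_boundary_succ {p : ℕ} (h : IsZero (X.reducedHomology (p + 2)))
    (a : X.obj (p + 1) →₀ ℤ) (ha : X.boundary p a = 0) : ∃ b, X.boundary (p + 1) b = a := by
  have e : X.augmentedComplex.ExactAt (p + 2) :=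
    (HomologicalComplex.exactAt_iff_isZero_homology _ _).2 h
  rw [HomologicalComplex.exactAt_iff' _ (p + 3) (p + 2) (p + 1) (by simp) (by simp)] at e
  have e' := (ShortComplex.ShortExact.moduleCat_exact_iff_function_exact _).1 e
  obtain ⟨b, hb⟩ := (e' a).1 ((congrArg (fun f => f.hom a) (X.augmentedComplex_d_succ p)).trans ha)
  exact ⟨b, (congrArg (fun f => f.hom b) (X.augmentedComplex_d_succ (p + 1))).symm.trans hb⟩

end SemiSimplicialSet

/-! ### Complexes of cosets of Young subgroups -/

/-- Add `c` to the first entry of a list. -/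
def addHead (c : ℕ) : List ℕ → List ℕ
  | [] => []
  | a :: t => (c + a) :: t

lemma length_addHead (c : ℕ) : ∀ l, (addHead c l).length = l.length
  | [] => rfl
  | _ :: _ => rfl

lemma tail_addHead (c : ℕ) : ∀ l, (addHead c l).tail = l.tail
  | [] => rfl
  | _ :: _ => rfl

lemma addHead_zero : ∀ l, addHead 0 l = l
  | [] => rfl
  | a :: t => by rw [addHead, zero_add]

lemma addHead_addHead (c d : ℕ) : ∀ l, addHead c (addHead d l) = addHead (c + d) l
  | [] => rfl
  | a :: t => by rw [addHead, addHead, addHead, add_assoc]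

lemma mergeAt_addHead (c : ℕ) : ∀ i l, mergeAt i (addHead c l) = addHead c (mergeAt i l)
  | 0, [] => rfl
  | 0, [_] => rfl
  | 0, a :: b :: t => by simp [mergeAt, addHead, add_assoc]
  | _ + 1, [] => rfl
  | _ + 1, _ :: _ => rfl

lemma sum_addHead (c : ℕ) {l : List ℕ} (h : l ≠ []) : (addHead c l).sum = c + l.sum := by
  cases l with
  | nil => exact absurd rfl h
  | cons a t => simp [addHead, add_assoc]

namespace StabilityGroupoid

variable (S : StabilityGroupoid.{u})

/-- Cosets of the subgroups `young l` for the lists `l` of length `p + 2` satisfying `R`. -/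
abbrev ListSimplex {m : ℕ} (R : List ℕ → Prop) (hR : ∀ l, R l → l.sum = m) (p : ℕ) : Type u :=
  Σ l : {l : List ℕ // l.length = p + 2 ∧ R l}, S.G m ⧸ S.young l.1 (hR l.1 l.2.2)

section

variable {S} {m : ℕ} {R : List ℕ → Prop} {hR : ∀ l, R l → l.sum = m} {p : ℕ}

/-- The coset of `g`. -/
def listMk (hR : ∀ l, R l → l.sum = m) (l : {l : List ℕ // l.length = p + 2 ∧ R l}) (g : S.G m) :
    S.ListSimplex R hR p := ⟨l, (g : S.G m ⧸ S.young l.1 (hR l.1 l.2.2))⟩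

lemma listMk_ind {P : S.ListSimplex R hR p → Prop} (h : ∀ l g, P (listMk hR l g)) (x) : P x := by
  obtain ⟨l, g⟩ := x
  induction g using QuotientGroup.induction_on with
  | H g => exact h l g

lemma listMk_eq {l l' : {l : List ℕ // l.length = p + 2 ∧ R l}} (e : l.1 = l'.1) (g g' : S.G m)
    (h : g⁻¹ * g' ∈ S.young l'.1 (hR l'.1 l'.2.2)) : listMk hR l g = listMk hR l' g' := by
  obtain rfl : l = l' := Subtype.ext e
  exact congrArg (Sigma.mk l) (QuotientGroup.eq.2 h)

lemma listMk_congr {l l' : {l : List ℕ // l.length = p + 2 ∧ R l}} (e : l.1 = l'.1) (g : S.G m) :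
    listMk hR l g = listMk hR l' g := by
  obtain rfl : l = l' := Subtype.ext e
  rfl

/-- Merge two consecutive entries of a list. -/
def mergeList (hm : ∀ i l, R l → R (mergeAt i l)) (i : Fin (p + 2))
    (l : {l : List ℕ // l.length = p + 1 + 2 ∧ R l}) : {l : List ℕ // l.length = p + 2 ∧ R l} :=
  ⟨mergeAt i l.1, by
      have := length_mergeAt i l.1 (by have := l.2.1; have := i.2; omega)
      have := l.2.1
      omega, hm i l.1 l.2.2⟩

variable (S) in
/-- The semi-simplicial set of the `ListSimplex R hR p`. -/
def listComplex (R : List ℕ → Prop) (hR : ∀ l, R l → l.sum = m)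
    (hm : ∀ i l, R l → R (mergeAt i l)) : SemiSimplicialSet.{u} where
  obj p := S.ListSimplex R hR p
  face p i x := ⟨mergeList hm i x.1, Subgroup.quotientMapOfLE (S.young_le_mergeAt i x.1.1
    (hR x.1.1 x.1.2.2) (hR (mergeList hm i x.1).1 (mergeList hm i x.1).2.2)) x.2⟩
  face_face p i j hij := listMk_ind fun l g =>
    listMk_congr (l := mergeList hm i (mergeList hm j.succ l))
      (l' := mergeList hm j (mergeList hm i.castSucc l)) (mergeAt_mergeAt i j l.1 hij) g

end

lemma splittingComplex_eq (n : ℕ) : S.splittingComplex n =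
    S.listComplex (fun l => (∀ a ∈ l, 0 < a) ∧ l.sum = n) (fun _ h => h.2)
      (fun i l h => ⟨pos_mergeAt i l h.1, (sum_mergeAt i l).trans h.2⟩) := rfl

/-- Lists with sum `m` whose tail has positive entries and sum `< n`. -/
def TailLT (n m : ℕ) (l : List ℕ) : Prop :=
  (∀ a ∈ l.tail, 0 < a) ∧ l.tail.sum < n ∧ l.sum = m

lemma TailLT.sum_eq {n m : ℕ} (l : List ℕ) (h : TailLT n m l) : l.sum = m := h.2.2

lemma TailLT.mergeAt {n m : ℕ} : ∀ i l, TailLT n m l → TailLT n m (mergeAt i l)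
  | 0, [], h => h
  | 0, [_], h => h
  | 0, a :: b :: t, h => by
    simp only [TailLT, _root_.mergeAt, List.tail_cons, List.mem_cons, forall_eq_or_imp,
      List.sum_cons] at h ⊢
    exact ⟨h.1.2, by omega, by omega⟩
  | _ + 1, [], h => h
  | i + 1, a :: t, h => by
    simp only [TailLT, _root_.mergeAt, List.tail_cons, List.sum_cons, sum_mergeAt] at h ⊢
    exact ⟨pos_mergeAt i t h.1, h.2⟩

/-- When the total is n, a tail of sum < n forces a positive first entry. This is why the complex in
rank n is the splitting complex. -/
lemma tailLT_self {n : ℕ} (hn : 0 < n) (l : List ℕ) :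
    TailLT n n l ↔ (∀ a ∈ l, 0 < a) ∧ l.sum = n := by
  cases l with
  | nil => simp [TailLT]; omega
  | cons a t =>
    simp only [TailLT, List.tail_cons, List.mem_cons, forall_eq_or_imp, List.sum_cons]
    constructor
    · rintro ⟨h, h', h''⟩
      exact ⟨⟨by omega, h⟩, h''⟩
    · rintro ⟨⟨h, h'⟩, h''⟩
      exact ⟨h', by omega, h''⟩

/-- The complex of the lists satisfying `TailLT n m`. -/
abbrev tailComplex (n m : ℕ) : SemiSimplicialSet.{u} :=
  S.listComplex (TailLT n m) TailLT.sum_eq TailLT.mergeAt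

lemma listComplex_congr {m : ℕ} {R R' : List ℕ → Prop} (e : R = R') (hR : ∀ l, R l → l.sum = m)
    (hm) (hR' : ∀ l, R' l → l.sum = m) (hm') :
    S.listComplex R hR hm = S.listComplex R' hR' hm' := by
  subst e
  rfl

lemma tailComplex_self {n : ℕ} (hn : 0 < n) : S.tailComplex n n = S.splittingComplex n :=
  (S.listComplex_congr (funext fun l => propext (tailLT_self hn l)) _ _ _ _).trans
    (S.splittingComplex_eq n).symm

variable {S}

lemma mem_young_cons {a k n : ℕ} {t : List ℕ} (hk : t.sum = k) (h : (a :: t).sum = n)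
    (h' : a + k = n) {x : S.G n} : x ∈ S.young (a :: t) h ↔
      ∃ y : S.G a, ∃ z ∈ S.young t hk, S.blk h' (y, z) = x := by
  subst hk
  constructor
  · rintro ⟨⟨y, z⟩, ⟨-, hz⟩, rfl⟩
    exact ⟨y, z, hz, rfl⟩
  · rintro ⟨y, z, hz, rfl⟩
    exact ⟨⟨y, z⟩, ⟨trivial, hz⟩, rfl⟩

lemma young_le_zero_cons {m : ℕ} {l : List ℕ} (h : l.sum = m) (h' : (0 :: l).sum = m) :
    S.young l h ≤ S.young (0 :: l) h' := fun x hx =>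
  (mem_young_cons h h' (zero_add m)).2 ⟨1, x, hx, S.one_blk _ _⟩

lemma mem_young_singleton {m : ℕ} (h : [m].sum = m) (x : S.G m) : x ∈ S.young [m] h :=
  (mem_young_cons (k := 0) rfl h (add_zero m)).2 ⟨x, 1, one_mem _, S.blk_one _ _⟩

lemma mem_young_zero_singleton {m b : ℕ} (h : [0, b].sum = m) (x : S.G m) :
    x ∈ S.young [0, b] h := by
  obtain rfl : b = m := by simpa using h
  exact young_le_zero_cons (List.sum_singleton ..) h (mem_young_singleton _ x)

lemma headI_mergeAt_zero {l : List ℕ} (hl : 2 ≤ l.length) (h : ∀ a ∈ l.tail, 0 < a) :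
    (mergeAt 0 l).headI ≠ 0 := by
  match l, hl with
  | a :: b :: t, _ =>
    have := h b (by simp)
    simp [mergeAt]
    omega

lemma headI_mergeAt_succ (i : ℕ) (l : List ℕ) : (mergeAt (i + 1) l).headI = l.headI := by
  cases l <;> rfl

lemma headI_mergeAt_ne_zero (i : ℕ) {l : List ℕ} (h : l.headI ≠ 0) :
    (mergeAt i l).headI ≠ 0 := by
  match i, l with
  | 0, [] => exact h
  | 0, [_] => exact h
  | 0, a :: b :: t =>
    simp only [mergeAt, List.headI_cons] at h ⊢
    omega
  | i + 1, l => rwa [headI_mergeAt_succ]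

lemma zero_cons_mergeAt {l : List ℕ} (hl : 2 ≤ l.length) (h : l.headI = 0) :
    0 :: mergeAt 0 l = l := by
  match l, hl with
  | a :: b :: t, _ =>
    obtain rfl : a = 0 := h
    simp [mergeAt]

lemma mergeAt_zero_cons {l : List ℕ} (hl : 1 ≤ l.length) : mergeAt 0 (0 :: l) = l := by
  match l, hl with
  | a :: t, _ => simp [mergeAt]

/-- After prepending 0 the old list becomes the tail, so its total m must be < n and its first entry
positive. -/
lemma TailLT.zero_cons {n m : ℕ} (hm : m < n) {l : List ℕ} (h : TailLT n m l) (hl : l.headI ≠ 0) :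
    TailLT n m (0 :: l) := by
  refine ⟨?_, by simpa [h.2.2] using hm, by simpa using h.2.2⟩
  cases l with
  | nil => simp
  | cons a t =>
    intro b hb
    rcases List.mem_cons.1 hb with rfl | hb
    · exact Nat.pos_of_ne_zero hl
    · exact h.1 b hb

/-- Prepend `0` to a list. -/
def zeroCons {n m p : ℕ} (hm : m < n) (l : {l : List ℕ // l.length = p + 2 ∧ TailLT n m l})
    (hl : l.1.headI ≠ 0) : {l : List ℕ // l.length = p + 1 + 2 ∧ TailLT n m l} :=
  ⟨0 :: l.1, by rw [List.length_cons, l.2.1], l.2.2.zero_cons hm hl⟩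

variable (S) in
/-- The complex `tailComplex n m` is contractible for `0 < m < n`. -/
def tailContraction {n m : ℕ} (h₀ : 0 < m) (hm : m < n) : (S.tailComplex n m).Contraction where
  -- The contraction prepends a zero, which is impossible exactly when the list already starts with
  -- one, and those simplices are themselves obtained by prepending.
  Z p x := x.1.1.headI = 0
  h p x hx := ⟨zeroCons hm x.1 hx, Subgroup.quotientMapOfLE (young_le_zero_cons
    x.1.2.2.2.2 (zeroCons hm x.1 hx).2.2.2.2) x.2⟩
  -- The Young subgroup of (0, m) is all of G_m, so this list carries a single vertex.
  x₀ := listMk TailLT.sum_eq ⟨[0, m], rfl, by simpa [TailLT] using ⟨h₀, hm⟩⟩ 1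
  face_zero p x hx := by
    induction x using listMk_ind (hR := TailLT.sum_eq) with
    | h l g =>
      exact listMk_congr (hR := TailLT.sum_eq) (l := mergeList TailLT.mergeAt 0 (zeroCons hm l hx))
        (mergeAt_zero_cons (by rw [l.2.1]; omega)) g
  not_Z_face p x i hx := headI_mergeAt_ne_zero i hx
  face_succ p x hx i := by
    induction x using listMk_ind (hR := TailLT.sum_eq) with
    | h l g =>
      exact listMk_congr (hR := TailLT.sum_eq) (l := mergeList TailLT.mergeAt i.succ (zeroCons hm l hx))
        (l' := zeroCons hm (mergeList TailLT.mergeAt i l) (headI_mergeAt_ne_zero i hx)) rfl g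
  face_last x hx := by
    induction x using listMk_ind (hR := TailLT.sum_eq) with
    | h l g =>
      refine listMk_eq (hR := TailLT.sum_eq) (l := mergeList TailLT.mergeAt 1 (zeroCons hm l hx)) ?_ g 1
        (mem_young_zero_singleton _ _)
      obtain ⟨l, h, h'⟩ := l
      match l, h with
      | [a, b], _ =>
        have := h'.2.2
        simp only [List.sum_cons, List.sum_nil] at this
        change [0, a + b] = [0, m]
        rw [← this, add_zero]
  not_Z_face_zero p x hx := headI_mergeAt_zero (by rw [x.1.2.1]; omega) x.1.2.2.1
  h_face_zero p x hx := by
    induction x using listMk_ind (hR := TailLT.sum_eq) with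
    | h l g =>
      exact listMk_congr (hR := TailLT.sum_eq) (l := zeroCons hm (mergeList TailLT.mergeAt 0 l)
        (headI_mergeAt_zero (by rw [l.2.1]; omega) l.2.2.1))
        (zero_cons_mergeAt (by rw [l.2.1]; omega) hx) g
  Z_face_succ p x i hx := (headI_mergeAt_succ i x.1.1).trans hx
  eq_of_Z x hx := by
    induction x using listMk_ind (hR := TailLT.sum_eq) with
    | h l g =>
      refine listMk_eq (hR := TailLT.sum_eq) ?_ g 1 (mem_young_zero_singleton _ _)
      obtain ⟨l, h, h'⟩ := l
      match l, h with
      | [a, b], _ =>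
        obtain rfl : a = 0 := hx
        have := h'.2.2
        simp only [List.sum_cons, List.sum_nil, zero_add, add_zero] at this
        change [0, b] = [0, m]
        rw [this]

end StabilityGroupoid

namespace BraidedStabilityGroupoid

open StabilityGroupoid

variable {S : BraidedStabilityGroupoid.{u}}

instance : HasExt.{u} S.UMod := hasExt_of_enoughProjectives _

/-! ### Orbits of morphisms -/

variable (S) in
-- Orbits of Aut(s) on the morphisms c-complementary to s are the cosets of G_c × G_s in G_m. The
-- action is free since ⊕ is injective.
lemma exists_orbit_section (s m : ℕ) : ∃ (O : Type u) (σ : O → S.UHom s m),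
    (∀ f, ∃ (o : O) (k : S.UHom s s), f = UHom.comp (σ o) k) ∧
    ∀ (o o' : O) (k k' : S.UHom s s), UHom.comp (σ o) k = UHom.comp (σ o') k' → o = o' ∧ k = k' := by
  by_cases hsm : s ≤ m
  · obtain ⟨c, h⟩ : ∃ c, c + s = m := ⟨m - s, by omega⟩
    refine ⟨S.G m ⧸ (S.blk h).range, fun o => UHom.mk c h o.out, fun f => ?_,
      fun o o' k k' e => ?_⟩
    · obtain ⟨c', h', g, rfl⟩ := f.exists_rep
      obtain rfl : c' = c := by omega
      obtain ⟨⟨_, ⟨x, y⟩, rfl⟩, e⟩ := QuotientGroup.mk_out_eq_mul (S.blk h).range g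
      refine ⟨(g : S.G m ⧸ (S.blk h).range), UHom.mk 0 (Nat.zero_add s) y⁻¹, ?_⟩
      rw [UHom.comp_mk, e]
      refine UHom.mk_eq (c' := c' + 0) _ (by omega) _ _ x⁻¹ ?_
      rw [mul_assoc, mul_assoc, S.blk_mul, one_mul, mul_one, S.blk_mul, mul_inv_cancel,
        mul_inv_cancel, S.blk_one_one, mul_one]
    · obtain ⟨d, hd, y, rfl⟩ := k.exists_rep
      obtain rfl : d = 0 := by omega
      obtain ⟨d', hd', y', rfl⟩ := k'.exists_rep
      obtain rfl : d' = 0 := by omega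
      rw [UHom.comp_mk, UHom.comp_mk] at e
      obtain ⟨x, e⟩ := (UHom.mk_eq_iff (c := c + 0) _ _ _).1 e
      rw [mul_assoc, S.blk_mul, one_mul, mul_one] at e
      have ho : o = o' := by
        rw [← QuotientGroup.out_eq' o, ← QuotientGroup.out_eq' o']
        refine QuotientGroup.eq.2 ⟨(x, y' * y⁻¹)⁻¹, ?_⟩
        have e' : o.out = o'.out * S.blk h (x, y' * y⁻¹) := by
          have h₁ : S.blk h (x, y' * y⁻¹) = S.blk h (x, y') * (S.blk h (1, y))⁻¹ := by
            rw [← S.blk_inv_right, S.blk_mul, mul_one]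
          rw [h₁, ← mul_assoc, ← e, mul_inv_cancel_right]
        rw [e', mul_inv_rev, inv_mul_cancel_right, ← map_inv]
      subst ho
      refine ⟨rfl, ?_⟩
      have := S.blk_injective h (mul_left_cancel e)
      rw [(Prod.mk.inj this).2]
  · exact ⟨PEmpty, PEmpty.elim, fun f => absurd f.le hsm, fun o => o.elim⟩

/-- A set of representatives of `Hom(s, m)` modulo `Aut(s)`. -/
def Orb (S : BraidedStabilityGroupoid.{u}) (s m : ℕ) : Type u := (S.exists_orbit_section s m).choose

/-- The representative of an orbit. -/
noncomputable def orb {s m : ℕ} : S.Orb s m → S.UHom s m :=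
  (S.exists_orbit_section s m).choose_spec.choose

lemma exists_orb {s m : ℕ} (f : S.UHom s m) :
    ∃ (o : S.Orb s m) (k : S.UHom s s), f = UHom.comp (orb o) k :=
  (S.exists_orbit_section s m).choose_spec.choose_spec.1 f

lemma orb_inj {s m : ℕ} {o o' : S.Orb s m} {k k' : S.UHom s s}
    (h : UHom.comp (orb o) k = UHom.comp (orb o') k') : o = o' ∧ k = k' :=
  (S.exists_orbit_section s m).choose_spec.choose_spec.2 o o' k k' h

/-! ### Modules induced from one rank -/

/-- The map `⨁_{f ∈ Hom(s, m) / Aut(s)} M_s → M_m`. -/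
noncomputable def indMap (M : S.UMod) (s m : ℕ) : (S.Orb s m →₀ M.obj ⟨s⟩) →+ M.obj ⟨m⟩ :=
  Finsupp.liftAddHom fun o => (act M (orb o)).toAddMonoidHom

lemma indMap_single (M : S.UMod) {s m : ℕ} (o : S.Orb s m) (a : M.obj ⟨s⟩) :
    indMap M s m (Finsupp.single o a) = act M (orb o) a :=
  Finsupp.liftAddHom_apply_single _ _ _

/-- `M` is induced from the `Aut(s)`-module `M_s`. -/
def IsInd (s : ℕ) (M : S.UMod) : Prop := ∀ m, Function.Bijective (indMap M s m)

lemma app_indMap {M M' : S.UMod} (φ : M ⟶ M') {s m : ℕ} (v : S.Orb s m →₀ M.obj ⟨s⟩) :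
    (φ.app ⟨m⟩).hom (indMap M s m v) =
      indMap M' s m (Finsupp.mapRange (φ.app ⟨s⟩).hom (map_zero _) v) := by
  refine DFunLike.congr_fun (f := (φ.app ⟨m⟩).hom.toAddMonoidHom.comp (indMap M s m))
    (g := (indMap M' s m).comp (Finsupp.mapRange.addMonoidHom (φ.app ⟨s⟩).hom.toAddMonoidHom))
    (Finsupp.addHom_ext fun o a => ?_) v
  refine (congrArg _ (indMap_single M o a)).trans ?_
  refine .trans ?_ (congrArg (indMap M' s m)
    (Finsupp.mapRange_single (f := (φ.app ⟨s⟩).hom) (hf := map_zero _))).symm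
  exact (app_act φ _ a).trans (indMap_single _ _ _).symm

/-- The coordinates in X₂ of an element of X₁ map to zero in X₃, so each of them lies in X₁. -/
lemma IsInd.of_exact {T : ShortComplex S.UMod} (hT : T.ShortExact) {s : ℕ} (h₂ : IsInd s T.X₂)
    (h₃ : IsInd s T.X₃) : IsInd s T.X₁ := fun m => by
  rw [umod_shortExact_iff] at hT
  constructor
  · intro v w h
    refine Finsupp.mapRange_injective _ (map_zero _) (hT s).1 ((h₂ m).1 ?_)
    rw [← app_indMap, ← app_indMap, h]
  · intro x
    obtain ⟨v, hv⟩ := (h₂ m).2 ((T.f.app ⟨m⟩).hom x)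
    have hv' : Finsupp.mapRange (T.g.app ⟨s⟩).hom (map_zero _) v = 0 := by
      apply (h₃ m).1
      rw [← app_indMap, hv, map_zero]
      exact ((hT m).2.1 _).2 ⟨x, rfl⟩
    have hw (o) : ∃ a, (T.f.app ⟨s⟩).hom a = v o :=
      ((hT s).2.1 _).1 (DFunLike.congr_fun hv' o)
    choose w hw using hw
    refine ⟨Finsupp.onFinset v.support w fun o ho => ?_, (hT m).1 ?_⟩
    · rw [Finsupp.mem_support_iff, ← hw]
      exact fun h => ho ((hT s).1 (h.trans (map_zero _).symm))
    · rw [app_indMap, ← hv]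
      congr 1
      ext o
      exact hw o

/-- Functors from `U𝒢` to sets. -/
structure USet (S : BraidedStabilityGroupoid.{u}) where
  obj : ℕ → Type u
  map : ∀ {m n}, S.UHom m n → obj m → obj n
  map_id : ∀ {n} (x : obj n), map (S.idHom n) x = x
  map_comp : ∀ {l m n} (f : S.UHom m n) (g : S.UHom l m) (x : obj l),
    map (UHom.comp f g) x = map f (map g x)

/-- The linearization of a functor to sets. -/
noncomputable def lin (X : S.USet) : S.UMod where
  obj Y := ModuleCat.of ℤ (X.obj Y.rank →₀ ℤ)
  map f := ModuleCat.ofHom (Finsupp.lmapDomain ℤ ℤ (X.map f))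
  map_id Y := ModuleCat.hom_ext (SemiSimplicialSet.linearMap_ext_single fun x =>
    Finsupp.mapDomain_single.trans (congrArg (fun y => Finsupp.single y (1 : ℤ)) (X.map_id x)))
  map_comp f g := ModuleCat.hom_ext (SemiSimplicialSet.linearMap_ext_single fun x => by
    refine Finsupp.mapDomain_single.trans ?_
    refine .trans ?_ (congrArg (Finsupp.mapDomain _) Finsupp.mapDomain_single).symm
    refine .trans ?_ Finsupp.mapDomain_single.symm
    exact congrArg (fun y => Finsupp.single y (1 : ℤ)) (X.map_comp g f x))

/-- The basis element `x`. -/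
noncomputable def linMk {X : S.USet} {n : ℕ} (x : X.obj n) : (lin X).obj ⟨n⟩ :=
  Finsupp.single x (1 : ℤ)

lemma act_linMk {X : S.USet} {m n : ℕ} (f : S.UHom m n) (x : X.obj m) :
    act (lin X) f (linMk x) = linMk (X.map f x) := Finsupp.mapDomain_single

lemma lin_linear_ext {X : S.USet} {W : Type*} [AddCommGroup W] [Module ℤ W] {n : ℕ}
    {f g : (lin X).obj ⟨n⟩ →ₗ[ℤ] W} (h : ∀ x : X.obj n, f (linMk x) = g (linMk x)) : f = g :=
  Finsupp.lhom_ext' fun x => LinearMap.ext_ring (h x)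

lemma lin_hom_ext {X : S.USet} {B : S.UMod} {φ ψ : lin X ⟶ B}
    (h : ∀ n (x : X.obj n), (φ.app ⟨n⟩).hom (linMk x) = (ψ.app ⟨n⟩).hom (linMk x)) : φ = ψ := by
  ext ⟨n⟩ : 2
  exact ModuleCat.hom_ext (lin_linear_ext (h n))

/-- The linear extension of a function. -/
noncomputable def linLift {X : S.USet} {W : Type*} [AddCommGroup W] [Module ℤ W] {n : ℕ}
    (b : X.obj n → W) : (lin X).obj ⟨n⟩ →ₗ[ℤ] W :=
  Finsupp.linearCombination ℤ b

lemma linLift_mk {X : S.USet} {W : Type*} [AddCommGroup W] [Module ℤ W] {n : ℕ}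
    (b : X.obj n → W) (x : X.obj n) : linLift b (linMk x) = b x :=
  linearCombination_single_one (R := ℤ) b x

/-- The morphism given by a natural function on the basis. -/
noncomputable def linDesc {X : S.USet} {B : S.UMod} (b : ∀ n, X.obj n → B.obj ⟨n⟩)
    (h : ∀ {m n} (f : S.UHom m n) x, b n (X.map f x) = act B f (b m x)) : lin X ⟶ B :=
  umodHom (fun n => linLift (b n)) (by
    intro m n f a
    refine LinearMap.congr_fun (f := linLift (b n) ∘ₗ act (lin X) f)
      (g := act B f ∘ₗ linLift (b m)) (lin_linear_ext fun x => ?_) a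
    rw [LinearMap.comp_apply, LinearMap.comp_apply, act_linMk, linLift_mk, linLift_mk, h])

lemma linDesc_mk {X : S.USet} {B : S.UMod} (b : ∀ n, X.obj n → B.obj ⟨n⟩) (h) {n : ℕ}
    (x : X.obj n) :
    ((linDesc (B := B) b h).app ⟨n⟩).hom (linMk x) = b n x := linLift_mk _ _

/-- The three conditions make (f, y) ↦ f(y) a bijection from pairs of an orbit representative and an
element of rank s onto X_m. -/
lemma isInd_lin {X : S.USet} {s : ℕ}
    (h₁ : ∀ m (x : X.obj m), ∃ (f : S.UHom s m) (y : X.obj s), X.map f y = x)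
    (h₂ : ∀ m (f f' : S.UHom s m) (y y' : X.obj s), X.map f y = X.map f' y' →
      ∃ k, f' = UHom.comp f k)
    (h₃ : ∀ m (f : S.UHom s m) (y y' : X.obj s), X.map f y = X.map f y' → y = y') :
    IsInd s (lin X) := fun m => by
  let e : S.Orb s m × X.obj s ≃ X.obj m := Equiv.ofBijective (fun p => X.map (orb p.1) p.2) (by
    constructor
    · rintro ⟨o, y⟩ ⟨o', y'⟩ h
      obtain ⟨k, hk⟩ := h₂ _ _ _ _ _ h
      obtain ⟨rfl, -⟩ := orb_inj ((comp_idHom (orb o')).trans hk)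
      exact congrArg _ (h₃ _ _ _ _ h)
    · intro x
      obtain ⟨f, y, rfl⟩ := h₁ m x
      obtain ⟨o, k, rfl⟩ := exists_orb f
      exact ⟨(o, X.map k y), (X.map_comp _ _ _).symm⟩)
  have he : indMap (lin X) s m = ((Finsupp.domCongr e : _ ≃+ (X.obj m →₀ ℤ)) :
      (S.Orb s m × X.obj s →₀ ℤ) →+ (X.obj m →₀ ℤ)).comp
        (Finsupp.curryAddEquiv (α := S.Orb s m) (β := X.obj s) (M := ℤ)).symm.toAddMonoidHom := by
    refine Finsupp.addHom_ext' fun o => Finsupp.addHom_ext fun y r => ?_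
    refine (indMap_single (lin X) o (Finsupp.single y r)).trans ?_
    refine (Finsupp.mapDomain_single).trans ?_
    refine .trans ?_ (congrArg (Finsupp.domCongr e) (Finsupp.uncurry_single o y r)).symm
    exact (Finsupp.equivMapDomain_single e (o, y) r).symm
  rw [he]
  exact ((Finsupp.domCongr e).bijective).comp (Finsupp.curryAddEquiv (M := ℤ)).symm.bijective

/-- The functor to sets whose linearization is `free s`. -/
def freeSet {J : Type u} (s : J → ℕ) : S.USet where
  obj n := Σ j, S.UHom (s j) n
  map f x := ⟨x.1, UHom.comp f x.2⟩
  map_id x := congrArg (Sigma.mk x.1) (idHom_comp x.2)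
  map_comp f g x := congrArg (Sigma.mk x.1) (comp_assoc f g x.2)

lemma isInd_free {J : Type u} (s : ℕ) : IsInd s (free (S := S) fun _ : J => s) := by
  change IsInd s (lin (freeSet _))
  refine isInd_lin (fun m x => ⟨x.2, ⟨x.1, S.idHom s⟩, congrArg (Sigma.mk x.1) (comp_idHom x.2)⟩)
    (fun m f f' y y' h => ?_) (fun m f y y' h => ?_)
  all_goals
    obtain ⟨j, y⟩ := y
    obtain ⟨j', y'⟩ := y'
    obtain ⟨rfl, h⟩ := Sigma.mk.inj h
    replace h := eq_of_heq h
  · obtain ⟨d, hd, y', rfl⟩ := UHom.exists_rep (s := s) y'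
    obtain rfl : d = 0 := by omega
    refine ⟨UHom.comp y (UHom.mk 0 hd y'⁻¹), ?_⟩
    dsimp only at h
    rw [← comp_assoc, h, comp_assoc, UHom.aut_comp_mk, mul_inv_cancel]
    exact (comp_idHom f').symm
  · obtain ⟨o, k, rfl⟩ := exists_orb f
    dsimp only at h
    rw [comp_assoc, comp_assoc] at h
    obtain ⟨d, hd, k, rfl⟩ := k.exists_rep
    obtain rfl : d = 0 := by omega
    have h' := congrArg (UHom.comp (UHom.mk 0 hd k⁻¹)) (orb_inj h).2
    rw [← comp_assoc, ← comp_assoc, UHom.aut_comp_mk, inv_mul_cancel] at h'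
    exact congrArg _ ((idHom_comp y).symm.trans (h'.trans (idHom_comp y')))

/-- A morphism from an induced module is determined in rank s, where N vanishes. Higher degrees
follow by dimension shifting, because the syzygies can be kept induced from the same rank. -/
lemma ExtVan.of_isInd {s : ℕ} {N M : S.UMod} (hN : ∀ a : N.obj ⟨s⟩, a = 0) (hM : IsInd s M)
    (i : ℕ) : ExtVan M N i := by
  have hz (M : S.UMod) (hM : IsInd s M) : ExtVan M N 0 :=
    ExtVan.zero_iff.2 fun φ => umod_hom_ext fun m a => by
      obtain ⟨v, rfl⟩ := (hM m).2 a
      rw [app_indMap]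
      refine .trans ?_ (map_zero (indMap N s m))
      congr 1
      ext o
      exact hN _
  induction i generalizing M with
  | zero => exact hz M hM
  | succ i ih =>
    -- All generators are taken in rank s. This is still a cover because M is spanned by images from
    -- rank s, and its kernel is again induced.
    let π : free (fun _ : M.obj ⟨s⟩ => s) ⟶ M := freeDesc fun a => a
    have hπ : Epi π := (umod_epi_iff π).2 fun m a => by
      obtain ⟨v, rfl⟩ := (hM m).2 a
      refine Finsupp.induction_linear v ⟨0, (map_zero _).trans (map_zero _).symm⟩ ?_ ?_
      · rintro v w ⟨x, hx⟩ ⟨y, hy⟩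
        exact ⟨x + y, by rw [map_add, map_add, hx, hy]⟩
      · intro o a
        exact ⟨freeMk _ a (orb o), (freeDesc_mk _ _ _).trans (indMap_single M o a).symm⟩
    have hT := kernelSequence_shortExact π
    exact ExtVan.right hT (ih (.of_exact hT (isInd_free s) hM))
      (ExtVan.projective (free fun _ : M.obj ⟨s⟩ => s))

/-! ### Decompositions of functors to sets -/

section

variable (X : S.USet) {T : Type u} (τ : ∀ m, X.obj m → T)
  (hτ : ∀ {m n} (f : S.UHom m n) x, τ n (X.map f x) = τ m x)

/-- The part of `X` where the invariant `τ` is `t`. -/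
def USet.fiber (t : T) : S.USet where
  obj m := {x : X.obj m // τ m x = t}
  map f x := ⟨X.map f x.1, (hτ f x.1).trans x.2⟩
  map_id x := Subtype.ext (X.map_id x.1)
  map_comp f g x := Subtype.ext (X.map_comp f g x.1)

/-- The inclusion of a summand. -/
noncomputable def linι (t : T) : lin (X.fiber τ hτ t) ⟶ lin X :=
  linDesc (X := X.fiber τ hτ t) (B := lin X) (fun _ x => linMk (X := X) x.1)
    fun f x => (act_linMk (X := X) f x.1).symm

lemma linι_mk (t : T) {n : ℕ} (x : (X.fiber τ hτ t).obj n) :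
    ((linι X τ hτ t).app ⟨n⟩).hom (linMk x) = linMk (X := X) x.1 :=
  linDesc_mk (X := X.fiber τ hτ t) (B := lin X) (fun _ x => linMk (X := X) x.1) _ x

/-- The linearization of `X` as a coproduct. -/
noncomputable def linCofan : Cofan fun t => lin (X.fiber τ hτ t) := Cofan.mk (lin X) (linι X τ hτ)

lemma linCofan_aux {n : ℕ} {t t' : T} (e : t = t') (x : X.obj n) (h : τ n x = t) {B : S.UMod}
    (i : ∀ t, lin (X.fiber τ hτ t) ⟶ B) : ((i t).app ⟨n⟩).hom
      (linMk (X := X.fiber τ hτ t) ⟨x, h⟩) = ((i t').app ⟨n⟩).hom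
      (linMk (X := X.fiber τ hτ t') ⟨x, h.trans e⟩) := by
  subst e
  rfl

/-- The morphism out of `lin X` given by its restrictions to the summands. -/
noncomputable def linFiberDesc {B : S.UMod} (i : ∀ t, lin (X.fiber τ hτ t) ⟶ B) : lin X ⟶ B :=
  linDesc (fun n x => ((i (τ n x)).app ⟨n⟩).hom (linMk (X := X.fiber τ hτ (τ n x)) ⟨x, rfl⟩))
    fun {m n} f x => by
      refine .trans ?_ (app_act (i (τ m x)) f _)
      refine .trans ?_ (congrArg _ (act_linMk _ _).symm)
      exact linCofan_aux X τ hτ (hτ f x) _ rfl i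

lemma linFiberDesc_mk {B : S.UMod} (i : ∀ t, lin (X.fiber τ hτ t) ⟶ B) (t : T) {n : ℕ}
    (x : (X.fiber τ hτ t).obj n) : ((linFiberDesc X τ hτ i).app ⟨n⟩).hom (linMk x.1) =
      ((i t).app ⟨n⟩).hom (linMk x) :=
  (linDesc_mk _ _ _).trans (linCofan_aux X τ hτ x.2 _ rfl i)

/-- `linCofan` is a coproduct. -/
noncomputable def linCofanIsColimit : IsColimit (linCofan X τ hτ) :=
  Cofan.IsColimit.mk _ (fun c => linFiberDesc X τ hτ c.inj)
    (fun c t => lin_hom_ext fun n x =>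
      (congrArg ((linFiberDesc X τ hτ c.inj).app ⟨n⟩).hom (linι_mk X τ hτ t x)).trans
        (linFiberDesc_mk X τ hτ c.inj t x))
    (fun c m hm => lin_hom_ext fun n x => by
      refine .trans ?_ (linFiberDesc_mk X τ hτ c.inj (τ n x) ⟨x, rfl⟩).symm
      refine (congrArg (m.app ⟨n⟩).hom (linι_mk X τ hτ (τ n x) ⟨x, rfl⟩)).symm.trans ?_
      exact congrArg (fun φ : lin (X.fiber τ hτ (τ n x)) ⟶ c.pt => (φ.app ⟨n⟩).hom
        (linMk (X := X.fiber τ hτ (τ n x)) ⟨x, rfl⟩)) (hm (τ n x)))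

lemma ExtVan.lin_of_fiber {N : S.UMod} {i : ℕ}
    (h : ∀ t, ExtVan (lin (X.fiber τ hτ t)) N i) : ExtVan (lin X) N i :=
  ExtVan.of_iso ((coproductIsCoproduct _).coconePointUniqueUpToIso (linCofanIsColimit X τ hτ))
    (ExtVan.sigma h)

end

/-! ### The functors to sets given by the complexes of cosets of Young subgroups -/

section

variable {n p : ℕ}

/-- Add `c` to the first entry. -/
def addHeadList {m m' c : ℕ} (h : c + m = m')
    (l : {l : List ℕ // l.length = p + 2 ∧ TailLT n m l}) :
    {l : List ℕ // l.length = p + 2 ∧ TailLT n m' l} :=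
  ⟨addHead c l.1, (length_addHead c l.1).trans l.2.1, by
    rw [TailLT, tail_addHead, sum_addHead c (by rintro h; simpa [h] using l.2.1)]
    exact ⟨l.2.2.1, l.2.2.2.1, by rw [l.2.2.2.2, h]⟩⟩

/-- A block in front is absorbed into the first factor of the Young subgroup, by associativity of ⊕.
-/
lemma blk_mem_young_addHead {m m' c : ℕ} (h : c + m = m') {l : List ℕ} (hl : l ≠ [])
    (hs : l.sum = m) (hs' : (addHead c l).sum = m') (k : S.G c) {x : S.G m}
    (hx : x ∈ S.young l hs) : S.blk h (k, x) ∈ S.young (addHead c l) hs' := by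
  cases l with
  | nil => exact absurd rfl hl
  | cons a t =>
    obtain ⟨y, z, hz, rfl⟩ := (mem_young_cons rfl hs hs).1 hx
    refine (mem_young_cons (S := S.toStabilityGroupoid) rfl hs' hs').2 ⟨S.blk rfl (k, y), z, hz, ?_⟩
    exact S.blk_assoc _ _ _ _ _ _ _

lemma blk_mem_young_addHeadList {m m' c : ℕ} (h : c + m = m')
    (l : {l : List ℕ // l.length = p + 2 ∧ TailLT n m l}) (k : S.G c) {x : S.G m}
    (hx : x ∈ S.young l.1 l.2.2.2.2) :
    S.blk h (k, x) ∈ S.young (addHeadList h l).1 (addHeadList h l).2.2.2.2 :=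
  blk_mem_young_addHead h (by intro h; simpa [h] using l.2.1) _ _ k hx

/-- The map induced by a morphism of `U𝒢`. -/
def tailMap {m m' : ℕ} (f : S.UHom m m')
    (x : S.ListSimplex (TailLT n m) TailLT.sum_eq p) :
    S.ListSimplex (TailLT n m') TailLT.sum_eq p :=
  Quotient.liftOn f
    (fun f => ⟨addHeadList f.h x.1, Quotient.map' (s₁ := QuotientGroup.leftRel _)
      (s₂ := QuotientGroup.leftRel _) (fun g => f.f * S.blk f.h (1, g)) (by
        intro g g' hg
        rw [QuotientGroup.leftRel_apply] at hg ⊢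
        have := blk_mem_young_addHeadList f.h x.1 1 hg
        rw [S.blk_mul_right, S.blk_inv_right] at this
        rw [mul_inv_rev]
        simpa [mul_assoc] using this) x.2⟩)
    (by
      rintro ⟨c, h, f⟩ ⟨c', h', f'⟩ ⟨k, hk⟩
      obtain rfl : c = c' := by omega
      dsimp only at hk
      subst hk
      induction x using listMk_ind with
      | h l g =>
        refine listMk_eq (hR := TailLT.sum_eq) (l := addHeadList h l) (l' := addHeadList h l) rfl
          (f' * S.blk h (k, 1) * S.blk h (1, g)) (f' * S.blk h (1, g)) ?_
        have := blk_mem_young_addHeadList h l k⁻¹ (one_mem _)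
        rw [S.blk_inv_left] at this
        rw [mul_inv_rev, mul_inv_rev, mul_assoc, mul_assoc, inv_mul_cancel_left]
        rw [← S.blk_inv_left, ← S.blk_inv_right, S.blk_mul, S.blk_mul]
        rw [← S.blk_inv_left] at this
        simpa using this)

lemma tailMap_mk {m m' c : ℕ} (h : c + m = m') (f : S.G m')
    (l : {l : List ℕ // l.length = p + 2 ∧ TailLT n m l}) (g : S.G m) :
    tailMap (UHom.mk c h f) (listMk TailLT.sum_eq l g) =
      listMk TailLT.sum_eq (addHeadList h l) (f * S.blk h (1, g)) := rfl

lemma listMk_congr' {m : ℕ} {R : List ℕ → Prop} {hR : ∀ l, R l → l.sum = m}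
    {l l' : {l : List ℕ // l.length = p + 2 ∧ R l}} (e : l.1 = l'.1) {g g' : S.G m} (h : g = g') :
    (listMk hR l g : S.ListSimplex R hR p) = listMk hR l' g' := by
  subst h
  exact listMk_congr e g

variable (S n p) in
/-- The functor `m ↦ (tailComplex n m)_p`. -/
def tailSet : S.USet where
  obj m := S.ListSimplex (m := m) (TailLT n m) TailLT.sum_eq p
  map := tailMap
  map_id := listMk_ind fun l g => (tailMap_mk _ _ _ _).trans
    (listMk_congr' (addHead_zero _) (by rw [one_mul, S.one_blk]))
  map_comp f g := listMk_ind fun l x => by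
    obtain ⟨c, h, f, rfl⟩ := f.exists_rep
    obtain ⟨d, h', g, rfl⟩ := g.exists_rep
    rw [UHom.comp_mk, tailMap_mk, tailMap_mk, tailMap_mk]
    refine listMk_congr' (addHead_addHead c d l.1).symm ?_
    rw [mul_assoc, S.blk_mul_right, S.one_blk_one_blk rfl]

lemma face_tailMap {m m' : ℕ} (f : S.UHom m m') (i : Fin (p + 2))
    (x : S.ListSimplex (TailLT n m) TailLT.sum_eq (p + 1)) :
    (S.tailComplex n m').face p i (tailMap f x) =
      tailMap f ((S.tailComplex n m).face p i x) := by
  obtain ⟨c, h, f, rfl⟩ := f.exists_rep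
  induction x using listMk_ind with
  | h l g =>
    refine listMk_congr (hR := TailLT.sum_eq) (l := mergeList TailLT.mergeAt i (addHeadList h l))
      (l' := addHeadList h (mergeList TailLT.mergeAt i l)) (mergeAt_addHead c i l.1) _

lemma listMk_inj {m : ℕ} {R : List ℕ → Prop} {hR : ∀ l, R l → l.sum = m}
    {l l' : {l : List ℕ // l.length = p + 2 ∧ R l}} {g g' : S.G m}
    (h : (listMk hR l g : S.ListSimplex R hR p) = listMk hR l' g') :
    g⁻¹ * g' ∈ S.young l.1 (hR l.1 l.2.2) := by
  obtain ⟨rfl, h⟩ := Sigma.mk.inj h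
  exact QuotientGroup.eq.1 (eq_of_heq h)

/-- The list `0 :: t`. -/
def zeroTail {t : List ℕ} (ht : t.sum < n ∧ (∀ a ∈ t, 0 < a) ∧ t.length = p + 1) :
    {l : List ℕ // l.length = p + 2 ∧ TailLT n t.sum l} :=
  ⟨0 :: t, by rw [List.length_cons, ht.2.2], ht.2.1, ht.1, by simp⟩

lemma exists_zeroTail {t : List ℕ} (ht : t.sum < n ∧ (∀ a ∈ t, 0 < a) ∧ t.length = p + 1)
    (x : S.ListSimplex (TailLT n t.sum) TailLT.sum_eq p) (hx : x.1.1.tail = t) :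
    ∃ g, x = listMk TailLT.sum_eq (zeroTail ht) g := by
  induction x using listMk_ind with
  | h l g =>
    refine ⟨g, listMk_congr ?_ g⟩
    obtain ⟨l, h, h'⟩ := l
    cases l with
    | nil => simp at h
    | cons a t' =>
      obtain rfl : t' = t := hx
      have := h'.2.2
      rw [List.sum_cons] at this
      obtain rfl : a = 0 := by omega
      rfl

lemma eq_of_tailMap_eq {t : List ℕ} (ht : t.sum < n ∧ (∀ a ∈ t, 0 < a) ∧ t.length = p + 1)
    {c m : ℕ} (h : c + t.sum = m) (f f' : S.G m) (g g' : S.G t.sum)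
    (e : tailMap (UHom.mk c h f) (listMk TailLT.sum_eq (zeroTail ht) g) =
      tailMap (UHom.mk c h f') (listMk TailLT.sum_eq (zeroTail ht) g')) :
    ∃ x : S.G c, ∃ z ∈ S.young t rfl, f' * S.blk h (1, g') = f * S.blk h (x, g * z) := by
  obtain ⟨x, z, hz, e'⟩ := (mem_young_cons (S := S.toStabilityGroupoid) (a := c) (t := t) rfl
    (by rw [List.sum_cons, h]) h).1 (listMk_inj e)
  refine ⟨x, z, hz, ?_⟩
  have h₁ : S.blk h (x, g * z) = S.blk h (1, g) * S.blk h (x, z) := by rw [S.blk_mul, one_mul]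
  rw [h₁, e', ← mul_assoc, mul_inv_cancel_left]

/-- Morphisms of `U𝒢` only enlarge the first entry of a tuple, so the module splits according to the
tail t. The summand of t is induced from rank |t| < n, from the cosets of the tuple (0, t). -/
lemma ExtVan.lin_tailSet {N : S.UMod} (hN : ∀ m < n, ∀ a : N.obj ⟨m⟩, a = 0) (i : ℕ) :
    ExtVan (lin (S.tailSet n p)) N i := by
  have hτ {m m' : ℕ} (f : S.UHom m m') (x : (S.tailSet n p).obj m) :
      (ULift.up.{u} ((S.tailSet n p).map f x).1.1.tail) = ULift.up.{u} x.1.1.tail := by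
    obtain ⟨c, h, f, rfl⟩ := f.exists_rep
    exact congrArg _ (tail_addHead c x.1.1)
  -- The tails are lifted to the universe of the groups, where the coproduct is indexed.
  refine ExtVan.lin_of_fiber (S.tailSet n p) (fun m x => ULift.up.{u} x.1.1.tail) hτ fun ⟨t⟩ => ?_
  by_cases ht : t.sum < n ∧ (∀ a ∈ t, 0 < a) ∧ t.length = p + 1
  swap
  · refine ExtVan.of_isZero (Functor.isZero _ fun X => ?_)
    refine (isZero_obj_iff (n := X.rank)).2 fun a => ?_
    refine LinearMap.congr_fun (f := LinearMap.id) (g := 0) (lin_linear_ext fun x => ?_) a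
    refine absurd ?_ ht
    obtain ⟨x, h⟩ := x
    obtain rfl : x.1.1.tail = t := congrArg ULift.down h
    exact ⟨x.1.2.2.2.1, x.1.2.2.1, by rw [List.length_tail, x.1.2.1]; rfl⟩
  -- The three goals are: every coset arises from the trivial coset of (0, t); equal images force
  -- the morphisms into one orbit of Aut(|t|); and each morphism acts injectively.
  refine ExtVan.of_isInd (s := t.sum) (hN _ ht.1) (isInd_lin ?_ ?_ ?_) i
  · rintro m ⟨x, hx⟩
    obtain ⟨g₀, h₀⟩ : ∃ (c : ℕ) (h : c + t.sum = m) (g : S.G m),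
        tailMap (UHom.mk c h g) (listMk TailLT.sum_eq (zeroTail ht) 1) = x := by
      replace hx : x.1.1.tail = t := congrArg ULift.down hx
      induction x using listMk_ind with
      | h l g =>
        obtain ⟨l, h, h'⟩ := l
        cases l with
        | nil => simp at h
        | cons a t' =>
          obtain rfl : t' = t := hx
          refine ⟨a, List.sum_cons.symm.trans h'.2.2, g, ?_⟩
          rw [tailMap_mk]
          exact listMk_congr' rfl (by rw [S.blk_one_one, mul_one])
    obtain ⟨h, g, rfl⟩ := h₀
    exact ⟨UHom.mk g₀ h g, ⟨listMk TailLT.sum_eq (zeroTail ht) 1, rfl⟩, rfl⟩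
  · rintro m f f' ⟨y, hy⟩ ⟨y', hy'⟩ e
    obtain ⟨g, rfl⟩ := exists_zeroTail ht y (congrArg ULift.down hy)
    obtain ⟨g', rfl⟩ := exists_zeroTail ht y' (congrArg ULift.down hy')
    obtain ⟨c, h, f, rfl⟩ := f.exists_rep
    obtain ⟨c', h', f', rfl⟩ := f'.exists_rep
    obtain rfl : c' = c := by omega
    obtain ⟨x, z, -, e'⟩ := eq_of_tailMap_eq ht h f f' g g' (congrArg Subtype.val e)
    refine ⟨UHom.mk 0 (Nat.zero_add _) (g * z * g'⁻¹), ?_⟩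
    rw [UHom.comp_mk]
    refine UHom.mk_eq (c' := c' + 0) _ (by omega) _ _ x ?_
    have h₁ : S.blk h (x, g * z * g'⁻¹) = S.blk h (x, g * z) * (S.blk h (1, g'))⁻¹ := by
      rw [← S.blk_inv_right, S.blk_mul, mul_one]
    rw [mul_assoc, S.blk_mul, one_mul, mul_one, h₁, ← mul_assoc, ← e', mul_inv_cancel_right]
  · rintro m f ⟨y, hy⟩ ⟨y', hy'⟩ e
    obtain ⟨g, rfl⟩ := exists_zeroTail ht y (congrArg ULift.down hy)
    obtain ⟨g', rfl⟩ := exists_zeroTail ht y' (congrArg ULift.down hy')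
    obtain ⟨c, h, f, rfl⟩ := f.exists_rep
    obtain ⟨x, z, hz, e'⟩ := eq_of_tailMap_eq ht h f f g g' (congrArg Subtype.val e)
    have := (Prod.mk.inj (S.blk_injective h (mul_left_cancel e'))).2
    refine Subtype.ext (listMk_eq (hR := TailLT.sum_eq) rfl g g' ?_)
    rw [this, inv_mul_cancel_left]
    exact young_le_zero_cons _ _ hz

end

/-! ### Covers by free modules -/

section

variable (P : ℕ → Prop) (M : S.UMod)

/-- The elements of `M` in ranks satisfying `P`. -/
abbrev Gens : Type u := {x : Σ m, M.obj ⟨m⟩ // P x.1}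

/-- The free module on the elements of `M` in ranks satisfying `P`. -/
noncomputable abbrev cover : S.UMod := free fun x : Gens P M => x.1.1

/-- The canonical morphism from the free module on elements of `M`. -/
noncomputable def coverDesc : cover P M ⟶ M := freeDesc fun x => x.1.2

variable {P M}

lemma coverDesc_mk {m n : ℕ} (hm : P m) (a : M.obj ⟨m⟩) (f : S.UHom m n) :
    ((coverDesc P M).app ⟨n⟩).hom (freeMk (fun x : Gens P M => x.1.1) ⟨⟨m, a⟩, hm⟩ f) = act M f a :=
  freeDesc_mk (s := fun x : Gens P M => x.1.1) (fun x : Gens P M => x.1.2) ⟨⟨m, a⟩, hm⟩ f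

lemma coverDesc_surjective {n : ℕ} (hn : P n) :
    Function.Surjective ((coverDesc P M).app ⟨n⟩).hom := fun a =>
  ⟨_, (coverDesc_mk hn a (S.idHom n)).trans (act_idHom M a)⟩

end

/-- `N` is supported in rank `n`. -/
def SuppAt (n : ℕ) (N : S.UMod) : Prop := ∀ m, m ≠ n → ∀ a : N.obj ⟨m⟩, a = 0

lemma ExtVan.free_of_ne {J : Type u} {s : J → ℕ} {n : ℕ} {N : S.UMod} (hN : SuppAt n N)
    (hs : ∀ j, s j ≠ n) (i : ℕ) : ExtVan (free s) N i := by
  cases i with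
  | zero => exact ExtVan.zero_iff.2 fun f => free_hom_ext fun j => hN _ (hs j) _
  | succ i => exact ExtVan.projective (free s)

/-- Such a module is covered by a free module generated in ranks > n, which has no Ext into N. The
kernel again vanishes in ranks ≤ n. -/
lemma ExtVan.of_eq_zero {n : ℕ} {N M : S.UMod} (hN : SuppAt n N)
    (hM : ∀ m ≤ n, ∀ a : M.obj ⟨m⟩, a = 0) (i : ℕ) : ExtVan M N i := by
  induction i generalizing M with
  | zero =>
    refine ExtVan.zero_iff.2 fun f => umod_hom_ext fun m a => ?_
    by_cases hm : m ≤ n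
    · rw [hM m hm a, map_zero, map_zero]
    · exact hN m (by omega) _
  | succ i ih =>
    have hπ : Epi (coverDesc (n < ·) M) := (umod_epi_iff _).2 fun m => by
      by_cases hm : n < m
      · exact coverDesc_surjective hm
      · exact fun a => ⟨0, (map_zero _).trans (hM m (by omega) a).symm⟩
    have hT := kernelSequence_shortExact (coverDesc (n < ·) M)
    refine ExtVan.right hT (ih fun m hm a => ((umod_shortExact_iff _).1 hT m).1 ?_)
      (free_of_ne hN (fun j => j.2.ne') _)
    exact (free_eq_zero (fun j => lt_of_le_of_lt hm j.2) _).trans (map_zero _).symm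

lemma cokernel_eq_zero {X B : S.UMod} (f : X ⟶ B) {m : ℕ}
    (hf : Function.Surjective (f.app ⟨m⟩).hom) (a : (cokernel f).obj ⟨m⟩) : a = 0 := by
  obtain ⟨b, rfl⟩ := (umod_epi_iff (cokernel.π f)).1 inferInstance m a
  obtain ⟨x, rfl⟩ := hf b
  exact congrArg (fun φ : X ⟶ cokernel f => (φ.app ⟨m⟩).hom x) (cokernel.condition f)

section

variable {n : ℕ} {N X B : S.UMod} (hN : SuppAt n N) {f : X ⟶ B}
  (hf : ∀ m ≤ n, Function.Surjective (f.app ⟨m⟩).hom)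

include hN hf

/-- The cokernel of f lives in ranks > n and is invisible to N, so f may be treated as an
epimorphism here and in the next lemma. -/
lemma ExtVan.zero_of_surjective (h : ExtVan X N 0) : ExtVan B N 0 :=
  ExtVan.mid (imageSequence_shortExact f) (ExtVan.right_zero (coimageSequence_shortExact f) h)
    (of_eq_zero hN (fun m hm => cokernel_eq_zero f (hf m hm)) 0)

lemma ExtVan.succ_of_surjective {i : ℕ} (h : ExtVan X N (i + 1)) (h' : ExtVan (kernel f) N i) :
    ExtVan B N (i + 1) :=
  ExtVan.mid (imageSequence_shortExact f) (ExtVan.right (coimageSequence_shortExact f) h' h)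
    (of_eq_zero hN (fun m hm => cokernel_eq_zero f (hf m hm)) _)

end

lemma exists_kernel {A B : S.UMod} {f : A ⟶ B} {m : ℕ} {a : A.obj ⟨m⟩}
    (h : (f.app ⟨m⟩).hom a = 0) : ∃ b, ((kernel.ι f).app ⟨m⟩).hom b = a :=
  ((umod_shortExact_iff _).1 (coimageSequence_shortExact f) m).2.1 a |>.1 (by
    apply (umod_mono_iff (Abelian.image.ι f)).1 inferInstance m
    refine (congrArg (fun φ : A ⟶ B => (φ.app ⟨m⟩).hom a) (Abelian.image.fac f)).trans ?_
    exact h.trans (map_zero _).symm)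

lemma kernel_ι_injective {A B : S.UMod} (f : A ⟶ B) (m : ℕ) :
    Function.Injective ((kernel.ι f).app ⟨m⟩).hom := (umod_mono_iff _).1 inferInstance m

/-- Dimension shifting along a complex that is exact in ranks `≤ n`. -/
lemma ExtVan.of_resolution {n : ℕ} {N : S.UMod} (hN : SuppAt n N) (j : ℕ) {B : S.UMod}
    {Y : ℕ → S.UMod} (hY : ∀ q i, ExtVan (Y q) N i) (ε : Y 0 ⟶ B) (d : ∀ q, Y (q + 1) ⟶ Y q)
    (hdε : d 0 ≫ ε = 0) (hdd : ∀ q, d (q + 1) ≫ d q = 0)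
    (hε : ∀ m ≤ n, Function.Surjective (ε.app ⟨m⟩).hom)
    (h₀ : 0 < j → ∀ m ≤ n, ∀ y : (Y 0).obj ⟨m⟩, (ε.app ⟨m⟩).hom y = 0 →
      ∃ z, ((d 0).app ⟨m⟩).hom z = y)
    (h₁ : ∀ q, q + 1 < j → ∀ m ≤ n, ∀ y : (Y (q + 1)).obj ⟨m⟩, ((d q).app ⟨m⟩).hom y = 0 →
      ∃ z, ((d (q + 1)).app ⟨m⟩).hom z = y) : ExtVan B N j := by
  induction j generalizing B Y with
  | zero => exact zero_of_surjective hN hε (hY 0 0)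
  | succ j ih =>
    -- The kernel of the augmentation takes the place of B, resolved by the same complex with its
    -- first term removed.
    refine succ_of_surjective hN hε (hY 0 _) ?_
    have hl := kernel.lift_ι ε (d 0) hdε
    have hl' {m : ℕ} (z : (Y 1).obj ⟨m⟩) : ((kernel.ι ε).app ⟨m⟩).hom
        (((kernel.lift ε (d 0) hdε).app ⟨m⟩).hom z) = ((d 0).app ⟨m⟩).hom z :=
      congrArg (fun φ : Y 1 ⟶ Y 0 => (φ.app ⟨m⟩).hom z) hl
    refine ih (Y := fun q => Y (q + 1)) (fun q => hY _) (kernel.lift ε (d 0) hdε)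
      (fun q => d (q + 1)) ?_ (fun q => hdd _) ?_ ?_ ?_
    · rw [← cancel_mono (kernel.ι ε), Category.assoc, hl, hdd, zero_comp]
    · intro m hm y
      have hy : (ε.app ⟨m⟩).hom (((kernel.ι ε).app ⟨m⟩).hom y) = 0 :=
        congrArg (fun φ : kernel ε ⟶ B => (φ.app ⟨m⟩).hom y) (kernel.condition ε)
      obtain ⟨z, hz⟩ := h₀ (Nat.succ_pos j) m hm _ hy
      exact ⟨z, kernel_ι_injective ε m ((hl' z).trans hz)⟩
    · intro hj m hm y hy
      refine h₁ 0 (by omega) m hm y ?_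
      rw [← hl', hy, map_zero]
    · intro q hq m hm y hy
      exact h₁ (q + 1) (by omega) m hm y hy

/-! ### The unit -/

lemma unitMod_eq_zero {n : ℕ} (hn : n ≠ 0) (a : S.unitMod.obj ⟨n⟩) : a = 0 := by
  obtain ⟨a, rfl⟩ := Submodule.Quotient.mk_surjective (augIdeal.{u} n) a
  refine (Submodule.Quotient.mk_eq_zero _).2 ?_
  rw [augIdeal, if_neg hn]
  trivial

/-- The generator of `unitMod` in rank `n`. -/
noncomputable def unitGen (S : BraidedStabilityGroupoid.{u}) (n : ℕ) : S.unitMod.obj ⟨n⟩ :=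
  (Submodule.Quotient.mk ⟨1⟩ : ULift.{u} ℤ ⧸ augIdeal.{u} n)

lemma act_unitGen {m n : ℕ} (f : S.UHom m n) : act S.unitMod f (unitGen S m) = unitGen S n := rfl

lemma zsmul_unitGen (n : ℕ) (k : ℤ) :
    k • unitGen S n = (Submodule.Quotient.mk ⟨k⟩ : ULift.{u} ℤ ⧸ augIdeal.{u} n) := by
  refine (Submodule.Quotient.mk_smul (augIdeal.{u} n) k ⟨1⟩).symm.trans ?_
  congr 1
  exact ULift.ext _ _ (mul_one k)

lemma exists_zsmul_unitGen {n : ℕ} (a : S.unitMod.obj ⟨n⟩) : ∃ k : ℤ, a = k • unitGen S n := by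
  obtain ⟨⟨k⟩, rfl⟩ := Submodule.Quotient.mk_surjective (augIdeal.{u} n) a
  exact ⟨k, (zsmul_unitGen n k).symm⟩

lemma zsmul_unitGen_zero {k : ℤ} (h : k • unitGen S 0 = 0) : k = 0 := by
  rw [zsmul_unitGen] at h
  have := (Submodule.Quotient.mk_eq_zero _).1 h
  rw [augIdeal, if_pos rfl] at this
  exact congrArg ULift.down ((Submodule.mem_bot ℤ).1 this)

/-- The one point functor. -/
def ptSet (S : BraidedStabilityGroupoid.{u}) : S.USet where
  obj _ := PUnit
  map _ _ := PUnit.unit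
  map_id _ := rfl
  map_comp _ _ _ := rfl

lemma eq_ini {m : ℕ} (f : S.UHom 0 m) : f = UHom.mk m (Nat.add_zero m) 1 :=
  (comp_idHom f).symm.trans (S.comp_ini f)

/-- Since 0 is initial, the constant module is induced from rank 0. -/
lemma ExtVan.lin_ptSet {N : S.UMod} (hN : ∀ a : N.obj ⟨0⟩, a = 0) (i : ℕ) :
    ExtVan (lin S.ptSet) N i :=
  of_isInd hN (isInd_lin (fun m _ => ⟨UHom.mk m (Nat.add_zero m) 1, PUnit.unit, rfl⟩)
    (fun m f f' _ _ _ => ⟨S.idHom 0, by rw [eq_ini f', eq_ini (UHom.comp f _)]⟩)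
    fun _ _ _ _ _ => rfl) i

/-- The morphism from the constant module to the unit. -/
noncomputable def ptDesc (S : BraidedStabilityGroupoid.{u}) : lin S.ptSet ⟶ S.unitMod :=
  linDesc (B := S.unitMod) (fun n _ => unitGen S n) fun f _ => (act_unitGen f).symm

lemma ptDesc_single {n : ℕ} (a : PUnit.{u + 1} →₀ ℤ) :
    ((ptDesc S).app ⟨n⟩).hom a = a PUnit.unit • unitGen S n := by
  refine LinearMap.congr_fun (f := ((ptDesc S).app ⟨n⟩).hom)
    (g := intLinear (fun a : PUnit.{u + 1} →₀ ℤ => a PUnit.unit • unitGen S n)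
      fun a b => (congrArg (· • unitGen S n) (Finsupp.add_apply a b _)).trans (add_smul _ _ _)) (lin_linear_ext fun x => ?_) a
  refine (linDesc_mk _ _ x).trans ?_
  exact ((congrArg (· • unitGen S n) (Finsupp.single_eq_same (a := PUnit.unit) (b := (1 : ℤ)))).trans
    (one_smul ℤ _)).symm

lemma ptDesc_surjective (n : ℕ) : Function.Surjective ((ptDesc S).app ⟨n⟩).hom := fun a => by
  obtain ⟨k, rfl⟩ := exists_zsmul_unitGen a
  exact ⟨Finsupp.single PUnit.unit k, (ptDesc_single _).trans
    (congrArg (· • unitGen S n) Finsupp.single_eq_same)⟩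

lemma ptDesc_zero {a : PUnit.{u + 1} →₀ ℤ} (h : ((ptDesc S).app ⟨0⟩).hom a = 0) : a = 0 := by
  rw [ptDesc_single] at h
  exact Finsupp.ext fun _ => zsmul_unitGen_zero h

/-! ### The unit is 0-regular -/

section

variable (n : ℕ)

/-- The boundary maps of the complexes `tailComplex n m`. -/
noncomputable def tailBoundary (p : ℕ) : lin (S.tailSet n (p + 1)) ⟶ lin (S.tailSet n p) :=
  umodHom (A := lin (S.tailSet n (p + 1))) (B := lin (S.tailSet n p))
    (fun m => intLinear ((S.tailComplex n m).boundary p) (map_add _)) fun {m m'} f a => by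
    refine LinearMap.congr_fun
      (f := intLinear ((S.tailComplex n m').boundary p) (map_add _) ∘ₗ act (lin (S.tailSet n (p + 1))) f)
      (g := act (lin (S.tailSet n p)) f ∘ₗ intLinear ((S.tailComplex n m).boundary p) (map_add _))
      (lin_linear_ext fun x => ?_) a
    refine (congrArg ((S.tailComplex n m').boundary p) (act_linMk f x)).trans ?_
    refine ((S.tailComplex n m').boundary_single p _).trans ?_
    refine .trans ?_ (congrArg (act (lin (S.tailSet n p)) f)
      ((S.tailComplex n m).boundary_single p x)).symm
    refine .trans ?_ (map_sum (act (lin (S.tailSet n p)) f) _ _).symm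
    refine Finset.sum_congr rfl fun i _ => ?_
    refine .trans ?_ (map_zsmul (act (lin (S.tailSet n p)) f) _ _).symm
    refine congrArg (((-1 : ℤ) ^ (i : ℕ)) • ·) ?_
    refine .trans ?_ (act_linMk (X := S.tailSet n p) f _).symm
    exact congrArg (fun y => Finsupp.single y (1 : ℤ)) (face_tailMap f i x)

/-- The augmentations of the complexes `tailComplex n m`. -/
noncomputable def tailAugmentation : lin (S.tailSet n 0) ⟶ lin S.ptSet :=
  linDesc (B := lin S.ptSet) (fun _ _ => linMk (X := S.ptSet) PUnit.unit)
    fun f _ => (act_linMk (X := S.ptSet) f _).symm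

lemma tailAugmentation_app {m : ℕ} (a : (S.tailComplex n m).obj 0 →₀ ℤ) :
    ((tailAugmentation (S := S) n).app ⟨m⟩).hom a = (S.tailComplex n m).augmentation a := by
  refine LinearMap.congr_fun (f := ((tailAugmentation (S := S) n).app ⟨m⟩).hom)
    (g := intLinear (V := (lin (S.tailSet n 0)).obj ⟨m⟩) (W := (lin S.ptSet).obj ⟨m⟩)
      (S.tailComplex n m).augmentation (map_add _)) (lin_linear_ext fun x => ?_) a
  exact (linDesc_mk _ _ x).trans ((S.tailComplex n m).augmentation_single x).symm

variable (S) in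
/-- The terms of the resolution of the unit. -/
noncomputable def tailTerm : ℕ → S.UMod
  | 0 => lin S.ptSet
  | p + 1 => lin (S.tailSet n p)

variable (S) in
/-- The differentials of the resolution of the unit. -/
noncomputable def tailD : ∀ p, tailTerm S n (p + 1) ⟶ tailTerm S n p
  | 0 => tailAugmentation n
  | p + 1 => tailBoundary n p

lemma tailComplex_zero_eq_zero {p : ℕ} (a : (S.tailComplex n 0).obj p →₀ ℤ) : a = 0 := by
  have : IsEmpty ((S.tailComplex n 0).obj p) := ⟨fun x => by
    obtain ⟨⟨l, h, h'⟩, -⟩ := x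
    match l, h with
    | a :: b :: t, _ =>
      have h₁ := h'.2.2
      have h₂ := h'.1 b (by simp)
      simp only [List.sum_cons] at h₁
      omega⟩
  exact Subsingleton.elim _ _

/-- `Ext^j(unit, N) = 0` for `j < n` and `N` supported in rank `n`. -/
theorem ExtVan.unit (hS : S.StandardConnectivity) {N : S.UMod} (hN : SuppAt n N) {j : ℕ}
    (hj : j < n) : ExtVan S.unitMod N j := by
  have hc {m : ℕ} (h₀ : m ≠ 0) (hm : m < n) : (S.tailComplex n m).Contraction :=
    S.tailContraction (Nat.pos_of_ne_zero h₀) hm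
  -- Index k stands for homological degree k - 1 ≤ j - 2 ≤ n - 3, which is exactly the assumed
  -- range.
  have hred {k : ℕ} (hk : k < j) : IsZero ((S.tailComplex n n).reducedHomology k) := by
    rw [S.tailComplex_self (by omega)]
    exact hS n k (by omega)
  refine of_resolution hN j (Y := tailTerm S n) ?_ (ptDesc S) (tailD S n) ?_ ?_
    (fun m _ => ptDesc_surjective m) ?_ ?_
  · rintro (_ | q) i
    · exact lin_ptSet (hN 0 (by omega)) i
    · exact lin_tailSet (fun m hm => hN m hm.ne) i
  · refine umod_hom_ext fun m a => ?_
    -- In rank 0 the source is zero, as a list of length at least 2 with positive tail has positive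
    -- sum. In all other ranks the unit is zero.
    by_cases hm : m = 0
    · subst hm
      have : a = 0 := tailComplex_zero_eq_zero n a
      rw [this, map_zero, map_zero]
    · exact unitMod_eq_zero hm _
  · rintro (_ | q)
    · refine umod_hom_ext fun m a => (tailAugmentation_app n _).trans ?_
      exact LinearMap.congr_fun (S.tailComplex n m).augmentation_boundary a
    · refine umod_hom_ext fun m a => ?_
      exact LinearMap.congr_fun ((S.tailComplex n m).boundary_boundary q) a
  · intro h0 m hm y hy
    -- In rank 0 the constant module already equals the unit. In the other ranks exactness comes
    -- from the contraction if m < n and from connectivity if m = n.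
    by_cases h : m = 0
    · subst h
      exact ⟨0, (map_zero _).trans (ptDesc_zero hy).symm⟩
    · obtain ⟨z, hz⟩ : ∃ z, (S.tailComplex n m).augmentation z = y := by
        by_cases hmn : m = n
        · subst hmn
          exact (S.tailComplex m m).surjective_augmentation (hred h0) y
        · exact (hc h (by omega)).surjective_augmentation y
      exact ⟨z, (tailAugmentation_app n z).trans hz⟩
  · rintro (_ | q) hq m hm y hy
    · by_cases h : m = 0
      · subst h
        exact ⟨0, (map_zero _).trans (tailComplex_zero_eq_zero n y).symm⟩
      · replace hy := (tailAugmentation_app n y).symm.trans hy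
        by_cases hmn : m = n
        · subst hmn
          exact (S.tailComplex m m).exists_boundary_zero (hred hq) y hy
        · exact ⟨_, (hc h (by omega)).boundary_homotopy_zero y hy⟩
    · by_cases h : m = 0
      · subst h
        exact ⟨0, (map_zero _).trans (tailComplex_zero_eq_zero n y).symm⟩
      · by_cases hmn : m = n
        · subst hmn
          exact (S.tailComplex m m).exists_boundary_succ (hred hq) y hy
        · exact (hc h (by omega)).exists_boundary y hy

end

/-! ### Regularity -/

/-- `Ext^j(A, N) = 0` for all `N` supported in a rank `n > j + c`. -/
def Reg (c : ℤ) (A : S.UMod) : Prop :=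
  ∀ j n : ℕ, (j : ℤ) + c < n → ∀ N : S.UMod, SuppAt n N → ExtVan A N j

lemma Reg.of_iso {c : ℤ} {A B : S.UMod} (e : A ≅ B) (h : Reg c A) : Reg c B :=
  fun j n hj N hN => ExtVan.of_iso e (h j n hj N hN)

lemma Reg.mono {c c' : ℤ} {A : S.UMod} (hc : c ≤ c') (h : Reg c A) : Reg c' A :=
  fun j n hj N hN => h j n (by omega) N hN

lemma Reg.mid {c : ℤ} {T : ShortComplex S.UMod} (hT : T.ShortExact) (h₁ : Reg c T.X₁)
    (h₃ : Reg c T.X₃) : Reg c T.X₂ :=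
  fun j n hj N hN => ExtVan.mid hT (h₁ j n hj N hN) (h₃ j n hj N hN)

lemma SuppAt.shift {n s : ℕ} {N : S.UMod} (hN : SuppAt n N) (h : s ≤ n) :
    SuppAt (n - s) ((S.shiftF s).obj N) := fun m hm => hN (m + s) (by omega)

/-- The product with a free module is a coproduct of the - ⊛ F_s, and each is treated by its
adjunction with Σ^s. -/
lemma ExtVan.day_free {J : Type u} {s : J → ℕ} {A N : S.UMod} {i : ℕ}
    (h : ∀ j, ExtVan A ((S.shiftF (s j)).obj N) i) : ExtVan (day A (free s)) N i :=
  ExtVan.of_iso (dayFreeIso s A) (ExtVan.sigma fun j => ExtVan.adjunction (dayAdjunction S (s j))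
    (h j))

lemma dayGen_eq {J : Type u} {s : J → ℕ} {A : S.UMod} {p n : ℕ} (a : A.obj ⟨p⟩) (j : J)
    (w : S.UHom (p + s j) n) : (dayGen s a j w : DayObj A (free s) n) =
      dayGen s (act A (compl w) a) j (hat (sec w)) := by
  rw [dayGen, dayGen, dayMk_act_left, hat_compl]

lemma dayMk_zero_left {A M : S.UMod} {n p q : ℕ} (b : M.obj ⟨q⟩) (w : S.UHom (p + q) n) :
    (dayMk (0 : A.obj ⟨p⟩) b w : DayObj A M n) = 0 := by
  have h := dayMk_add_left (0 : A.obj ⟨p⟩) 0 b w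
  rwa [add_zero, left_eq_add] at h

/-- In rank m this product is generated by elements of the unit in rank m - d, which vanish unless m
= d. -/
lemma day_unitMod_free_eq_zero {J : Type u} {d m : ℕ} (hm : m ≠ d)
    (x : (day S.unitMod (free fun _ : J => d)).obj ⟨m⟩) : x = 0 := by
  refine LinearMap.congr_fun (f := LinearMap.id) (g := 0)
    (day_free_linear_ext fun a j w => ?_) x
  have hle : d ≤ m := (sec w).le
  rw [LinearMap.id_apply, dayGen_eq, unitMod_eq_zero (n := m - d) (by omega) (act S.unitMod (compl w) a)]
  exact dayMk_zero_left _ _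

section

variable {B : S.UMod} (b : B.obj ⟨0⟩) (hb : ∀ m ≠ 0, ∀ x : B.obj ⟨m⟩, x = 0)

/-- The components of `unitDesc`. -/
noncomputable def unitDescApp (n : ℕ) : S.unitMod.obj ⟨n⟩ →ₗ[ℤ] B.obj ⟨n⟩ :=
  Submodule.liftQ (augIdeal.{u} n) (intLinear (fun k : ULift.{u} ℤ => k.down •
      act B (UHom.mk n (Nat.add_zero n) 1) b) fun k l => add_zsmul _ k.down l.down) (by
    intro k hk
    by_cases hn : n = 0
    · rw [augIdeal, if_pos hn] at hk
      rw [(Submodule.mem_bot ℤ).1 hk]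
      exact zero_mem _
    · exact hb n hn _)

lemma unitDescApp_gen (n : ℕ) :
    unitDescApp b hb n (unitGen S n) = act B (UHom.mk n (Nat.add_zero n) 1) b :=
  one_smul ℤ _

lemma unit_linear_ext {W : Type*} [AddCommGroup W] [Module ℤ W] {n : ℕ}
    {f g : S.unitMod.obj ⟨n⟩ →ₗ[ℤ] W} (h : f (unitGen S n) = g (unitGen S n)) : f = g :=
  LinearMap.ext fun x => by
    obtain ⟨k, rfl⟩ := exists_zsmul_unitGen x
    rw [map_zsmul, map_zsmul, h]

/-- The morphism from the unit to a module supported in rank `0`. -/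
noncomputable def unitDesc : S.unitMod ⟶ B :=
  umodHom (unitDescApp b hb) fun {m n} f a => by
    refine LinearMap.congr_fun (f := unitDescApp b hb n ∘ₗ act S.unitMod f)
      (g := act B f ∘ₗ unitDescApp b hb m) (unit_linear_ext ?_) a
    rw [LinearMap.comp_apply, LinearMap.comp_apply, act_unitGen, unitDescApp_gen, unitDescApp_gen,
      ← act_comp, S.comp_ini]

lemma unitDesc_gen : ((unitDesc b hb).app ⟨0⟩).hom (unitGen S 0) = b :=
  (unitDescApp_gen b hb 0).trans (act_idHom B b)

end

/-- As A vanishes above rank k, Σ^k A is supported in rank 0, so each element of top rank defines a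
morphism from the unit to Σ^k A. Its adjoint maps ℤ ⊛ F_k onto the part generated by that element.
-/
lemma exists_day_unitMod_free {k : ℕ} {A : S.UMod} (hA : ∀ m, k < m → ∀ a : A.obj ⟨m⟩, a = 0) :
    ∃ f : day S.unitMod (free fun _ : A.obj ⟨0 + k⟩ => k) ⟶ A,
      Function.Surjective (f.app ⟨k⟩).hom := by
  let θ (x : A.obj ⟨0 + k⟩) : S.unitMod ⟶ (S.shiftF k).obj A :=
    unitDesc (B := (S.shiftF k).obj A) x fun m hm => hA (m + k) (by omega)
  refine ⟨dayFreeDesc θ, fun a => ?_⟩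
  have h (k' : ℕ) (e : k' = k) : ∃ (x : A.obj ⟨k'⟩) (w : S.UHom k' k), act A w x = a := by
    subst e
    exact ⟨a, S.idHom _, act_idHom A a⟩
  obtain ⟨x, w, rfl⟩ := h (0 + k) (zero_add k)
  refine ⟨dayGen _ (unitGen S 0) x w, (dayFreeDesc_gen θ _ _ _).trans ?_⟩
  exact congrArg (act A w) (unitDesc_gen (B := (S.shiftF k).obj A) x _)

/-- A module supported in ranks `≤ d` is `d`-regular. -/
theorem Reg.of_bounded (hS : S.StandardConnectivity) {d : ℤ} {A : S.UMod}
    (hA : ∀ m : ℕ, d < m → ∀ a : A.obj ⟨m⟩, a = 0) : Reg d A := by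
  -- Here k = d + 1 is the first rank from which A vanishes. The outer induction is on k and treats
  -- the cokernel of the map from the top rank; the inner one is on the degree j and treats its
  -- kernel.
  have key (k : ℕ) : ∀ (j : ℕ) (A : S.UMod), (∀ m, k ≤ m → ∀ a : A.obj ⟨m⟩, a = 0) →
      ∀ n : ℕ, j + k ≤ n → ∀ N : S.UMod, SuppAt n N → ExtVan A N j := by
    induction k with
    | zero =>
      intro j A hA n _ N hN
      exact ExtVan.of_eq_zero hN (fun m _ => hA m (Nat.zero_le m)) j
    | succ k ihk =>
      intro j
      induction j with
      | zero =>
        intro A hA n hj N hN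
        obtain ⟨f, hf⟩ := exists_day_unitMod_free (k := k) hA
        refine ExtVan.mid (imageSequence_shortExact f) (ExtVan.right_zero
          (coimageSequence_shortExact f) (ExtVan.day_free fun _ => ExtVan.unit (n - k) hS
            (hN.shift (by omega)) (by omega))) (ihk _ _ (fun m hm => ?_) n (by omega) N hN)
        rcases hm.eq_or_lt with rfl | hm
        · exact cokernel_eq_zero f hf
        · exact cokernel_eq_zero f fun a => ⟨0, (map_zero _).trans (hA m hm a).symm⟩
      | succ j ihj =>
        intro A hA n hj N hN
        obtain ⟨f, hf⟩ := exists_day_unitMod_free (k := k) hA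
        refine ExtVan.mid (imageSequence_shortExact f) (ExtVan.right
          (coimageSequence_shortExact f) (ihj _ (fun m hm a => ?_) n (by omega) N hN)
          (ExtVan.day_free fun _ => ExtVan.unit (n - k) hS
            (hN.shift (by omega)) (by omega))) (ihk _ _ (fun m hm => ?_) n (by omega) N hN)
        -- The kernel sits inside a module concentrated in rank k, so it satisfies the same bound as
        -- A and is needed only in degree j.
        · exact kernel_ι_injective f m ((day_unitMod_free_eq_zero (by omega) _).trans
            (map_zero _).symm)
        · rcases hm.eq_or_lt with rfl | hm
          · exact cokernel_eq_zero f hf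
          · exact cokernel_eq_zero f fun a => ⟨0, (map_zero _).trans (hA m hm a).symm⟩
  intro j n hj N hN
  rcases lt_or_ge d 0 with hd | hd
  · exact ExtVan.of_eq_zero hN (fun m _ => hA m (by omega)) j
  · exact key (d + 1).toNat j A (fun m hm => hA m (by omega)) n (by omega) N hN

/-! ### Indecomposables -/

/-- The decomposable elements in rank `n`, and everything in the other ranks. -/
def decomp (n : ℕ) (C : S.UMod) (k : ℕ) : Submodule ℤ (C.obj ⟨k⟩) :=
  Submodule.span ℤ {x | k ≠ n ∨ ∃ m < k, ∃ (f : S.UHom m k) (b : C.obj ⟨m⟩), act C f b = x}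

lemma decomp_le (n : ℕ) (C : S.UMod) {k l : ℕ} (f : S.UHom k l) :
    decomp n C k ≤ (decomp n C l).comap (act C f) := by
  refine Submodule.span_le.2 fun x hx => Submodule.subset_span ?_
  by_cases hl : l = n
  · subst hl
    by_cases hk : k = l
    · subst hk
      obtain hk | ⟨m, hm, g, b, rfl⟩ := hx
      · exact absurd rfl hk
      · exact Or.inr ⟨m, hm, UHom.comp f g, b, act_comp C f g b⟩
    · exact Or.inr ⟨k, lt_of_le_of_ne f.le hk, f, x, rfl⟩
  · exact Or.inl hl

/-- The indecomposables in rank `n`, as a module supported in rank `n`. -/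
noncomputable def indec (n : ℕ) (C : S.UMod) : S.UMod where
  obj X := ModuleCat.of ℤ (C.obj ⟨X.rank⟩ ⧸ decomp n C X.rank)
  map {X Y} f := ModuleCat.ofHom (X := C.obj ⟨X.rank⟩ ⧸ decomp n C X.rank)
    (Y := C.obj ⟨Y.rank⟩ ⧸ decomp n C Y.rank)
    (intLinear (Submodule.mapQ _ _ (act C f) (decomp_le n C f)) (map_add _))
  map_id X := ModuleCat.hom_ext (LinearMap.ext fun x => by
    obtain ⟨x, rfl⟩ := Submodule.Quotient.mk_surjective (decomp n C X.rank) x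
    exact congrArg (Submodule.Quotient.mk (p := decomp n C X.rank)) (act_idHom C x))
  map_comp {X Y Z} f g := ModuleCat.hom_ext (LinearMap.ext fun x => by
    obtain ⟨x, rfl⟩ := Submodule.Quotient.mk_surjective (decomp n C X.rank) x
    exact congrArg (Submodule.Quotient.mk (p := decomp n C Z.rank)) (act_comp C g f x))

/-- The projection to the indecomposables. -/
noncomputable def indecπ (n : ℕ) (C : S.UMod) : C ⟶ indec n C :=
  umodHom (B := indec n C) (fun k => intLinear (W := C.obj ⟨k⟩ ⧸ decomp n C k)
    (Submodule.mkQ (decomp n C k)) (map_add _)) fun _ _ => rfl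

lemma indecπ_surjective (n : ℕ) (C : S.UMod) (k : ℕ) :
    Function.Surjective ((indecπ n C).app ⟨k⟩).hom :=
  Submodule.Quotient.mk_surjective (decomp n C k)

lemma indecπ_eq_zero_iff {n : ℕ} {C : S.UMod} {k : ℕ} (x : C.obj ⟨k⟩) :
    ((indecπ n C).app ⟨k⟩).hom x = 0 ↔ x ∈ decomp n C k :=
  Submodule.Quotient.mk_eq_zero (decomp n C k)

lemma suppAt_indec (n : ℕ) (C : S.UMod) : SuppAt n (indec n C) := fun k hk a => by
  obtain ⟨x, rfl⟩ := indecπ_surjective n C k a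
  exact (indecπ_eq_zero_iff x).2 (Submodule.subset_span (Or.inl hk))

/-- This is Nakayama's lemma. The cokernel vanishes in ranks ≤ q; in the first further rank where it
could be nonzero, it has no decomposables, so it would be a nonzero quotient of B supported in one
rank. -/
lemma surjective_of_extVan {X B : S.UMod} (f : X ⟶ B) (q : ℕ)
    (hf : ∀ m ≤ q, Function.Surjective (f.app ⟨m⟩).hom)
    (h : ∀ n, q < n → ∀ N, SuppAt n N → ExtVan B N 0) : Epi f := by
  have key (m : ℕ) : ∀ c : (cokernel f).obj ⟨m⟩, c = 0 := by
    induction m using Nat.strong_induction_on with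
    | _ m ih =>
      intro c
      by_cases hm : m ≤ q
      · exact cokernel_eq_zero f (hf m hm) c
      · obtain ⟨b, rfl⟩ := (umod_epi_iff (cokernel.π f)).1 inferInstance m c
        have h₀ := ExtVan.zero_iff.1 (h m (by omega) _ (suppAt_indec m (cokernel f)))
          (cokernel.π f ≫ indecπ m (cokernel f))
        have h₁ := (indecπ_eq_zero_iff _).1
          (congrArg (fun φ : B ⟶ indec m (cokernel f) => (φ.app ⟨m⟩).hom b) h₀)
        refine (Submodule.mem_bot ℤ).1 (Submodule.span_le.2 ?_ h₁)
        rintro x (hx | ⟨l, hl, g, y, rfl⟩)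
        · exact absurd rfl hx
        · rw [ih l hl y]
          exact map_zero _
  exact Preadditive.epi_of_isZero_cokernel f (Functor.isZero _ fun X =>
    (isZero_obj_iff (n := X.rank)).2 (key X.rank))

/-! ### A resolution of the unit -/

/-- The syzygies of the unit. -/
noncomputable def syz (S : BraidedStabilityGroupoid.{u}) : ℕ → S.UMod
  | 0 => S.unitMod
  | q + 1 => kernel (coverDesc (· ≤ q) (syz S q))

lemma Reg.unit (hS : S.StandardConnectivity) : Reg 0 S.unitMod :=
  fun _ n hj _ hN => ExtVan.unit n hS hN (by omega)

/-- Regularity q in degree 0 says that the qth syzygy has no indecomposables in ranks > q, so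
generators of ranks ≤ q suffice. Passing to the kernel costs one in regularity. -/
lemma reg_syz (hS : S.StandardConnectivity) (q : ℕ) :
    Reg q (syz S q) ∧ Epi (coverDesc (· ≤ q) (syz S q)) := by
  have epi (q : ℕ) (h : Reg q (syz S q)) : Epi (coverDesc (· ≤ q) (syz S q)) :=
    surjective_of_extVan _ q (fun m hm => coverDesc_surjective hm)
      fun n hn N hN => h 0 n (by omega) N hN
  induction q with
  | zero => exact ⟨Reg.unit hS, epi 0 (Reg.unit hS)⟩
  | succ q ih =>
    have := ih.2
    have h : Reg ((q + 1 : ℕ) : ℤ) (syz S (q + 1)) := fun j n hj N hN =>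
      ExtVan.left (kernelSequence_shortExact (coverDesc (· ≤ q) (syz S q)))
        (ExtVan.free_of_ne hN (fun x => by have := x.2; push_cast at hj; omega) j)
        (ih.1 (j + 1) n (by push_cast at hj ⊢; omega) N hN)
    exact ⟨h, epi _ h⟩

/-! ### Splitting in each rank -/

section

variable {T : ShortComplex S.UMod} (hT : T.ShortExact) (n : ℕ)
  [Module.Projective ℤ (T.X₃.obj ⟨n⟩)]

include hT

lemma exists_splitting : ∃ (r : T.X₂.obj ⟨n⟩ →ₗ[ℤ] T.X₁.obj ⟨n⟩)
    (s : T.X₃.obj ⟨n⟩ →ₗ[ℤ] T.X₂.obj ⟨n⟩), (∀ x, r ((T.f.app ⟨n⟩).hom x) = x) ∧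
    (∀ x, (T.g.app ⟨n⟩).hom (s x) = x) ∧
    ∀ x, (T.f.app ⟨n⟩).hom (r x) + s ((T.g.app ⟨n⟩).hom x) = x := by
  obtain ⟨hf, he, hg⟩ := (umod_shortExact_iff T).1 hT n
  obtain ⟨s, hs⟩ := Module.projective_lifting_property (T.g.app ⟨n⟩).hom LinearMap.id hg
  replace hs (x) : (T.g.app ⟨n⟩).hom (s x) = x := LinearMap.congr_fun hs x
  have h (x) : ∃ y, (T.f.app ⟨n⟩).hom y = x - s ((T.g.app ⟨n⟩).hom x) :=
    (he _).1 (by rw [map_sub, hs, sub_self])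
  choose r hr using h
  refine ⟨intLinear r fun x y => hf ?_, s, fun x => hf ((hr _).trans ?_), hs,
    fun x => (congrArg (· + _) (hr x)).trans (sub_add_cancel _ _)⟩
  · rw [map_add, hr, hr, hr, map_add, map_add]
    abel
  · rw [(he _).2 ⟨x, rfl⟩, map_zero, sub_zero]

lemma projective_X₁ [Module.Projective ℤ (T.X₂.obj ⟨n⟩)] : Module.Projective ℤ (T.X₁.obj ⟨n⟩) := by
  obtain ⟨r, -, hr, -⟩ := exists_splitting hT n
  exact Module.Projective.of_split (T.f.app ⟨n⟩).hom r (LinearMap.ext hr)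

end

/-- In every rank the sequence splits over ℤ, and splittings survive tensoring with A_n. -/
lemma shortExact_map_tensL {T : ShortComplex S.UMod} (hT : T.ShortExact)
    (h : ∀ n, Module.Projective ℤ (T.X₃.obj ⟨n⟩)) (A : S.UMod) :
    (T.map (tensL A)).ShortExact := by
  refine (umod_shortExact_iff _).2 fun n => ?_
  obtain ⟨r, s, hr, hs, hrs⟩ := exists_splitting hT n
  let r' : (tens A T.X₂).obj ⟨n⟩ →ₗ[ℤ] (tens A T.X₁).obj ⟨n⟩ :=
    tensLift (fun a b => tmk a (r b)) (fun a a' b => tmk_add_left _ _ _)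
      (fun a b b' => by rw [map_add, tmk_add_right])
  let s' : (tens A T.X₃).obj ⟨n⟩ →ₗ[ℤ] (tens A T.X₂).obj ⟨n⟩ :=
    tensLift (fun a b => tmk a (s b)) (fun a a' b => tmk_add_left _ _ _)
      (fun a b b' => by rw [map_add, tmk_add_right])
  let f' : (tens A T.X₁).obj ⟨n⟩ →ₗ[ℤ] (tens A T.X₂).obj ⟨n⟩ := tensMapApp (𝟙 A) T.f n
  let g' : (tens A T.X₂).obj ⟨n⟩ →ₗ[ℤ] (tens A T.X₃).obj ⟨n⟩ := tensMapApp (𝟙 A) T.g n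
  have h₁ : r' ∘ₗ f' = LinearMap.id :=
    tens_linear_ext fun a b => congrArg (tmk a) (hr b)
  have h₂ : g' ∘ₗ s' = LinearMap.id :=
    tens_linear_ext fun a b => congrArg (tmk a) (hs b)
  have h₃ : f' ∘ₗ r' + s' ∘ₗ g' = LinearMap.id :=
    tens_linear_ext fun a b => (tmk_add_right a _ _).symm.trans (congrArg (tmk a) (hrs b))
  refine ⟨Function.LeftInverse.injective (g := r') fun x => LinearMap.congr_fun h₁ x,
    fun x => ⟨fun hx => ⟨r' x, ?_⟩, ?_⟩,
    Function.RightInverse.surjective (g := s') fun x => LinearMap.congr_fun h₂ x⟩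
  · have h₄ : f' (r' x) + s' (g' x) = x := LinearMap.congr_fun h₃ x
    have h₅ : g' x = 0 := hx
    rw [h₅, map_zero] at h₄
    exact (add_zero _).symm.trans h₄
  · rintro ⟨y, rfl⟩
    exact congrArg (fun φ : tens A T.X₁ ⟶ tens A T.X₃ => (φ.app ⟨n⟩).hom y)
      (T.map (tensL A)).zero

lemma projective_free {J : Type u} (s : J → ℕ) (n : ℕ) :
    Module.Projective ℤ ((free (S := S) s).obj ⟨n⟩) := by
  change Module.Projective ℤ ((Σ j, S.UHom (s j) n) →₀ ℤ)
  infer_instance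

lemma projective_unitMod (n : ℕ) : Module.Projective ℤ (S.unitMod.obj ⟨n⟩) := by
  change Module.Projective ℤ (ULift.{u} ℤ ⧸ augIdeal.{u} n)
  by_cases hn : n = 0
  · rw [augIdeal, if_pos hn]
    exact Module.Projective.of_equiv (Submodule.quotEquivOfEqBot _ rfl).symm
  · rw [augIdeal, if_neg hn]
    infer_instance

/-- Projectivity over ℤ passes from the unit and the free terms to the kernels, since the syzygy
sequences split rank by rank. This is what makes A ⊗ K a resolution for arbitrary A. -/
lemma projective_syz (hS : S.StandardConnectivity) (q n : ℕ) :
    Module.Projective ℤ ((syz S q).obj ⟨n⟩) := by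
  induction q with
  | zero => exact projective_unitMod n
  | succ q ih =>
    have := (reg_syz hS q).2
    have : Module.Projective ℤ ((kernelSequence (coverDesc (· ≤ q) (syz S q))).X₂.obj ⟨n⟩) :=
      projective_free (S := S) (fun x : Gens (· ≤ q) (syz S q) => x.1.1) n
    have : Module.Projective ℤ ((kernelSequence (coverDesc (· ≤ q) (syz S q))).X₃.obj ⟨n⟩) := ih
    exact projective_X₁ (kernelSequence_shortExact (coverDesc (· ≤ q) (syz S q))) n

end BraidedStabilityGroupoid

/-! ### Exactness after composing with an epimorphism or a monomorphism -/

section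

variable {C : Type*} [Category* C] [Abelian C] {X Y Z W : C}

lemma exact_epi_comp {p : X ⟶ Y} [Epi p] {i : Y ⟶ Z} {g : Z ⟶ W} {w : i ≫ g = 0}
    (h : (ShortComplex.mk i g w).Exact) {f : X ⟶ Z} (hf : f = p ≫ i) (w' : f ≫ g = 0) :
    (ShortComplex.mk f g w').Exact := by
  subst hf
  let φ : ShortComplex.mk (p ≫ i) g w' ⟶ ShortComplex.mk i g w :=
    { τ₁ := p, τ₂ := 𝟙 _, τ₃ := 𝟙 _ }
  have : Epi φ.τ₁ := ‹Epi p›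
  exact (ShortComplex.exact_iff_of_epi_of_isIso_of_mono φ).2 h

lemma exact_comp_mono {f : X ⟶ Y} {p : Y ⟶ Z} {i : Z ⟶ W} [Mono i] {w : f ≫ p = 0}
    (h : (ShortComplex.mk f p w).Exact) {g : Y ⟶ W} (hg : g = p ≫ i) (w' : f ≫ g = 0) :
    (ShortComplex.mk f g w').Exact := by
  subst hg
  let φ : ShortComplex.mk f p w ⟶ ShortComplex.mk f (p ≫ i) w' :=
    { τ₁ := 𝟙 _, τ₂ := 𝟙 _, τ₃ := i }
  have : Mono φ.τ₃ := ‹Mono i›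
  exact (ShortComplex.exact_iff_of_epi_of_isIso_of_mono φ).1 h

end


namespace BraidedStabilityGroupoid

open StabilityGroupoid

variable {S : BraidedStabilityGroupoid.{u}}

/-! ### The resolution as a cochain complex -/

/-- The inclusion of a syzygy. -/
noncomputable def syzι (S : BraidedStabilityGroupoid.{u}) (q : ℕ) :
    syz S (q + 1) ⟶ cover (· ≤ q) (syz S q) := kernel.ι (coverDesc (· ≤ q) (syz S q))

lemma syzι_comp_coverDesc (q : ℕ) : syzι S q ≫ coverDesc (· ≤ q) (syz S q) = 0 :=
  kernel.condition _

/-- The differentials of the resolution of the unit. -/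
noncomputable def syzD (S : BraidedStabilityGroupoid.{u}) (q : ℕ) :
    cover (· ≤ q + 1) (syz S (q + 1)) ⟶ cover (· ≤ q) (syz S q) :=
  coverDesc (· ≤ q + 1) (syz S (q + 1)) ≫ syzι S q

lemma syzD_comp_coverDesc (q : ℕ) : syzD S q ≫ coverDesc (· ≤ q) (syz S q) = 0 := by
  rw [syzD, Category.assoc, syzι_comp_coverDesc, comp_zero]

lemma syzD_comp_syzD (q : ℕ) : syzD S (q + 1) ≫ syzD S q = 0 := by
  rw [syzD.eq_def S q, ← Category.assoc, syzD_comp_coverDesc, zero_comp]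

/-- The generators of the resolution of the unit, in cohomological degree `k`. -/
def resIdx (S : BraidedStabilityGroupoid.{u}) : ℤ → Type u
  | .ofNat 0 => Gens (· ≤ 0) (syz S 0)
  | .ofNat (_ + 1) => PEmpty
  | .negSucc q => Gens (· ≤ q + 1) (syz S (q + 1))

/-- The ranks of the generators. -/
def resRank (S : BraidedStabilityGroupoid.{u}) : ∀ k : ℤ, resIdx S k → ℕ
  | .ofNat 0 => fun x : Gens (· ≤ 0) (syz S 0) => x.1.1
  | .ofNat (_ + 1) => fun x : PEmpty => x.elim
  | .negSucc q => fun x : Gens (· ≤ q + 1) (syz S (q + 1)) => x.1.1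

lemma resRank_le : ∀ (k : ℤ) (x : resIdx S k), (resRank S k x : ℤ) ≤ -k
  | .ofNat 0 => fun x : Gens (· ≤ 0) (syz S 0) => Int.ofNat_le.2 x.2
  | .ofNat (_ + 1) => fun x : PEmpty => x.elim
  | .negSucc q => fun x : Gens (· ≤ q + 1) (syz S (q + 1)) => Int.ofNat_le.2 x.2

/-- The differentials of `res`. -/
noncomputable def resD (S : BraidedStabilityGroupoid.{u}) :
    ∀ k : ℤ, free (S := S) (resRank S k) ⟶ free (resRank S (k + 1))
  | .ofNat _ => 0
  | .negSucc 0 => syzD S 0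
  | .negSucc (q + 1) => syzD S (q + 1)

/-- The resolution of the unit, as a cochain complex in non-positive degrees. -/
noncomputable def res (S : BraidedStabilityGroupoid.{u}) : CochainComplex S.UMod ℤ :=
  CochainComplex.of (fun k => free (resRank S k)) (resD S) (by
    rintro (n | _ | _ | q)
    · exact zero_comp
    · exact comp_zero
    · exact syzD_comp_syzD 0
    · exact syzD_comp_syzD (q + 1))

lemma res_d (k : ℤ) : (res S).d k (k + 1) = resD S k :=
  CochainComplex.of_d (fun k => free (resRank S k)) (resD S) k

lemma isZero_free {J : Type u} [IsEmpty J] (s : J → ℕ) : IsZero (free (S := S) s) :=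
  Functor.isZero _ fun X => (isZero_obj_iff (n := X.rank)).2
    (free_eq_zero fun j => isEmptyElim j)

lemma isZero_res {k : ℤ} (hk : 0 < k) : IsZero ((res S).X k) := by
  have : IsEmpty (resIdx S k) := ⟨fun x => by have := resRank_le k x; omega⟩
  exact isZero_free (resRank S k)

/-! ### The complexes `A ⊛ K` and `A ⊗ K` -/

/-- The functor `A ↦ A ⊛ K`. -/
noncomputable def dayRes (S : BraidedStabilityGroupoid.{u}) : S.UMod ⥤ CochainComplex S.UMod ℤ where
  obj A := ((dayL A).mapHomologicalComplex _).obj (res S)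
  map {A A'} α :=
    { f := fun k => (dayR ((res S).X k)).map α
      comm' := fun i j _ => by
        refine (dayMap_comp _ _ _ _).symm.trans (.trans ?_ (dayMap_comp _ _ _ _))
        rw [Category.comp_id, Category.comp_id, Category.id_comp, Category.id_comp] }
  map_id A := HomologicalComplex.Hom.ext (funext fun k => (dayR ((res S).X k)).map_id A)
  map_comp α β := HomologicalComplex.Hom.ext (funext fun k => (dayR ((res S).X k)).map_comp α β)

instance : (dayRes S).PreservesZeroMorphisms where
  map_zero A A' := HomologicalComplex.Hom.ext (funext fun k =>
    (dayR ((res S).X k)).map_zero A A')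

lemma shortExact_map_dayRes {T : ShortComplex S.UMod} (hT : T.ShortExact) :
    (T.map (dayRes S)).ShortExact :=
  HomologicalComplex.shortExact_of_degreewise_shortExact _ fun k =>
    shortExact_map_dayR_free (resRank S k) hT

/-- The complex `A ⊗ K`. -/
noncomputable abbrev tensRes (A : S.UMod) : CochainComplex S.UMod ℤ :=
  ((tensL A).mapHomologicalComplex _).obj (res S)

/-- The comparison `A ⊛ K ⟶ A ⊗ K`. -/
noncomputable def dayToTensRes (A : S.UMod) : (dayRes S).obj A ⟶ tensRes A where
  f k := dayToTens A ((res S).X k)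
  comm' i j _ := (dayToTens_naturality (𝟙 A) ((res S).d i j)).symm

/-- The generator of the resolution over the unit. -/
noncomputable def resGen (S : BraidedStabilityGroupoid.{u}) : ((res S).X 0).obj ⟨0⟩ :=
  freeMk (fun x : Gens (· ≤ 0) (syz S 0) => x.1.1) ⟨⟨0, unitGen S 0⟩, le_rfl⟩ (S.idHom 0)

/-- `a ↦ a ⊗ 1` -/
noncomputable def toDayRes (A : S.UMod) : A ⟶ ((dayRes S).obj A).X 0 :=
  umodHom (B := day A ((res S).X 0)) (fun n => intLinear (W := DayObj A ((res S).X 0) n)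
      (fun a => dayMk a (resGen S) (S.idHom (n + 0)))
      fun a a' => dayMk_add_left a a' _ _) fun {m n} x a => by
    refine (dayMk_act_left x a (resGen S) (S.idHom (n + 0))).trans ?_
    refine .trans ?_ (act_dayMk A ((res S).X 0) x a (resGen S) (S.idHom (m + 0))).symm
    rw [S.rshMap_zero]
    exact congrArg (dayMk a (resGen S)) ((idHom_comp x).trans (comp_idHom x).symm)

lemma toDayRes_d (A : S.UMod) (k : ℤ) (hk : (ComplexShape.up ℤ).Rel 0 k) :
    toDayRes A ≫ ((dayRes S).obj A).d 0 k = 0 := by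
  have hz : IsZero (((dayRes S).obj A).X k) := (dayL A).map_isZero (isZero_res (by
    simp only [ComplexShape.up_Rel] at hk; omega))
  exact hz.eq_of_tgt _ _

/-- The natural transformation with components `A ⟶ A ⊛ K`. -/
noncomputable def singleToDayRes (S : BraidedStabilityGroupoid.{u}) :
    HomologicalComplex.single S.UMod (.up ℤ) 0 ⟶ dayRes S where
  app A := HomologicalComplex.mkHomFromSingle (K := (dayRes S).obj A) (toDayRes A) (toDayRes_d A)
  naturality A A' α := by
    refine HomologicalComplex.from_single_hom_ext ?_
    rw [HomologicalComplex.comp_f, HomologicalComplex.comp_f,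
      HomologicalComplex.mkHomFromSingle_f, HomologicalComplex.mkHomFromSingle_f,
      HomologicalComplex.single_map_f_self]
    simp only [Category.assoc, Iso.inv_hom_id_assoc]
    refine congrArg _ (umod_hom_ext fun n a => ?_)
    exact (dayMap_mk α (𝟙 _) a (resGen S) (S.idHom (n + 0))).symm

section

variable {n : ℕ} {N : S.UMod} (hN : SuppAt n N)

include hN in
-- Of two distinct ranks at least one differs from n. This vanishing is what makes the retraction N
-- ⊛ ℤ ⟶ N natural.
lemma suppAt_act {p p' : ℕ} (h : p ≠ p') (f : S.UHom p p') (x : N.obj ⟨p⟩) : act N f x = 0 := by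
  by_cases hp : p = n
  · exact hN p' (by omega) _
  · rw [hN p hp x, map_zero]

/-- The coefficient of an element of the unit. -/
noncomputable def coef (n : ℕ) : S.unitMod.obj ⟨n⟩ →ₗ[ℤ] ℤ :=
  Submodule.liftQ (augIdeal.{u} n)
    (intLinear (fun k : ULift.{u} ℤ => if n = 0 then k.down else 0) fun k l => by
      split_ifs <;> simp) (by
    intro k hk
    by_cases hn : n = 0
    · rw [augIdeal, if_pos hn] at hk
      rw [(Submodule.mem_bot ℤ).1 hk]
      exact zero_mem _
    · exact if_neg hn)

lemma coef_gen : coef 0 (unitGen S 0) = 1 := rfl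

/-- The morphism `N ⊛ ℤ ⟶ N` for a module `N` supported in one rank. -/
noncomputable def dayUnitDesc : day N S.unitMod ⟶ N :=
  dayDesc (B := N)
    { φ := fun p q a b => coef q b • act N (S.insR p q) a
      add_left := fun a a' b => by rw [map_add, zsmul_add]
      add_right := fun a b b' => by rw [map_add, add_zsmul]
      act_left := fun x a b => by
        rw [map_zsmul, ← act_comp, ← act_comp, S.rshMap_comp_insR]
      act_right := fun {p q q'} y a b => by
        rw [map_zsmul, ← act_comp, S.lshMap_comp_insR]
        by_cases hq : q = 0
        · subst hq
          obtain rfl : q' = 0 := by have := y.le; omega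
          obtain ⟨k, rfl⟩ := exists_zsmul_unitGen b
          rw [map_zsmul, act_unitGen]
        · rw [suppAt_act hN (by omega) (S.insR p q) a, zsmul_zero, zsmul_zero] }

/-- The morphism `N ⊛ K_0 ⟶ N` for a module `N` supported in one rank. -/
noncomputable def dayResDesc : ((dayRes S).obj N).X 0 ⟶ N :=
  dayMap (𝟙 N) (coverDesc (· ≤ 0) (syz S 0)) ≫ dayUnitDesc hN

lemma d_comp_dayResDesc (k : ℤ) (hk : (ComplexShape.up ℤ).Rel k 0) :
    ((dayRes S).obj N).d k 0 ≫ dayResDesc hN = 0 := by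
  obtain rfl : k = -1 := by simp only [ComplexShape.up_Rel] at hk; omega
  have h : (res S).d (-1) 0 = syzD S 0 := res_d (-1)
  have h₁ : ((dayRes S).obj N).d (-1) 0 = (dayL N).map (syzD S 0) := congrArg (dayL N).map h
  have h₂ : (dayL N).map (syzD S 0) ≫ (dayL N).map (coverDesc (· ≤ 0) (syz S 0)) = 0 := by
    rw [← Functor.map_comp, syzD_comp_coverDesc, Functor.map_zero]
  refine (congrArg (· ≫ dayResDesc hN) h₁).trans ((Category.assoc _ _ _).symm.trans ?_)
  exact (congrArg (· ≫ dayUnitDesc hN) h₂).trans zero_comp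

/-- The morphism `N ⊛ K ⟶ N` for a module `N` supported in one rank. -/
noncomputable def dayResToSingle :
    (dayRes S).obj N ⟶ (HomologicalComplex.single S.UMod (.up ℤ) 0).obj N :=
  HomologicalComplex.mkHomToSingle (dayResDesc hN) (d_comp_dayResDesc hN)

lemma toDayRes_comp_dayResDesc : toDayRes N ≫ dayResDesc hN = 𝟙 N := by
  refine umod_hom_ext fun m a => ?_
  refine (congrArg ((dayUnitDesc hN).app ⟨m⟩).hom (dayMap_mk (𝟙 N)
    (coverDesc (· ≤ 0) (syz S 0)) a (resGen S) (S.idHom (m + 0)))).trans ?_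
  refine (dayDesc_mk _ _ _ _).trans ?_
  have h : ((coverDesc (· ≤ 0) (syz S 0)).app ⟨0⟩).hom (resGen S) = unitGen S 0 :=
    (coverDesc_mk (P := (· ≤ 0)) (M := syz S 0) le_rfl (unitGen S 0) (S.idHom 0)).trans
      (act_unitGen _)
  refine (congrArg (fun b => act N (S.idHom (m + 0)) (coef 0 b • act N (S.insR m 0) a)) h).trans ?_
  have h₂ : S.insR m 0 = S.idHom m := lshMap_idHom m 0
  rw [coef_gen, one_zsmul, h₂, act_idHom]
  exact act_idHom N a

lemma singleToDayRes_comp_dayResToSingle :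
    (singleToDayRes S).app N ≫ dayResToSingle hN = 𝟙 _ := by
  refine HomologicalComplex.from_single_hom_ext ?_
  have h := toDayRes_comp_dayResDesc hN
  rw [HomologicalComplex.comp_f, singleToDayRes, dayResToSingle,
    HomologicalComplex.mkHomFromSingle_f, HomologicalComplex.mkHomToSingle_f, Category.assoc,
    ← Category.assoc (toDayRes N), h, Category.id_comp, Iso.hom_inv_id]
  rfl

end

/-! ### The complex `A ⊗ K` is a resolution of `A ⊗ ℤ` -/

section

variable (A : S.UMod) (hS : S.StandardConnectivity)

include hS

lemma shortExact_syz (q : ℕ) :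
    (ShortComplex.mk (syzι S q) (coverDesc (· ≤ q) (syz S q))
      (syzι_comp_coverDesc q)).ShortExact := by
  have := (reg_syz hS q).2
  exact kernelSequence_shortExact (coverDesc (· ≤ q) (syz S q))

lemma shortExact_tens_syz (q : ℕ) :
    ((ShortComplex.mk (syzι S q) (coverDesc (· ≤ q) (syz S q))
      (syzι_comp_coverDesc q)).map (tensL A)).ShortExact :=
  shortExact_map_tensL (shortExact_syz hS q) (projective_syz hS q) A

/-- The differential is the cover of the next syzygy followed by its inclusion, and A ⊗ - keeps the
former epimorphic. -/
lemma exact_tens_coverDesc (q : ℕ) :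
    (ShortComplex.mk ((tensL A).map (syzD S q)) ((tensL A).map (coverDesc (· ≤ q) (syz S q)))
      (by rw [← Functor.map_comp, syzD_comp_coverDesc, Functor.map_zero])).Exact := by
  have : Epi ((tensL A).map (coverDesc (· ≤ q + 1) (syz S (q + 1)))) :=
    (shortExact_tens_syz A hS (q + 1)).epi_g
  exact exact_epi_comp (shortExact_tens_syz A hS q).exact ((tensL A).map_comp _ _) _

lemma exact_tens_syzD (q : ℕ) :
    (ShortComplex.mk ((tensL A).map (syzD S (q + 1))) ((tensL A).map (syzD S q))
      (by rw [← Functor.map_comp, syzD_comp_syzD, Functor.map_zero])).Exact := by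
  have : Mono ((tensL A).map (syzι S q)) := (shortExact_tens_syz A hS q).mono_f
  exact exact_comp_mono (exact_tens_coverDesc A hS (q + 1)) ((tensL A).map_comp _ _) _

end

end BraidedStabilityGroupoid

lemma exact_congr {C : Type*} [Category* C] [HasZeroMorphisms C] {X Y Z : C} {f f' : X ⟶ Y}
    {g g' : Y ⟶ Z} {w : f ≫ g = 0} (h : (ShortComplex.mk f g w).Exact) (hf : f' = f)
    (hg : g' = g) (w' : f' ≫ g' = 0) : (ShortComplex.mk f' g' w').Exact := by
  subst hf hg
  exact h


namespace BraidedStabilityGroupoid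

open StabilityGroupoid

variable {S : BraidedStabilityGroupoid.{u}}

section

variable (A : S.UMod)

/-- The augmentation of `A ⊗ K`. -/
noncomputable def tensResDesc : (tensRes A).X 0 ⟶ tens A S.unitMod :=
  (tensL A).map (coverDesc (· ≤ 0) (syz S 0))

lemma tensRes_d (k : ℤ) : (tensRes A).d k (k + 1) = (tensL A).map (resD S k) :=
  congrArg (tensL A).map (res_d k)

lemma tensRes_d_zero : (tensRes A).d (-1) 0 = (tensL A).map (syzD S 0) := tensRes_d A (-1)

lemma d_comp_tensResDesc (k : ℤ) (hk : (ComplexShape.up ℤ).Rel k 0) :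
    (tensRes A).d k 0 ≫ tensResDesc A = 0 := by
  obtain rfl : k = -1 := by simp only [ComplexShape.up_Rel] at hk; omega
  have h : (tensL A).map (syzD S 0) ≫ (tensL A).map (coverDesc (· ≤ 0) (syz S 0)) = 0 := by
    rw [← Functor.map_comp, syzD_comp_coverDesc, Functor.map_zero]
  exact (congrArg (· ≫ tensResDesc A) (tensRes_d_zero A)).trans h

/-- The augmentation of `A ⊗ K`, as a morphism of complexes. -/
noncomputable def tensResToSingle :
    tensRes A ⟶ (HomologicalComplex.single S.UMod (.up ℤ) 0).obj (tens A S.unitMod) :=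
  HomologicalComplex.mkHomToSingle (tensResDesc A) (d_comp_tensResDesc A)

lemma isZero_tensRes {k : ℤ} (hk : 0 < k) : IsZero ((tensRes A).X k) :=
  (tensL A).map_isZero (isZero_res hk)

variable (hS : S.StandardConnectivity)

include hS

lemma exactAt_tensRes {k : ℤ} (hk : k < 0) : (tensRes A).ExactAt k := by
  obtain ⟨q, rfl⟩ : ∃ q, k = Int.negSucc q := Int.eq_negSucc_of_lt_zero hk
  cases q with
  | zero =>
    rw [HomologicalComplex.exactAt_iff' _ (Int.negSucc 1) (Int.negSucc 0) 0 (by simp) (by simp)]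
    exact exact_congr (exact_tens_syzD A hS 0) (tensRes_d A (Int.negSucc 1))
      (tensRes_d A (Int.negSucc 0)) _
  | succ q =>
    rw [HomologicalComplex.exactAt_iff' _ (Int.negSucc (q + 2)) (Int.negSucc (q + 1))
      (Int.negSucc q) ((CochainComplex.prev _ _).trans (by omega))
      ((CochainComplex.next _ _).trans (by omega))]
    exact exact_congr (exact_tens_syzD A hS (q + 1)) (tensRes_d A (Int.negSucc (q + 2)))
      (tensRes_d A (Int.negSucc (q + 1))) _

lemma quasiIso_tensResToSingle : QuasiIso (tensResToSingle A) := ⟨fun k => by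
  rcases lt_trichotomy k 0 with hk | rfl | hk
  · rw [quasiIsoAt_iff_exactAt' _ _ (HomologicalComplex.exactAt_single_obj _ _ _ _ hk.ne)]
    exact exactAt_tensRes A hS hk
  · have he : Epi (tensResDesc A) := (shortExact_tens_syz A hS 0).epi_g
    have hf : (tensResToSingle A).f 0 = tensResDesc A ≫
      (HomologicalComplex.singleObjXSelf (.up ℤ) 0 (tens A S.unitMod)).inv :=
      HomologicalComplex.mkHomToSingle_f _ _
    rw [quasiIsoAt_iff' _ (-1) 0 1 (by simp) (by simp), ShortComplex.quasiIso_iff_of_zeros']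
    · constructor
      · refine exact_comp_mono (w := ?_) ?_ hf _
        · exact d_comp_tensResDesc A (-1) rfl
        · exact exact_congr (exact_tens_coverDesc A hS 0) (tensRes_d_zero A) rfl _
      · have : Epi ((tensResToSingle A).f 0) := by
          rw [hf]
          infer_instance
        exact this
    · exact (isZero_tensRes A one_pos).eq_of_tgt _ _
    · rfl
    · rfl
  · rw [quasiIsoAt_iff_exactAt' _ _ (HomologicalComplex.exactAt_single_obj _ _ _ _ hk.ne')]
    exact ShortComplex.exact_of_isZero_X₂ _ (isZero_tensRes A hk)⟩

end

/-! ### Regularity from the kernels and cokernels of `A ⟶ Σ^s A` -/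

lemma isStrictlyLE_kernel {X Y : CochainComplex S.UMod ℤ} (f : X ⟶ Y)
    (hX : ∀ k, 0 < k → IsZero (X.X k)) : CochainComplex.IsStrictlyLE (kernel f) 0 :=
  (CochainComplex.isStrictlyLE_iff _ _).2 fun k hk => IsZero.of_mono ((kernel.ι f).f k) (hX k hk)

lemma isStrictlyLE_cokernel {X Y : CochainComplex S.UMod ℤ} (f : X ⟶ Y)
    (hY : ∀ k, 0 < k → IsZero (Y.X k)) : CochainComplex.IsStrictlyLE (cokernel f) 0 :=
  (CochainComplex.isStrictlyLE_iff _ _).2 fun k hk => IsZero.of_epi ((cokernel.π f).f k) (hY k hk)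

/-- Generators in cohomological degree k have rank s ≤ -k, so Σ^s N is supported in rank n - s ≥ n +
k > i + c, as i = k + j. The bound j ≤ n ensures s ≤ n, so that n - s is a true difference. -/
lemma ExtVan.sigma_dayR {J : Type u} {s : J → ℕ} {c : ℤ} {B : J → S.UMod}
    (hB : ∀ j, Reg c (B j)) {k j : ℤ} {i n : ℕ} (hs : ∀ x, (s x : ℤ) ≤ -k) (hi : k + j = i)
    (hj : j + c < n) (hj' : j ≤ n) {N : S.UMod} (hN : SuppAt n N) :
    ExtVan (∐ fun x => (dayR (S.free₁ (s x))).obj (B x)) N i :=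
  ExtVan.sigma fun x => ExtVan.adjunction (dayAdjunction S (s x))
    (hB x i (n - s x) (by have := hs x; omega) _ (hN.shift (by have := hs x; omega)))

/-- Every class in Ext^j(A, N) factors through A ⊛ K, and A ⊛ K differs from A ⊗ K only by the
kernel and cokernel of the comparison. The cokernel enters one degree higher, hence its better
regularity c - 1. -/
theorem Reg.of_toSig (hS : S.StandardConnectivity) {c : ℤ} (hc : 0 ≤ c) {A : S.UMod}
    (hk : ∀ s, Reg c (kernel (toSig s A))) (hk' : ∀ s, Reg (c - 1) (cokernel (toSig s A))) :
    Reg c A := by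
  intro j n hj N hN
  have := HasDerivedCategory.standard S.UMod
  refine ExtVan.of_homVan (dayRes S) (fun T hT => shortExact_map_dayRes hT) (singleToDayRes S) N
    (dayResToSingle hN) (singleToDayRes_comp_dayResToSingle hN) ?_
  let κ := dayToTensRes A
  -- In degree k ≤ 0 the kernel is a coproduct of ker(A ⟶ Σ^s A) ⊛ F_s with s ≤ -k, so Ext can be
  -- tested term by term.
  have h₁ : HomVan (kernel κ) N j := by
    have := isStrictlyLE_kernel κ fun k hk => (dayL A).map_isZero (isZero_res hk)
    refine HomVan.of_terms 0 fun k i hi => ?_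
    refine ExtVan.of_iso ((nonempty_sigma_iso_kernel_dayToTens (resRank S k) A).1.some ≪≫
      (PreservesKernel.iso (HomologicalComplex.eval S.UMod (.up ℤ) k) κ).symm)
      (ExtVan.sigma_dayR (fun _ => hk _) (resRank_le k) hi hj (by omega) hN)
  have h₂ : HomVan (cokernel κ) N (j + 1) := by
    have := isStrictlyLE_cokernel κ fun k hk => isZero_tensRes A hk
    refine HomVan.of_terms 0 fun k i hi => ?_
    refine ExtVan.of_iso ((nonempty_sigma_iso_kernel_dayToTens (resRank S k) A).2.some ≪≫
      (PreservesCokernel.iso (HomologicalComplex.eval S.UMod (.up ℤ) k) κ).symm)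
      (ExtVan.sigma_dayR (fun _ => hk' _) (resRank_le k) hi (by omega) (by omega) hN)
  -- The complex A ⊗ K is quasi-isomorphic to A ⊗ ℤ, which lives in rank 0 and is therefore
  -- 0-regular. As c ≥ 0, this suffices.
  have h₃ : HomVan (tensRes A) N j := by
    have := quasiIso_tensResToSingle A hS
    refine HomVan.of_quasiIso (tensResToSingle A) (HomVan.single_zero ?_)
    refine Reg.of_bounded hS (d := 0) (fun m hm => ?_) j n (by omega) N hN
    intro x
    refine LinearMap.congr_fun (f := LinearMap.id) (g := 0) (tens_linear_ext fun a b => ?_) x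
    have : b = 0 := unitMod_eq_zero (by omega) b
    subst this
    exact TensorProduct.tmul_zero _ _
  exact HomVan.mid (coimageSequence_shortExact κ) h₁
    (HomVan.left (imageSequence_shortExact κ) h₃ h₂)

end BraidedStabilityGroupoid

/-! ### The cokernel of a composite -/

section

variable {C : Type*} [Category* C] [Abelian C] {X Y Z : C} (g : X ⟶ Y) (f : Y ⟶ Z)

/-- The morphism between cokernels induced by postcomposition. -/
noncomputable def cokernelToComp : cokernel g ⟶ cokernel (g ≫ f) :=
  cokernel.desc g (f ≫ cokernel.π (g ≫ f)) (by rw [← Category.assoc, cokernel.condition])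

lemma π_cokernelToComp : cokernel.π g ≫ cokernelToComp g f = f ≫ cokernel.π (g ≫ f) :=
  cokernel.π_desc _ _ _

/-- The cokernel of `cokernelToComp`. -/
noncomputable def cokernelCokernelToComp : cokernel (cokernelToComp g f) ≅ cokernel f where
  hom := cokernel.desc _ (cokernel.desc (g ≫ f) (cokernel.π f) (by simp))
    (coequalizer.hom_ext (by
      rw [← Category.assoc, π_cokernelToComp, Category.assoc, cokernel.π_desc, comp_zero,
        cokernel.condition]))
  inv := cokernel.desc _ (cokernel.π (g ≫ f) ≫ cokernel.π _) (by
    rw [← Category.assoc, ← π_cokernelToComp, Category.assoc, cokernel.condition, comp_zero])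
  hom_inv_id := coequalizer.hom_ext (coequalizer.hom_ext (by simp))
  inv_hom_id := coequalizer.hom_ext (by simp)

end


namespace BraidedStabilityGroupoid

open StabilityGroupoid

variable {S : BraidedStabilityGroupoid.{u}}

/-! ### Boundedness -/

/-- `A` vanishes in ranks `> d`. -/
def Bdd (d : ℤ) (A : S.UMod) : Prop := ∀ n : ℕ, d < n → ∀ a : A.obj ⟨n⟩, a = 0

lemma Bdd.of_injective {d : ℤ} {A B : S.UMod} (f : A ⟶ B)
    (hf : ∀ m : ℕ, d < m → Function.Injective (f.app ⟨m⟩).hom) (h : Bdd d B) : Bdd d A :=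
  fun n hn _ => hf n hn ((h n hn _).trans (map_zero _).symm)

lemma Bdd.of_iso {d : ℤ} {A B : S.UMod} (e : A ≅ B) (h : Bdd d A) : Bdd d B :=
  .of_injective e.inv (fun m _ => (umod_mono_iff _).1 inferInstance m) h

lemma bdd_kernel_iff {d : ℤ} {A B : S.UMod} (f : A ⟶ B) :
    Bdd d (kernel f) ↔ ∀ m : ℕ, d < m → Function.Injective (f.app ⟨m⟩).hom := by
  constructor
  · intro h m hm
    refine (injective_iff_map_eq_zero _).2 fun a ha => ?_
    obtain ⟨b, rfl⟩ := exists_kernel ha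
    rw [h m hm b, map_zero]
  · intro h m hm b
    refine kernel_ι_injective f m (.trans (h m hm ?_) (map_zero _).symm)
    refine .trans ?_ (map_zero _).symm
    exact congrArg (fun φ : kernel f ⟶ B => (φ.app ⟨m⟩).hom b) (kernel.condition f)

lemma Reg.right {c : ℤ} {T : ShortComplex S.UMod} (hT : T.ShortExact) (h₁ : Reg (c + 1) T.X₁)
    (h₂ : Reg c T.X₂) : Reg c T.X₃ := fun j n hj N hN => by
  cases j with
  | zero => exact ExtVan.right_zero hT (h₂ 0 n hj N hN)
  | succ j => exact ExtVan.right hT (h₁ j n (by push_cast at hj; omega) N hN) (h₂ _ n hj N hN)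

/-- If y ∈ Y maps into the image of g ≫ f, say f(y) = f(g(x)), then injectivity of f in that rank
gives y = g(x). -/
lemma bdd_kernel_cokernelToComp {d : ℤ} {X Y Z : S.UMod} {g : X ⟶ Y} {f : Y ⟶ Z}
    (hf : Bdd d (kernel f)) : Bdd d (kernel (cokernelToComp g f)) := by
  rw [bdd_kernel_iff] at hf ⊢
  intro m hm
  refine (injective_iff_map_eq_zero _).2 fun x hx => ?_
  obtain ⟨y, rfl⟩ := (umod_epi_iff (cokernel.π g)).1 inferInstance m x
  have h₁ : ((cokernel.π (g ≫ f)).app ⟨m⟩).hom ((f.app ⟨m⟩).hom y) = 0 :=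
    (congrArg (fun φ : Y ⟶ _ => (φ.app ⟨m⟩).hom y) (π_cokernelToComp g f)).symm.trans hx
  obtain ⟨x, hx⟩ := ((umod_exact_iff _).1 (ShortComplex.exact_cokernel (g ≫ f)) m _).1 h₁
  have h₂ : (g.app ⟨m⟩).hom x = y := hf m hm hx
  rw [← h₂]
  exact congrArg (fun φ : X ⟶ _ => (φ.app ⟨m⟩).hom x) (cokernel.condition g)

/-- The cokernel of the composite is an extension of coker f by the image of coker g. That image is
a quotient of coker g by a bounded module, which may have regularity c + 1. -/
lemma Reg.cokernel_comp (hS : S.StandardConnectivity) {c : ℤ} {X Y Z : S.UMod} {g : X ⟶ Y}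
    {f : Y ⟶ Z} (hf : Bdd (c + 1) (kernel f)) (hg : Reg c (cokernel g)) (hf' : Reg c (cokernel f)) :
    Reg c (cokernel (g ≫ f)) :=
  Reg.mid (imageSequence_shortExact (cokernelToComp g f))
    (Reg.right (coimageSequence_shortExact (cokernelToComp g f))
      (Reg.of_bounded hS (bdd_kernel_cokernelToComp hf)) hg)
    (Reg.of_iso (cokernelCokernelToComp g f).symm hf')

/-! ### Iterated shifts -/

lemma rshMap_rshMap_one (s : ℕ) {m n : ℕ} (x : S.UHom m n) :
    S.rshMap 1 (S.rshMap s x) = S.rshMap (s + 1) x := by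
  induction x using UHom.ind with
  | H c h f =>
    rw [rshMap_mk, rshMap_mk, rshMap_mk, S.blk_assoc rfl _ rfl rfl, blk_one_one]

lemma lshMap_insR_one (p s : ℕ) : S.lshMap p (S.insR s 1) = S.insR (p + s) 1 := by
  rw [insR_eq, insR_eq, lshMap_mk, S.hexagon_right (l := p) (m := s) (n := 1) rfl rfl rfl rfl
    (by omega) (by omega), mul_inv_rev, ← map_inv, ← map_inv]
  simp only [Prod.inv_mk, inv_one]

/-- The last summand is added separately, which gives the factorization of A ⟶ Σ^{s+1} A used in the
induction on s. -/
lemma insR_succ (p s : ℕ) : S.insR p (s + 1) = UHom.comp (S.insR (p + s) 1) (S.insR p s) := by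
  rw [← lshMap_insR_one, insR.eq_def S p s, ← S.lshMap_comp, S.comp_ini, insR.eq_def]

/-- `Σ^s Σ A ≅ Σ^{s+1} A` -/
noncomputable def shiftSuccIso (s : ℕ) (A : S.UMod) :
    (S.shiftF s).obj ((S.shiftF 1).obj A) ≅ (S.shiftF (s + 1)).obj A where
  hom := umodHom (A := (S.shiftF s).obj ((S.shiftF 1).obj A)) (B := (S.shiftF (s + 1)).obj A)
    (fun p => LinearMap.id (M := A.obj ⟨p + s + 1⟩)) fun x a =>
      congrArg (fun y => act A y a) (rshMap_rshMap_one s x)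
  inv := umodHom (B := (S.shiftF s).obj ((S.shiftF 1).obj A)) (A := (S.shiftF (s + 1)).obj A)
    (fun p => LinearMap.id (M := A.obj ⟨p + s + 1⟩)) fun x a =>
      congrArg (fun y => act A y a) (rshMap_rshMap_one s x).symm
  hom_inv_id := umod_hom_ext fun _ _ => rfl
  inv_hom_id := umod_hom_ext fun _ _ => rfl

lemma toSig_succ (s : ℕ) (A : S.UMod) : toSig (s + 1) A =
    (toSig s A ≫ (S.shiftF s).map (toSig 1 A)) ≫ (shiftSuccIso s A).hom :=
  umod_hom_ext fun p a =>
    (congrArg (fun y => act A y a) (insR_succ p s)).trans (act_comp A _ _ a)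

lemma toSig_naturality (s : ℕ) {A B : S.UMod} (α : A ⟶ B) :
    toSig s A ≫ (S.shiftF s).map α = α ≫ toSig s B :=
  umod_hom_ext fun p a => app_act α (S.insR p s) a

/-- The endomorphism of `ΣΣA` induced by an endomorphism of `2`. -/
noncomputable def shiftEnd (A : S.UMod) (y : S.UHom 2 2) :
    (S.shiftF 1).obj ((S.shiftF 1).obj A) ⟶ (S.shiftF 1).obj ((S.shiftF 1).obj A) :=
  umodHom (A := (S.shiftF 1).obj ((S.shiftF 1).obj A)) (B := (S.shiftF 1).obj ((S.shiftF 1).obj A))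
    (fun p => (act A (S.lshMap p y) : A.obj ⟨p + 2⟩ →ₗ[ℤ] A.obj ⟨p + 2⟩)) fun {m n} x a => by
      refine (act_comp A (S.lshMap n y) (S.rshMap 1 (S.rshMap 1 x)) a).symm.trans ?_
      refine .trans ?_ (act_comp A (S.rshMap 1 (S.rshMap 1 x)) (S.lshMap m y) a)
      rw [rshMap_rshMap_one]
      exact congrArg (fun z => act A z a) (S.interchange x y).symm

lemma shiftEnd_comp (A : S.UMod) (y y' : S.UHom 2 2) :
    shiftEnd A y ≫ shiftEnd A y' = shiftEnd A (UHom.comp y' y) :=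
  umod_hom_ext fun p a => by
    refine (act_comp A (S.lshMap p y') (S.lshMap p y) a).symm.trans ?_
    rw [← S.lshMap_comp]
    rfl

lemma shiftEnd_id (A : S.UMod) : shiftEnd A (S.idHom 2) = 𝟙 _ :=
  umod_hom_ext fun p a => by
    refine (congrArg (fun z => act A z a) (S.lshMap_idHom p 2)).trans ?_
    exact act_idHom A a

/-- The action of the braiding on `ΣΣA`. -/
noncomputable def shiftBraid (A : S.UMod) :
    (S.shiftF 1).obj ((S.shiftF 1).obj A) ≅ (S.shiftF 1).obj ((S.shiftF 1).obj A) where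
  hom := shiftEnd A (UHom.mk 0 rfl (S.braid (m := 1) (n := 1) rfl))
  inv := shiftEnd A (UHom.mk 0 rfl (S.braid (m := 1) (n := 1) rfl)⁻¹)
  hom_inv_id := by rw [shiftEnd_comp, UHom.aut_comp_mk, inv_mul_cancel]; exact shiftEnd_id A
  inv_hom_id := by rw [shiftEnd_comp, UHom.aut_comp_mk, mul_inv_cancel]; exact shiftEnd_id A

lemma lshMap_aut (p : ℕ) {n : ℕ} (g : S.G n) :
    S.lshMap p (UHom.mk 0 (Nat.zero_add n) g : S.UHom n n) =
      UHom.mk 0 (Nat.zero_add (p + n)) (S.blk rfl (1, g)) := by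
  rw [lshMap_mk, S.braid_zero, inv_one, blk_one_one, mul_one]

/-- The two ways of inserting a new summand, before or after the last one, differ by b_{1,1}, by the
hexagon identity. -/
lemma rshMap_insR_one (p : ℕ) : S.rshMap 1 (S.insR p 1) =
    UHom.comp (S.lshMap p (UHom.mk 0 (Nat.zero_add 2) (S.braid (m := 1) (n := 1) rfl) :
      S.UHom 2 2)) (S.insR (p + 1) 1) := by
  rw [insR_eq, insR_eq, lshMap_aut, rshMap_mk, S.hexagon_right (l := p) (m := 1) (n := 1)
    (lm := p + 1) (mn := 2) (ln := p + 1) rfl rfl rfl rfl rfl rfl]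
  refine .trans ?_ (UHom.aut_comp_mk _ _ _ _).symm
  rw [mul_inv_rev, ← map_inv, ← map_inv, ← mul_assoc, ← map_mul, Prod.inv_mk,
    Prod.inv_mk, Prod.mk_mul_mk, mul_inv_cancel, mul_inv_cancel, inv_one, blk_one_one, one_mul]

lemma toSig_shift (A : S.UMod) : toSig 1 ((S.shiftF 1).obj A) =
    (S.shiftF 1).map (toSig 1 A) ≫ (shiftBraid A).hom :=
  umod_hom_ext fun p a =>
    (congrArg (fun y => act A y a) (rshMap_insR_one p)).trans (act_comp A _ _ a)

/-! ### Polynomial modules -/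

/-- Polynomial modules; the degree is shifted by one, so that `0` stands for `-∞`. -/
def Poly : ℕ → ℤ → S.UMod → Prop
  | 0, d, A => Bdd d A
  | r + 1, d, A => Bdd d (kernel (toSig 1 A)) ∧ Poly r (d - 1) (cokernel (toSig 1 A))

lemma Poly.of_iso {r : ℕ} {d : ℤ} {A B : S.UMod} (e : A ≅ B) (h : Poly r d A) : Poly r d B := by
  induction r generalizing d A B with
  | zero => exact Bdd.of_iso e h
  | succ r ih =>
    have w := toSig_naturality 1 e.hom
    exact ⟨.of_iso (kernel.mapIso _ _ e ((S.shiftF 1).mapIso e) w) h.1,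
      ih (cokernel.mapIso _ _ e ((S.shiftF 1).mapIso e) w) h.2⟩

lemma Bdd.shift {d : ℤ} {A : S.UMod} (s : ℕ) (h : Bdd d A) : Bdd d ((S.shiftF s).obj A) :=
  fun n hn => h (n + s) (by push_cast; omega)

/-- Up to the automorphism of ΣΣA given by b_{1,1}, the map ΣA ⟶ ΣΣA is the shift of A ⟶ ΣA. Since Σ
is exact, kernel and cokernel for ΣA are the shifts of those for A. -/
lemma Poly.shift_one {r : ℕ} {d : ℤ} {A : S.UMod} (h : Poly r d A) :
    Poly r d ((S.shiftF 1).obj A) := by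
  induction r generalizing d A with
  | zero => exact Bdd.shift 1 h
  | succ r ih =>
    have w : (S.shiftF 1).map (toSig 1 A) ≫ (shiftBraid A).hom =
      (Iso.refl ((S.shiftF 1).obj A)).hom ≫ toSig 1 ((S.shiftF 1).obj A) := by
      rw [toSig_shift, Iso.refl_hom, Category.id_comp]
    exact ⟨.of_iso (PreservesKernel.iso (S.shiftF 1) (toSig 1 A) ≪≫
        kernel.mapIso _ _ (Iso.refl _) (shiftBraid A) w) (h.1.shift 1),
      .of_iso (PreservesCokernel.iso (S.shiftF 1) (toSig 1 A) ≪≫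
        cokernel.mapIso _ _ (Iso.refl _) (shiftBraid A) w) (ih h.2)⟩

/-- `A ≅ Σ^0 A` -/
noncomputable def shiftZeroIso (A : S.UMod) : A ≅ (S.shiftF 0).obj A where
  hom := umodHom (B := (S.shiftF 0).obj A) (fun p => LinearMap.id (M := A.obj ⟨p⟩)) fun x a =>
    congrArg (fun y => act A y a) (S.rshMap_zero x).symm
  inv := umodHom (A := (S.shiftF 0).obj A) (fun p => LinearMap.id (M := A.obj ⟨p⟩)) fun x a =>
    congrArg (fun y => act A y a) (S.rshMap_zero x)
  hom_inv_id := umod_hom_ext fun _ _ => rfl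
  inv_hom_id := umod_hom_ext fun _ _ => rfl

lemma Poly.shift {r : ℕ} {d : ℤ} {A : S.UMod} (s : ℕ) (h : Poly r d A) :
    Poly r d ((S.shiftF s).obj A) := by
  induction s generalizing A with
  | zero => exact h.of_iso (shiftZeroIso A)
  | succ s ih => exact (ih h.shift_one).of_iso (shiftSuccIso s A)

lemma toSig_zero (A : S.UMod) : toSig 0 A = (shiftZeroIso A).hom :=
  umod_hom_ext fun p a => (congrArg (fun y => act A y a) (S.lshMap_idHom p 0)).trans (act_idHom A a)

/-- A_m → A_{m+s} is a composite of s maps of the form A_k → A_{k+1} with k ≥ m, each injective when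
m > d. -/
lemma bdd_kernel_toSig {d : ℤ} {A : S.UMod} (h : Bdd d (kernel (toSig 1 A))) (s : ℕ) :
    Bdd d (kernel (toSig s A)) := by
  rw [bdd_kernel_iff] at h ⊢
  induction s with
  | zero =>
    rw [toSig_zero]
    exact fun m _ => (umod_mono_iff _).1 inferInstance m
  | succ s ih =>
    intro m hm x y hxy
    refine ih m hm (h (m + s) (by push_cast; omega) ?_)
    refine (congrArg (fun z => act A z x) (insR_succ m s)).trans (act_comp A _ _ x) |>.symm.trans ?_
    exact hxy.trans ((congrArg (fun z => act A z y) (insR_succ m s)).trans (act_comp A _ _ y))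

/-- The index r is the polynomial degree plus one, whence r - 1. The kernels of A ⟶ Σ^s A vanish in
ranks > d; their cokernels are handled by an inner induction on s. -/
theorem Poly.reg (hS : S.StandardConnectivity) {r : ℕ} {d : ℤ} {A : S.UMod} (h : Poly r d A) :
    Reg (max d (r - 1)) A := by
  induction r generalizing d A with
  | zero => exact (Reg.of_bounded hS h).mono (le_max_left _ _)
  | succ r ih =>
    refine Reg.of_toSig hS (by push_cast; omega)
      (fun s => (Reg.of_bounded hS (bdd_kernel_toSig h.1 s)).mono (le_max_left _ _)) fun s => ?_
    induction s with
    | zero =>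
      rw [toSig_zero]
      exact (Reg.of_bounded hS (d := -1) fun m _ =>
        cokernel_eq_zero _ ((umod_epi_iff _).1 inferInstance m)).mono (by push_cast; omega)
    | succ s ihs =>
      rw [toSig_succ]
      -- The bound for the composite is c - 1 with c = max(d, r). The second factor is Σ^s applied
      -- to A ⟶ ΣA: its kernel vanishes in ranks > d, where d ≤ c, and its cokernel is polynomial of
      -- smaller degree in ranks > d - 1.
      refine Reg.of_iso (cokernelCompIsIso _ (shiftSuccIso s A).hom).symm ?_
      refine Reg.cokernel_comp hS ?_ ihs ?_
      · refine Bdd.of_iso (PreservesKernel.iso (S.shiftF s) (toSig 1 A)) fun m hm => ?_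
        exact h.1.shift s m (by push_cast at hm; omega)
      · refine Reg.of_iso (PreservesCokernel.iso (S.shiftF s) (toSig 1 A)) ?_
        exact (ih (h.2.shift s)).mono (by push_cast; omega)

lemma toShiftMod_eq (A : S.UMod) : S.toShiftMod A = toSig 1 A :=
  umod_hom_ext fun p a => congrArg (fun y => act A y a) (S.insR_eq p 1).symm

lemma IsPolynomial.poly {r : WithBot ℕ} {d : ℤ} {A : S.UMod} (h : S.IsPolynomial r d A) :
    Poly (r.recBotCoe 0 (· + 1)) d A := by
  induction h with
  | bot d A h => exact fun n hn => isZero_obj_iff.1 (h n hn)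
  | zero d A hker _ ih =>
    rw [toShiftMod_eq] at hker ih
    exact ⟨fun n hn => isZero_obj_iff.1 (hker n hn), ih⟩
  | succ r d A hker _ ih =>
    rw [toShiftMod_eq] at hker ih
    exact ⟨fun n hn => isZero_obj_iff.1 (hker n hn), ih⟩

/-! ### The product with the unit -/

section

variable {A B : S.UMod} {n : ℕ}

lemma mk_symb_add_left {p q : ℕ} (h : p + q = n) (a a' : A.obj ⟨p⟩) (b : B.obj ⟨q⟩) (g : S.G n) :
    (S.relations A B n).mkQ (symb h (a + a') b g) =
      (S.relations A B n).mkQ (symb h a b g) + (S.relations A B n).mkQ (symb h a' b g) := by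
  rw [← map_add]
  exact (Submodule.Quotient.eq _).2 (Submodule.subset_span (.add_left ..))

lemma mk_symb_add_right {p q : ℕ} (h : p + q = n) (a : A.obj ⟨p⟩) (b b' : B.obj ⟨q⟩) (g : S.G n) :
    (S.relations A B n).mkQ (symb h a (b + b') g) =
      (S.relations A B n).mkQ (symb h a b g) + (S.relations A B n).mkQ (symb h a b' g) := by
  rw [← map_add]
  exact (Submodule.Quotient.eq _).2 (Submodule.subset_span (.add_right ..))

lemma mk_symb_zero_right {p q : ℕ} (h : p + q = n) (a : A.obj ⟨p⟩) (g : S.G n) :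
    (S.relations A B n).mkQ (symb h a (0 : B.obj ⟨q⟩) g) = 0 := by
  have := mk_symb_add_right h a (0 : B.obj ⟨q⟩) 0 g
  rwa [add_zero, left_eq_add] at this

lemma mk_symb_aut {p q : ℕ} (h : p + q = n) (x : S.G p) (a : A.obj ⟨p⟩) (b : B.obj ⟨q⟩)
    (g : S.G n) : (S.relations A B n).mkQ (symb h (act A (S.ofAut x) a) b g) =
      (S.relations A B n).mkQ (symb h a b (g * S.blk h (x, 1))) := by
  have h' : (S.relations A B n).mkQ (symb h (act A (S.ofAut x) a) (act B (S.ofAut 1) b) g) =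
    (S.relations A B n).mkQ (symb h a b (g * S.blk h (x, 1))) :=
    (Submodule.Quotient.eq _).2 (Submodule.subset_span (.equivariant h x 1 a b g))
  exact (congrArg (fun y => (S.relations A B n).mkQ (symb h (act A (S.ofAut x) a) y g))
    (act_idHom B b)).symm.trans h'

lemma mk_symb_balanced {p c q pc cq : ℕ} (hpc : p + c = pc) (h : pc + q = n) (hcq : c + q = cq)
    (h' : p + cq = n) (a : A.obj ⟨p⟩) (b : B.obj ⟨q⟩) (g : S.G n) :
    (S.relations A B n).mkQ (symb h (act A (S.insRight hpc) a) b g) =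
      (S.relations A B n).mkQ (symb h' a (act B (S.insLeft hcq) b) g) :=
  (Submodule.Quotient.eq _).2 (Submodule.subset_span (.balanced ..))

end

section

variable (A : S.UMod) (n : ℕ)

/-- The class of `a ⊗ 1`. -/
noncomputable def unitSymb : A.obj ⟨n⟩ →ₗ[ℤ] TensorObj S A S.unitMod n :=
  intLinear (fun a => (S.relations A S.unitMod n).mkQ (symb (Nat.add_zero n) a (unitGen S 0) 1))
    fun _ _ => mk_symb_add_left ..

variable {A n}

lemma unitSymb_apply (a : A.obj ⟨n⟩) : unitSymb A n a =
    (S.relations A S.unitMod n).mkQ (symb (Nat.add_zero n) a (unitGen S 0) 1) := rfl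

lemma tensorMap_unitSymb {A' : S.UMod} (φ : A ⟶ A') (a : A.obj ⟨n⟩) :
    S.tensorMap φ S.unitMod n (unitSymb A n a) = unitSymb A' n ((φ.app ⟨n⟩).hom a) :=
  tensorMap_symb ..

lemma unitSymb_aut (g : S.G n) (a : A.obj ⟨n⟩) : unitSymb A n (act A (S.ofAut g) a) =
    (S.relations A S.unitMod n).mkQ (symb (Nat.add_zero n) a (unitGen S 0) g) := by
  rw [unitSymb_apply, mk_symb_aut, S.blk_one, one_mul]

/-- In a symbol a ⊗ b ⊗ g the element b vanishes unless q = 0, and then g can be absorbed into a. -/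
lemma unitSymb_surjective : Function.Surjective (unitSymb A n) := by
  rw [← LinearMap.range_eq_top, ← Submodule.ker_mkQ (LinearMap.range (unitSymb A n)),
    LinearMap.ker_eq_top]
  refine tensorObj_hom_ext fun {p q} h a b g => ?_
  refine (Submodule.Quotient.mk_eq_zero _).2 ?_
  by_cases hq : q = 0
  · subst hq
    have hp : p = n := h
    subst hp
    obtain ⟨k, rfl⟩ := exists_zsmul_unitGen b
    refine ⟨k • act A (S.ofAut g) a, ?_⟩
    rw [map_zsmul, unitSymb_aut]
    exact ((intLinear (fun b => (S.relations A S.unitMod p).mkQ (symb h a b g))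
      fun _ _ => mk_symb_add_right ..).map_smul k (unitGen S 0)).symm
  · rw [unitMod_eq_zero hq b, mk_symb_zero_right]
    exact zero_mem _

/-- The inverse of `unitSymb`, modulo decomposables. -/
noncomputable def unitCoord (s : Symb S A S.unitMod n) : A.obj ⟨n⟩ ⧸ decomp n A n :=
  coef s.q s.b • (decomp n A n).mkQ (act A (UHom.mk s.q ((Nat.add_comm _ _).trans s.h) s.g) s.a)

lemma linearCombination_unitCoord {p q : ℕ} (h : p + q = n) (a : A.obj ⟨p⟩)
    (b : S.unitMod.obj ⟨q⟩) (g : S.G n) :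
    Finsupp.linearCombination ℤ unitCoord (symb h a b g) = coef q b •
      (decomp n A n).mkQ (act A (UHom.mk q ((Nat.add_comm _ _).trans h) g) a) :=
  (Finsupp.linearCombination_single ℤ _ _).trans (one_smul ℤ _)

lemma coef_eq_zero {q : ℕ} (hq : q ≠ 0) (b : S.unitMod.obj ⟨q⟩) : coef q b = 0 := by
  rw [unitMod_eq_zero hq b, map_zero]

lemma mkQ_act_eq_zero {m : ℕ} (hm : m < n) (f : S.UHom m n) (a : A.obj ⟨m⟩) :
    (decomp n A n).mkQ (act A f a) = 0 :=
  (Submodule.Quotient.mk_eq_zero _).2 (Submodule.subset_span (Or.inr ⟨m, hm, f, a, rfl⟩))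

/-- Only symbols with q = 0 contribute. In a balancing relation with c > 0 one side has coefficient
0 and the other is decomposable; with c = 0 the two sides agree. -/
lemma unitCoord_relations : S.relations A S.unitMod n ≤
    LinearMap.ker (Finsupp.linearCombination ℤ (unitCoord (A := A) (n := n))) := by
  refine Submodule.span_le.2 fun x hx => LinearMap.mem_ker.2 ?_
  cases hx with
  | add_left h a a' b g =>
    rw [map_sub, map_add, linearCombination_unitCoord, linearCombination_unitCoord,
      linearCombination_unitCoord, map_add, map_add, zsmul_add, sub_self]
  | add_right h a b b' g =>
    rw [map_sub, map_add, linearCombination_unitCoord, linearCombination_unitCoord,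
      linearCombination_unitCoord, map_add, add_zsmul, sub_self]
  | @equivariant p q h x y a b g =>
    rw [map_sub, linearCombination_unitCoord, linearCombination_unitCoord]
    by_cases hq : q = 0
    · subst hq
      obtain ⟨k, rfl⟩ := exists_zsmul_unitGen b
      have h₁ : (S.unitMod.map (S.ofAut y)).hom (k • unitGen S 0) = k • unitGen S 0 := map_zsmul _ _ _
      have h₂ : act A (UHom.mk 0 ((Nat.add_comm _ _).trans h) g) (act A (S.ofAut x) a) =
          act A (UHom.mk 0 ((Nat.add_comm _ _).trans h) (g * S.blk h (x, y))) a := by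
        have hp : p = n := h
        subst hp
        rw [← act_comp, Subsingleton.elim (h := S.subsingleton_zero) y 1, S.blk_one]
        exact congrArg (fun f => act A f a) (UHom.aut_comp_mk _ _ _ _)
      rw [h₁, sub_eq_zero]
      exact congrArg (fun z => coef 0 (k • unitGen S 0) • (decomp n A n).mkQ z) h₂
    · rw [coef_eq_zero hq, coef_eq_zero hq, zero_zsmul, zero_zsmul, sub_zero]
  | @balanced p c q pc cq hpc h hcq h' a b g =>
    rw [map_sub, linearCombination_unitCoord, linearCombination_unitCoord]
    by_cases hc : c = 0
    · subst hc
      have hp : p = pc := hpc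
      subst hp
      obtain rfl : q = cq := by omega
      have h₁ : S.insRight hpc = S.idHom p := congrArg (UHom.mk 0 _) (by rw [S.braid_zero, inv_one])
      have h₂ : (A.map (S.insRight hpc)).hom a = a :=
        (congrArg (fun f => act A f a) h₁).trans (act_idHom A a)
      have h₃ : (S.unitMod.map (S.insLeft hcq)).hom b = b := act_idHom S.unitMod b
      rw [h₂, h₃, sub_self]
    · have h₁ : act A (UHom.mk q ((Nat.add_comm _ _).trans h) g) ((A.map (S.insRight hpc)).hom a) =
        act A (UHom.comp (UHom.mk q ((Nat.add_comm _ _).trans h) g) (S.insRight hpc)) a :=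
        (act_comp A _ _ a).symm
      rw [coef_eq_zero (q := cq) (by omega), zero_zsmul, sub_zero, h₁,
        mkQ_act_eq_zero (m := p) (by omega), zsmul_zero]

/-- With surjectivity this computes (A ⊛ ℤ)_n as A_n modulo decomposables. -/
lemma unitSymb_eq_zero_iff (a : A.obj ⟨n⟩) : unitSymb A n a = 0 ↔ a ∈ decomp n A n := by
  constructor
  · intro h
    have h₁ := LinearMap.mem_ker.1 (unitCoord_relations ((Submodule.Quotient.mk_eq_zero _).1 h))
    rw [linearCombination_unitCoord, coef_gen, one_smul] at h₁
    have h₂ := (Submodule.Quotient.mk_eq_zero _).1 h₁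
    rwa [show act A (UHom.mk 0 _ 1) a = a from act_idHom A a] at h₂
  · refine fun h => Submodule.span_le (p := LinearMap.ker (unitSymb A n)).2 ?_ h
    rintro _ (hn | ⟨m, hm, f, b, rfl⟩)
    · exact absurd rfl hn
    · induction f using UHom.ind with
      | H c h g =>
        -- A morphism with complement c is id_m ⊕ ι_c followed by an automorphism. Balancing moves
        -- ι_c to the unit, where it is zero since c > 0.
        have e : (UHom.mk c h g : S.UHom m n) = UHom.comp (S.ofAut (g * S.braid (m := m) (n := c)
            ((Nat.add_comm _ _).trans h))) (S.insRight ((Nat.add_comm _ _).trans h)) := by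
          refine .trans ?_ (UHom.aut_comp_mk _ _ _ _).symm
          rw [mul_inv_cancel_right]
        refine (congrArg (fun f => unitSymb A n (act A f b)) e).trans ?_
        rw [act_comp, unitSymb_aut, mk_symb_balanced _ _ (Nat.add_zero c)
          ((Nat.add_comm _ _).trans h), unitMod_eq_zero (n := c) (by omega) (act _ _ _),
          mk_symb_zero_right]

end

/-! ### Vanishing of `Tor` -/

/-- Decomposables of B lift to decomposables of P as p is surjective in all ranks, and the error
lies in ker p, hence in the image of e. -/
lemma exists_sub_mem_decomp {P' P B : S.UMod} {e : P' ⟶ P} {p : P ⟶ B} {n : ℕ}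
    (hp : ∀ m, Function.Surjective (p.app ⟨m⟩).hom)
    (he : ∀ x : P.obj ⟨n⟩, (p.app ⟨n⟩).hom x = 0 → ∃ z, (e.app ⟨n⟩).hom z = x) {x : P.obj ⟨n⟩}
    (hx : (p.app ⟨n⟩).hom x ∈ decomp n B n) :
    ∃ z, x - (e.app ⟨n⟩).hom z ∈ decomp n P n := by
  have h : decomp n B n ≤ (decomp n P n).map (p.app ⟨n⟩).hom := by
    refine Submodule.span_le.2 ?_
    rintro _ (hn | ⟨m, hm, f, b, rfl⟩)
    · exact absurd rfl hn
    · obtain ⟨y, rfl⟩ := hp m b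
      exact ⟨act P f y, Submodule.subset_span (Or.inr ⟨m, hm, f, y, rfl⟩), app_act p f y⟩
  obtain ⟨y, hy, hyx⟩ := h hx
  obtain ⟨z, hz⟩ := he (x - y) (by rw [map_sub, hyx, sub_self])
  exact ⟨z, by rwa [hz, sub_sub_cancel]⟩

lemma exists_tensorMap {P' P B : S.UMod} {e : P' ⟶ P} {p : P ⟶ B} {n : ℕ}
    (hp : ∀ m, Function.Surjective (p.app ⟨m⟩).hom)
    (he : ∀ x : P.obj ⟨n⟩, (p.app ⟨n⟩).hom x = 0 → ∃ z, (e.app ⟨n⟩).hom z = x) {x : P.obj ⟨n⟩}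
    (hx : (p.app ⟨n⟩).hom x ∈ decomp n B n) :
    ∃ y, S.tensorMap e S.unitMod n y = unitSymb P n x := by
  obtain ⟨z, hz⟩ := exists_sub_mem_decomp hp he hx
  refine ⟨unitSymb P' n z, ?_⟩
  rw [tensorMap_unitSymb, eq_comm, ← sub_eq_zero, ← map_sub]
  exact (unitSymb_eq_zero_iff _).2 hz

lemma app_decomp {A N : S.UMod} {n : ℕ} (hN : SuppAt n N) (g : A ⟶ N) {a : A.obj ⟨n⟩}
    (ha : a ∈ decomp n A n) : (g.app ⟨n⟩).hom a = 0 := by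
  refine Submodule.span_le (p := LinearMap.ker (g.app ⟨n⟩).hom).2 ?_ ha
  rintro _ (hn | ⟨m, hm, f, b, rfl⟩)
  · exact absurd rfl hn
  · refine (app_act g f b).trans ?_
    rw [hN m hm.ne ((g.app ⟨m⟩).hom b), map_zero]

/-- The value of a `𝒢`-module in degree `n`. -/
abbrev degF (S : BraidedStabilityGroupoid.{u}) (n : ℕ) : S.GMod ⥤ ModuleCat.{u} ℤ :=
  (evaluation _ _).obj ⟨n, SingleObj.star _⟩

/-- Evaluation in degree n is exact, so the homology can be computed from the complex of abelian
groups (P_* ⊛ ℤ)_n. -/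
lemma isZero_tor_of_exact {A : S.UMod} (P : ProjectiveResolution A) (n : ℕ) {i j k : ℕ}
    (hj : (ComplexShape.down ℕ).prev i = j) (hk : (ComplexShape.down ℕ).next i = k)
    (h : ∀ x : TensorObj S (P.complex.X i) S.unitMod n,
      S.tensorMap (P.complex.d i k) S.unitMod n x = 0 →
        ∃ y, S.tensorMap (P.complex.d j i) S.unitMod n y = x) :
    IsZero (S.deg (S.tor i A) n) := by
  let K := ((S.tensorRight S.unitMod).mapHomologicalComplex (.down ℕ)).obj P.complex
  have h₁ : ((K.sc' j i k).map (degF S n)).Exact :=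
    (ShortComplex.moduleCat_exact_iff _).2 fun x hx => h x hx
  have h₂ : ((K.sc i).map (degF S n)).Exact :=
    (ShortComplex.exact_iff_of_iso ((degF S n).mapShortComplex.mapIso (K.isoSc' j i k hj hk))).2 h₁
  have h₃ : IsZero ((degF S n).obj (K.homology i)) :=
    ((ShortComplex.exact_iff_isZero_homology _).1 h₂).of_iso
      ((K.sc i).mapHomologyIso (degF S n)).symm
  exact h₃.of_iso ((degF S n).mapIso (P.isoLeftDerivedObj (S.tensorRight S.unitMod) i))

/-- A cycle of (P_i ⊛ ℤ)_n is a boundary once its image in the next syzygy is decomposable there.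
Vanishing of Ext with coefficients in the indecomposables of that syzygy provides this; for i = 0
the syzygy is A itself. -/
theorem isZero_tor {A : S.UMod} {i n : ℕ} (h : ∀ N, SuppAt n N → ExtVan A N i) :
    IsZero (S.deg (S.tor i A) n) := by
  let P := ProjectiveResolution.of A
  cases i with
  | zero =>
    refine isZero_tor_of_exact P n (j := 1) (k := 0) (by simp) (by simp) fun x _ => ?_
    obtain ⟨x, rfl⟩ := unitSymb_surjective x
    let p : P.complex.X 0 ⟶ A := P.π.f 0
    have hp : Epi p := inferInstanceAs (Epi (P.π.f 0))
    refine exists_tensorMap (p := p) ((umod_epi_iff p).1 hp)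
      (fun x hx => ((umod_exact_iff _).1 P.exact₀ n x).1 hx) ?_
    refine (indecπ_eq_zero_iff _).1 ?_
    have := ExtVan.zero_iff.1 (h _ (suppAt_indec n A)) (indecπ n A)
    rw [this]
    rfl
  | succ i =>
    refine isZero_tor_of_exact P n (j := i + 2) (k := i) (by simp) (by simp) fun x hx => ?_
    obtain ⟨x, rfl⟩ := unitSymb_surjective x
    let d := P.complex.d (i + 1) i
    let p := Abelian.factorThruImage d
    have hd : p ≫ Abelian.image.ι d = d := Abelian.image.fac d
    have hd' (x) : ((Abelian.image.ι d).app ⟨n⟩).hom ((p.app ⟨n⟩).hom x) = (d.app ⟨n⟩).hom x :=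
      congrArg (fun φ : P.complex.X (i + 1) ⟶ P.complex.X i => (φ.app ⟨n⟩).hom x) hd
    refine exists_tensorMap (p := p) ((umod_epi_iff p).1 inferInstance)
      (fun x hx => ((umod_exact_iff _).1 (P.exact_succ i) n x).1 ?_) ?_
    · refine (hd' x).symm.trans ?_
      rw [hx, map_zero]
    -- The projection of P_{i+1} to the rank n indecomposables of the image of d is a cocycle. Ext
    -- vanishing extends it to a map g on P_i, and g kills d(x) because d(x) is decomposable.
    · have hf : P.complex.d (i + 2) (i + 1) ≫ p ≫ indecπ n (Abelian.image d) = 0 := by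
        rw [← Category.assoc]
        refine (congrArg (· ≫ indecπ n (Abelian.image d)) ?_).trans zero_comp
        rw [← cancel_mono (Abelian.image.ι d), Category.assoc, hd, zero_comp]
        exact P.complex.d_comp_d _ _ _
      obtain ⟨g, hg⟩ := (P.extMk_eq_zero_iff (p ≫ indecπ n (Abelian.image d)) (i + 2) rfl hf i
        rfl).1 (h _ (suppAt_indec n _) _)
      refine (indecπ_eq_zero_iff _).1 ?_
      refine (congrArg (fun φ : P.complex.X (i + 1) ⟶ _ => (φ.app ⟨n⟩).hom x) hg).symm.trans ?_
      refine app_decomp (suppAt_indec n _) g ((unitSymb_eq_zero_iff _).1 ?_)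
      exact (tensorMap_unitSymb _ _).symm.trans hx

end BraidedStabilityGroupoid

/-- The vanishing of `Tor_i^{ℤ̲}(A, ℤ)_n` for `n > i + max(d, r)`, where `r` may be `-∞`. -/
theorem mainTheorem4 (S : BraidedStabilityGroupoid.{u}) (hS : S.StandardConnectivity)
    (r : WithBot ℕ) (d : ℤ) (A : S.UMod) (hA : S.IsPolynomial r d A) (i n : ℕ)
    (hn : ((i : ℤ) : WithBot ℤ) + max (d : WithBot ℤ) (r.map (fun k : ℕ => (k : ℤ))) <
      ((n : ℤ) : WithBot ℤ)) :
    IsZero (S.deg (S.tor i A) n) := by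
  refine BraidedStabilityGroupoid.isZero_tor fun N hN => ?_
  induction r with
  | bot =>
    -- For r = -∞ the bound is d itself, so boundedness is used directly; the general estimate would
    -- only give max(d, -1).
    rw [WithBot.map_bot, max_bot_right, ← WithBot.coe_add, WithBot.coe_lt_coe] at hn
    exact BraidedStabilityGroupoid.Reg.of_bounded hS hA.poly i n hn N hN
  | coe k =>
    rw [WithBot.map_coe, ← WithBot.coe_max, ← WithBot.coe_add, WithBot.coe_lt_coe] at hn
    have h : BraidedStabilityGroupoid.Poly (k + 1) d A := hA.poly
    exact h.reg hS i n (by push_cast; omega) N hN
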